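/- Let $\mathcal C$ be a monoidal bicategory (for example a symmetric monoidal one). Let $\mathrm{Aut}_\otimes(\mathcal C)$ be the monoidal bicategory whose objects are the monoidal weak 2-functors $\mathcal C\to\mathcal C$ that are biequivalences, whose 1-cells are the invertible monoidal pseudo-natural transformations (those with equivalences as components), whose 2-cells are the invertible monoidal modifications, and whose tensor product is composition. For an abelian group $H$ let $B^2H$ be the monoidal bicategory with one object, one 1-cell, and $H$ as group of 2-cells, both compositions and the tensor product of 2-cells being the multiplication of $H$ and all structure cells being identities. Let $G$ be a path-connected topological group with $\pi_2(G,x)$ trivial for every $x\in G$, and let $\Pi_2(G)$ be its fundamental 2-groupoid (objects are the points of $G$, 1-cells are paths, 2-cells are classes of homotopies of paths relative to the end points, two such homotopies being identified if they are homotopic relative to their boundary), which is a monoidal bicategory under the pointwise multiplication of $G$. A monoidal homotopy action of $G$ on $\mathcal C$ is a weak monoidal 2-functor $\rho:\Pi_2(G)\to \mathrm{Aut}_\otimes(\mathcal C)$. The trivial one is constant at the unit object $\mathrm{id}_{\mathcal C}$, with the structure cells given by the unit constraints of $\mathrm{Aut}_\otimes(\mathcal C)$. Suppose that $\mathrm{Aut}_\otimes(\mathcal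 C)$ is monoidally equivalent to $B^2H$ for an abelian group $H$, i.e. that there is a weak monoidal 2-functor $\mathrm{Aut}_\otimes(\mathcal C)\to B^2H$ which is a biequivalence, and that the group cohomology $H^2_{\mathrm{grp}}(\pi_1(G,e),H)$ with trivial coefficients vanishes. Then for every monoidal homotopy action $\rho$ of $G$ on $\mathcal C$ there is a monoidal pseudo-natural transformation from $\rho$ to the trivial action all of whose components are equivalences. -/

import Mathlib

open CategoryTheory Bicategory
open scoped CategoryTheory.Pseudofunctor.StrongTrans

noncomputable section

namespace MonBicat

universe w₁ v₁ u₁ w₂ v₂ u₂ w₃ v₃ u₃ w₄ v₄ u₄ u v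

section Squares

variable {B : Type u₁} [Bicategory.{w₁, v₁} B] {C : Type u₂} [Bicategory.{w₂, v₂} C]

/-- An invertible square in a bicategory, with top edge `f`, bottom edge `g`, left edge `u` and
right edge `v`. -/
abbrev Sq {a b c d : B} (f : a ⟶ b) (g : c ⟶ d) (u : a ⟶ c) (v : b ⟶ d) := f ≫ v ≅ u ≫ g

/-- Stacking of squares along a common horizontal edge. -/
def vcomp {a b c d e k : B} {f : a ⟶ b} {g : c ⟶ d} {h : e ⟶ k} {u : a ⟶ c} {v : b ⟶ d}
    {u' : c ⟶ e} {v' : d ⟶ k} (Q : Sq f g u v) (R : Sq g h u' v') :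
    Sq f h (u ≫ u') (v ≫ v') :=
  (α_ f v v').symm ≪≫ whiskerRightIso Q v' ≪≫ α_ u g v' ≪≫ whiskerLeftIso u R ≪≫
    (α_ u u' h).symm

/-- Pasting of squares along a common vertical edge. -/
def hcomp {a b c d e k : B} {f : a ⟶ b} {g : c ⟶ d} {u : a ⟶ c} {v : b ⟶ d} {f' : b ⟶ e}
    {g' : d ⟶ k} {w : e ⟶ k} (Q : Sq f g u v) (R : Sq f' g' v w) :
    Sq (f ≫ f') (g ≫ g') u w :=
  α_ f f' w ≪≫ whiskerLeftIso f R ≪≫ (α_ f v g').symm ≪≫ whiskerRightIso Q g' ≪≫ α_ u g g'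

/-- The identity square on a horizontal edge. -/
def idV {a b : B} (f : a ⟶ b) : Sq f f (𝟙 a) (𝟙 b) := ρ_ f ≪≫ (λ_ f).symm

/-- The identity square on a vertical edge. -/
def idH {a b : B} (u : a ⟶ b) : Sq (𝟙 a) (𝟙 b) u u := λ_ u ≪≫ (ρ_ u).symm

/-- The image of a square under a pseudofunctor. -/
def mapSq (F : B ⥤ᵖ C) {a b c d : B} {f : a ⟶ b} {g : c ⟶ d} {u : a ⟶ c} {v : b ⟶ d}
    (Q : Sq f g u v) : Sq (F.map f) (F.map g) (F.map u) (F.map v) :=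
  (F.mapComp f v).symm ≪≫ F.map₂Iso Q ≪≫ F.mapComp u g

/-- Replacing the vertical edges of a square by isomorphic ones. -/
def adj {a b c d : B} {f : a ⟶ b} {g : c ⟶ d} {u u' : a ⟶ c} {v v' : b ⟶ d} (i : u' ≅ u)
    (Q : Sq f g u v) (j : v' ≅ v) : Sq f g u' v' :=
  whiskerLeftIso f j ≪≫ Q ≪≫ whiskerRightIso i.symm g

/-- The image under a pseudofunctor of a 2-isomorphism from a path of length two to a 1-cell. -/
def map21 (F : B ⥤ᵖ C) {a b c : B} {f : a ⟶ b} {g : b ⟶ c} {h : a ⟶ c} (η : f ≫ g ≅ h) :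
    F.map f ≫ F.map g ≅ F.map h :=
  (F.mapComp f g).symm ≪≫ F.map₂Iso η

/-- The image under a pseudofunctor of a 2-isomorphism from a path of length three to a path of
length two. -/
def map32 (F : B ⥤ᵖ C) {a b c d e : B} {f : a ⟶ b} {g : b ⟶ c} {h : c ⟶ d} {k : a ⟶ e}
    {l : e ⟶ d} (η : f ≫ g ≫ h ≅ k ≫ l) :
    F.map f ≫ F.map g ≫ F.map h ≅ F.map k ≫ F.map l :=
  whiskerLeftIso _ (F.mapComp g h).symm ≪≫ (F.mapComp f (g ≫ h)).symm ≪≫ F.map₂Iso η ≪≫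
    F.mapComp k l

/-- A 1-cell of a bicategory is an equivalence. -/
def IsEquiv₁ {a b : B} (f : a ⟶ b) : Prop := ∃ e : a ≌ b, e.hom = f

end Squares

section Products

variable {A : Type u₁} [Bicategory.{w₁, v₁} A] {B : Type u₂} [Bicategory.{w₂, v₂} B]
  {C : Type u₃} [Bicategory.{w₃, v₃} C] {D : Type u₄} [Bicategory.{w₄, v₄} D]

/-- The product of two pseudofunctors. -/
def prodMap (F : A ⥤ᵖ B) (G : C ⥤ᵖ D) : (A × C) ⥤ᵖ (B × D) where
  obj x := (F.obj x.1, G.obj x.2)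
  map f := (F.map f.1, G.map f.2)
  map₂ η := (F.map₂ η.1, G.map₂ η.2)
  mapId x := Iso.prod (F.mapId x.1) (G.mapId x.2)
  mapComp f g := Iso.prod (F.mapComp f.1 g.1) (G.mapComp f.2 g.2)
  map₂_id _ := Prod.ext (by simp) (by simp)
  map₂_comp _ _ := Prod.ext (by simp) (by simp)
  map₂_whisker_left _ _ _ _ := Prod.ext (by simp) (by simp)
  map₂_whisker_right _ _ := Prod.ext (by simp) (by simp)
  map₂_associator _ _ _ := Prod.ext (by simp) (by simp)
  map₂_left_unitor _ := Prod.ext (by simp) (by simp)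
  map₂_right_unitor _ := Prod.ext (by simp) (by simp)

/-- The reassociation pseudofunctor of a triple product. -/
def reassoc (A : Type u₁) [Bicategory.{w₁, v₁} A] (B : Type u₂) [Bicategory.{w₂, v₂} B]
    (C : Type u₃) [Bicategory.{w₃, v₃} C] : ((A × B) × C) ⥤ᵖ (A × (B × C)) where
  obj x := (x.1.1, (x.1.2, x.2))
  map f := (f.1.1, (f.1.2, f.2))
  map₂ η := (η.1.1, (η.1.2, η.2))
  mapId x := Iso.refl _
  mapComp f g := Iso.refl _
  map₂_whisker_left _ _ _ _ := Prod.ext (by simp) (Prod.ext (by simp) (by simp))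
  map₂_whisker_right _ _ := Prod.ext (by simp) (Prod.ext (by simp) (by simp))
  map₂_associator _ _ _ := Prod.ext (by simp) (Prod.ext (by simp) (by simp))
  map₂_left_unitor _ := Prod.ext (by simp) (Prod.ext (by simp) (by simp))
  map₂_right_unitor _ := Prod.ext (by simp) (Prod.ext (by simp) (by simp))

end Products

end MonBicat

namespace MonBicat

universe w₁ v₁ u₁ w₂ v₂ u₂ w₃ v₃ u₃ w₄ v₄ u₄ u v

section Tensor

variable {B : Type u₁} [Bicategory.{w₁, v₁} B] (T : (B × B) ⥤ᵖ B)

/-- The tensor product of objects. -/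
abbrev tobj (a b : B) : B := T.obj (a, b)

variable {a b c a' b' c' d d' : B}

/-- The tensor product of 1-cells. -/
def tmap (f : a ⟶ a') (g : b ⟶ b') : tobj T a b ⟶ tobj T a' b' :=
  T.map (X := (a, b)) (Y := (a', b')) (f, g)

/-- The tensor product of 2-isomorphisms. -/
def tiso {f f' : a ⟶ a'} {g g' : b ⟶ b'} (η : f ≅ f') (θ : g ≅ g') :
    tmap T f g ≅ tmap T f' g' :=
  T.map₂Iso (a := (a, b)) (b := (a', b')) (Iso.prod η θ)

/-- The tensor product of 1-cells is compatible with composition. -/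
def tcomp {f : a ⟶ a'} {f' : a' ⟶ c} {g : b ⟶ b'} {g' : b' ⟶ d} :
    tmap T (f ≫ f') (g ≫ g') ≅ tmap T f g ≫ tmap T f' g' :=
  T.mapComp (a := (a, b)) (b := (a', b')) (c := (c, d)) (f, g) (f', g')

/-- The tensor product of 1-cells is compatible with identities. -/
def tid (a b : B) : tmap T (𝟙 a) (𝟙 b) ≅ 𝟙 (tobj T a b) := T.mapId (a, b)

/-- The tensor product of squares. -/
def tsq {f : a ⟶ b} {g : c ⟶ d} {u : a ⟶ c} {v : b ⟶ d} {f' : a' ⟶ b'}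
    {g' : c' ⟶ d'} {u' : a' ⟶ c'} {v' : b' ⟶ d'} (Q : Sq f g u v) (R : Sq f' g' u' v') :
    Sq (tmap T f f') (tmap T g g') (tmap T u u') (tmap T v v') :=
  (tcomp T).symm ≪≫ tiso T Q R ≪≫ tcomp T

/-- The pseudofunctor `a ⊗ -`. -/
def tensorL (a : B) : B ⥤ᵖ B := (Bicategory.Prod.sectR a B).toPseudofunctor.comp T

/-- The pseudofunctor `- ⊗ b`. -/
def tensorR (b : B) : B ⥤ᵖ B := (Bicategory.Prod.sectL B b).toPseudofunctor.comp T

/-- `a ⊗ -` preserves composition. -/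
def lcomp (a : B) (f : b ⟶ c) (g : c ⟶ d) :
    tmap T (𝟙 a) (f ≫ g) ≅ tmap T (𝟙 a) f ≫ tmap T (𝟙 a) g := (tensorL T a).mapComp f g

/-- `- ⊗ a` preserves composition. -/
def rcomp (a : B) (f : b ⟶ c) (g : c ⟶ d) :
    tmap T (f ≫ g) (𝟙 a) ≅ tmap T f (𝟙 a) ≫ tmap T g (𝟙 a) := (tensorR T a).mapComp f g

/-- Whiskering with an object on the left a 2-isomorphism from a path of length two to a 1-cell. -/
def tl21 (x : B) {f : a ⟶ b} {g : b ⟶ c} {h : a ⟶ c} (η : f ≫ g ≅ h) :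
    tmap T (𝟙 x) f ≫ tmap T (𝟙 x) g ≅ tmap T (𝟙 x) h := map21 (tensorL T x) η

/-- Whiskering with an object on the right a 2-isomorphism from a path of length two to a
1-cell. -/
def tr21 (x : B) {f : a ⟶ b} {g : b ⟶ c} {h : a ⟶ c} (η : f ≫ g ≅ h) :
    tmap T f (𝟙 x) ≫ tmap T g (𝟙 x) ≅ tmap T h (𝟙 x) := map21 (tensorR T x) η

/-- Whiskering with an object on the left a 2-isomorphism from a path of length three to a path of
length two. -/
def tl32 (x : B) {e : B} {f : a ⟶ b} {g : b ⟶ c} {h : c ⟶ d} {k : a ⟶ e} {l : e ⟶ d}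
    (η : f ≫ g ≫ h ≅ k ≫ l) :
    tmap T (𝟙 x) f ≫ tmap T (𝟙 x) g ≫ tmap T (𝟙 x) h ≅ tmap T (𝟙 x) k ≫ tmap T (𝟙 x) l :=
  map32 (tensorL T x) η

/-- Whiskering with an object on the right a 2-isomorphism from a path of length three to a path of
length two. -/
def tr32 (x : B) {e : B} {f : a ⟶ b} {g : b ⟶ c} {h : c ⟶ d} {k : a ⟶ e} {l : e ⟶ d}
    (η : f ≫ g ≫ h ≅ k ≫ l) :
    tmap T f (𝟙 x) ≫ tmap T g (𝟙 x) ≫ tmap T h (𝟙 x) ≅ tmap T k (𝟙 x) ≫ tmap T l (𝟙 x) :=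
  map32 (tensorR T x) η

end Tensor

/-- The data of a monoidal bicategory (a tricategory with one object): a tensor product, a unit
object, an associator, two unitors, an invertible pentagonator `π` and invertible 2-unitors
`μ`, `l`, `r`. The equations are in `MonData.IsMonoidal` below. -/
structure MonData (B : Type u₁) [Bicategory.{w₁, v₁} B] where
  /-- the tensor product -/
  T : (B × B) ⥤ᵖ B
  /-- the unit object -/
  I : B
  /-- the associator `(a ⊗ b) ⊗ c ⟶ a ⊗ (b ⊗ c)` -/
  as : ((prodMap T (Pseudofunctor.id B)).comp T) ⟶
    ((reassoc B B B).comp ((prodMap (Pseudofunctor.id B) T).comp T))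
  /-- the left unitor `I ⊗ a ⟶ a` -/
  lu : tensorL T I ⟶ Pseudofunctor.id B
  /-- the right unitor `a ⊗ I ⟶ a` -/
  ru : tensorR T I ⟶ Pseudofunctor.id B
  /-- the pentagonator -/
  pent (a b c d : B) :
    tmap T (as.app ((a, b), c)) (𝟙 d) ≫ as.app ((a, T.obj (b, c)), d) ≫
      tmap T (𝟙 a) (as.app ((b, c), d)) ≅
    as.app ((T.obj (a, b), c), d) ≫ as.app ((a, b), T.obj (c, d))
  /-- the middle 2-unitor -/
  mid (a b : B) : as.app ((a, I), b) ≫ tmap T (𝟙 a) (lu.app b) ≅ tmap T (ru.app a) (𝟙 b)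
  /-- the left 2-unitor -/
  left (a b : B) : as.app ((I, a), b) ≫ lu.app (T.obj (a, b)) ≅ tmap T (lu.app a) (𝟙 b)
  /-- the right 2-unitor -/
  right (a b : B) : as.app ((a, b), I) ≫ tmap T (𝟙 a) (ru.app b) ≅ ru.app (T.obj (a, b))

namespace MonData

variable {B : Type u₁} [Bicategory.{w₁, v₁} B] (M : MonData B)

section
variable {a b c a' b' c' : B}

/-- The component of the associator at three objects. -/
def α (a b c : B) : tobj M.T (tobj M.T a b) c ⟶ tobj M.T a (tobj M.T b c) :=
  M.as.app ((a, b), c)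

/-- The component of the left unitor. -/
def l (a : B) : tobj M.T M.I a ⟶ a := M.lu.app a

/-- The component of the right unitor. -/
def r (a : B) : tobj M.T a M.I ⟶ a := M.ru.app a

/-- The naturality square of the associator. -/
def αnat (f : a ⟶ a') (g : b ⟶ b') (h : c ⟶ c') :
    Sq (tmap M.T (tmap M.T f g) h) (tmap M.T f (tmap M.T g h)) (M.α a b c) (M.α a' b' c') :=
  M.as.naturality (a := ((a, b), c)) (b := ((a', b'), c')) ((f, g), h)

/-- The naturality square of the left unitor. -/
def lnat (f : a ⟶ a') : Sq (tmap M.T (𝟙 M.I) f) f (M.l a) (M.l a') := M.lu.naturality f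

/-- The naturality square of the right unitor. -/
def rnat (f : a ⟶ a') : Sq (tmap M.T f (𝟙 M.I)) f (M.r a) (M.r a') := M.ru.naturality f

/-- The pentagonator. -/
def π (a b c d : B) : tmap M.T (M.α a b c) (𝟙 d) ≫ M.α a (tobj M.T b c) d ≫
    tmap M.T (𝟙 a) (M.α b c d) ≅ M.α (tobj M.T a b) c d ≫ M.α a b (tobj M.T c d) :=
  M.pent a b c d

/-- The middle 2-unitor. -/
def μ (a b : B) : M.α a M.I b ≫ tmap M.T (𝟙 a) (M.l b) ≅ tmap M.T (M.r a) (𝟙 b) := M.mid a b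

/-- The left 2-unitor. -/
def lam (a b : B) : M.α M.I a b ≫ M.l (tobj M.T a b) ≅ tmap M.T (M.l a) (𝟙 b) := M.left a b

/-- The right 2-unitor. -/
def rho (a b : B) : M.α a b M.I ≫ tmap M.T (𝟙 a) (M.r b) ≅ M.r (tobj M.T a b) := M.right a b

/-- Naturality of the associator with respect to `1 ⊗ (1 ⊗ f)`, where `1 ⊗ 1` is identified with
the identity of the tensor product. -/
def αnat₃ (a b : B) (f : c ⟶ c') : M.α a b c ≫ tmap M.T (𝟙 a) (tmap M.T (𝟙 b) f) ≅
    tmap M.T (𝟙 (tobj M.T a b)) f ≫ M.α a b c' :=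
  (M.αnat (𝟙 a) (𝟙 b) f).symm ≪≫ whiskerRightIso (tiso M.T (tid M.T a b) (Iso.refl f)) _

/-- Naturality of the associator with respect to `(f ⊗ 1) ⊗ 1`, where `1 ⊗ 1` is identified with
the identity of the tensor product. -/
def αnat₁ (f : a ⟶ a') (b c : B) : tmap M.T (tmap M.T f (𝟙 b)) (𝟙 c) ≫ M.α a' b c ≅
    M.α a b c ≫ tmap M.T f (𝟙 (tobj M.T b c)) :=
  M.αnat f (𝟙 b) (𝟙 c) ≪≫ whiskerLeftIso _ (tiso M.T (Iso.refl f) (tid M.T b c))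

end

/-- The equations of a monoidal bicategory: the associator and the unitors are equivalences, the
structure 2-cells are modifications, and the three coherence equations of a tricategory hold. -/
structure IsMonoidal : Prop where
  as_equiv (a b c : B) : IsEquiv₁ (M.α a b c)
  lu_equiv (a : B) : IsEquiv₁ (M.l a)
  ru_equiv (a : B) : IsEquiv₁ (M.r a)
  π_nat {a b c d a' b' c' d' : B} (f : a ⟶ a') (g : b ⟶ b') (h : c ⟶ c') (k : d ⟶ d') :
    tmap M.T (tmap M.T (tmap M.T f g) h) k ◁ (M.π a' b' c' d').hom ≫
      (vcomp (M.αnat (tmap M.T f g) h k) (M.αnat f g (tmap M.T h k))).hom =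
    (vcomp (tsq M.T (M.αnat f g h) (idV k)) (vcomp (M.αnat f (tmap M.T g h) k)
      (tsq M.T (idV f) (M.αnat g h k)))).hom ≫
      (M.π a b c d).hom ▷ tmap M.T f (tmap M.T g (tmap M.T h k))
  μ_nat {a b a' b' : B} (f : a ⟶ a') (g : b ⟶ b') :
    tmap M.T (tmap M.T f (𝟙 M.I)) g ◁ (M.μ a' b').hom ≫ (tsq M.T (M.rnat f) (idV g)).hom =
    (vcomp (M.αnat f (𝟙 M.I) g) (tsq M.T (idV f) (M.lnat g))).hom ≫
      (M.μ a b).hom ▷ tmap M.T f g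
  lam_nat {a b a' b' : B} (f : a ⟶ a') (g : b ⟶ b') :
    tmap M.T (tmap M.T (𝟙 M.I) f) g ◁ (M.lam a' b').hom ≫ (tsq M.T (M.lnat f) (idV g)).hom =
    (vcomp (M.αnat (𝟙 M.I) f g) (M.lnat (tmap M.T f g))).hom ≫
      (M.lam a b).hom ▷ tmap M.T f g
  rho_nat {a b a' b' : B} (f : a ⟶ a') (g : b ⟶ b') :
    tmap M.T (tmap M.T f g) (𝟙 M.I) ◁ (M.rho a' b').hom ≫ (M.rnat (tmap M.T f g)).hom =
    (vcomp (M.αnat f g (𝟙 M.I)) (tsq M.T (idV f) (M.rnat g))).hom ≫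
      (M.rho a b).hom ▷ tmap M.T f g
  /-- the associahedron equation -/
  assoc (a b c d e : B) :
    (tr32 M.T e (M.π a b c d)).hom ▷ (M.α a (tobj M.T b (tobj M.T c d)) e ≫
        tmap M.T (𝟙 a) (M.α b (tobj M.T c d) e) ≫
        tmap M.T (𝟙 a) (tmap M.T (𝟙 b) (M.α c d e))) ⊗≫
      tmap M.T (M.α (tobj M.T a b) c d) (𝟙 e) ◁ (M.π a b (tobj M.T c d) e).hom ▷
        tmap M.T (𝟙 a) (tmap M.T (𝟙 b) (M.α c d e)) ⊗≫
      (tmap M.T (M.α (tobj M.T a b) c d) (𝟙 e) ≫ M.α (tobj M.T a b) (tobj M.T c d) e) ◁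
        (M.αnat₃ a b (M.α c d e)).hom ⊗≫
      (M.π (tobj M.T a b) c d e).hom ▷ M.α a b (tobj M.T c (tobj M.T d e)) =
    𝟙 ((tmap M.T (tmap M.T (M.α a b c) (𝟙 d)) (𝟙 e) ≫
        tmap M.T (M.α a (tobj M.T b c) d) (𝟙 e) ≫
        tmap M.T (tmap M.T (𝟙 a) (M.α b c d)) (𝟙 e)) ≫
        M.α a (tobj M.T b (tobj M.T c d)) e ≫
        tmap M.T (𝟙 a) (M.α b (tobj M.T c d) e) ≫
        tmap M.T (𝟙 a) (tmap M.T (𝟙 b) (M.α c d e))) ⊗≫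
      (tmap M.T (tmap M.T (M.α a b c) (𝟙 d)) (𝟙 e) ≫
        tmap M.T (M.α a (tobj M.T b c) d) (𝟙 e)) ◁
        (M.αnat (𝟙 a) (M.α b c d) (𝟙 e)).hom ▷
        (tmap M.T (𝟙 a) (M.α b (tobj M.T c d) e) ≫
          tmap M.T (𝟙 a) (tmap M.T (𝟙 b) (M.α c d e))) ⊗≫
      (tmap M.T (tmap M.T (M.α a b c) (𝟙 d)) (𝟙 e) ≫
        tmap M.T (M.α a (tobj M.T b c) d) (𝟙 e) ≫ M.α a (tobj M.T (tobj M.T b c) d) e) ◁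
        (tl32 M.T a (M.π b c d e)).hom ⊗≫
      tmap M.T (tmap M.T (M.α a b c) (𝟙 d)) (𝟙 e) ◁ (M.π a (tobj M.T b c) d e).hom ▷
        tmap M.T (𝟙 a) (M.α b c (tobj M.T d e)) ⊗≫
      (M.αnat₁ (M.α a b c) d e).hom ▷ (M.α a (tobj M.T b c) (tobj M.T d e) ≫
        tmap M.T (𝟙 a) (M.α b c (tobj M.T d e))) ⊗≫
      M.α (tobj M.T (tobj M.T a b) c) d e ◁ (M.π a b c (tobj M.T d e)).hom ⊗≫
      𝟙 ((M.α (tobj M.T (tobj M.T a b) c) d e ≫ M.α (tobj M.T a b) c (tobj M.T d e)) ≫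
        M.α a b (tobj M.T c (tobj M.T d e)))
  /-- the left normalisation equation -/
  unit_left (a b c : B) :
    𝟙 ((tmap M.T (M.α a M.I b) (𝟙 c) ≫ M.α a (tobj M.T M.I b) c ≫
        tmap M.T (𝟙 a) (M.α M.I b c)) ≫ tmap M.T (𝟙 a) (M.l (tobj M.T b c))) ⊗≫
      (tmap M.T (M.α a M.I b) (𝟙 c) ≫ M.α a (tobj M.T M.I b) c) ◁
        (tl21 M.T a (M.lam b c)).hom ⊗≫
      tmap M.T (M.α a M.I b) (𝟙 c) ◁ (M.αnat (𝟙 a) (M.l b) (𝟙 c)).inv ⊗≫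
      (tr21 M.T c (M.μ a b)).hom ▷ M.α a b c =
    (M.π a M.I b c).hom ▷ tmap M.T (𝟙 a) (M.l (tobj M.T b c)) ⊗≫
      M.α (tobj M.T a M.I) b c ◁ (M.μ a (tobj M.T b c)).hom ⊗≫
      (M.αnat₁ (M.r a) b c).inv
  /-- the right normalisation equation -/
  unit_right (a b c : B) :
    𝟙 ((tmap M.T (M.α a b M.I) (𝟙 c) ≫ M.α a (tobj M.T b M.I) c ≫
        tmap M.T (𝟙 a) (M.α b M.I c)) ≫ tmap M.T (𝟙 a) (tmap M.T (𝟙 b) (M.l c))) ⊗≫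
      (tmap M.T (M.α a b M.I) (𝟙 c) ≫ M.α a (tobj M.T b M.I) c) ◁
        (tl21 M.T a (M.μ b c)).hom ⊗≫
      tmap M.T (M.α a b M.I) (𝟙 c) ◁ (M.αnat (𝟙 a) (M.r b) (𝟙 c)).inv ⊗≫
      (tr21 M.T c (M.rho a b)).hom ▷ M.α a b c =
    (M.π a b M.I c).hom ▷ tmap M.T (𝟙 a) (tmap M.T (𝟙 b) (M.l c)) ⊗≫
      M.α (tobj M.T a b) M.I c ◁ (M.αnat₃ a b (M.l c)).hom ⊗≫
      (M.μ (tobj M.T a b) c).hom ▷ M.α a b c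

end MonData

end MonBicat

namespace MonBicat

universe w₁ v₁ u₁ w₂ v₂ u₂ w₃ v₃ u₃ w₄ v₄ u₄ u v

variable {B : Type u₁} [Bicategory.{w₁, v₁} B] {C : Type u₂} [Bicategory.{w₂, v₂} C]

/-- The data of a weak monoidal 2-functor between monoidal bicategories. The equations are in
`MonFunData.IsMonoidal` below. The invertible structure 2-cells are written as squares, with
the structure of `N` on the top edge and the image of the structure of `M` on the bottom edge. -/
structure MonFunData (M : MonData B) (N : MonData C) where
  /-- the underlying weak 2-functor -/
  F : B ⥤ᵖ C
  /-- the comparison `F a ⊗ F b ⟶ F (a ⊗ b)` -/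
  χt : (prodMap F F).comp N.T ⟶ M.T.comp F
  /-- the comparison of units -/
  ι : N.I ⟶ F.obj M.I
  /-- the associativity 2-cell -/
  ω (a b c : B) : Sq (N.α (F.obj a) (F.obj b) (F.obj c)) (F.map (M.α a b c))
    (tmap N.T (χt.app (a, b)) (𝟙 (F.obj c)) ≫ χt.app (M.T.obj (a, b), c))
    (tmap N.T (𝟙 (F.obj a)) (χt.app (b, c)) ≫ χt.app (a, M.T.obj (b, c)))
  /-- the left unit 2-cell -/
  γ (a : B) : Sq (N.l (F.obj a)) (F.map (M.l a))
    (tmap N.T ι (𝟙 (F.obj a)) ≫ χt.app (M.I, a)) (𝟙 (F.obj a))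
  /-- the right unit 2-cell -/
  δ (a : B) : Sq (N.r (F.obj a)) (F.map (M.r a))
    (tmap N.T (𝟙 (F.obj a)) ι ≫ χt.app (a, M.I)) (𝟙 (F.obj a))

namespace MonFunData

variable {M : MonData B} {N : MonData C} (X : MonFunData M N)

section

variable {a b c a' b' : B}

/-- The action on objects. -/
abbrev o (a : B) : C := X.F.obj a

/-- The component of the comparison of tensor products. -/
def χ (a b : B) : tobj N.T (X.o a) (X.o b) ⟶ X.o (tobj M.T a b) := X.χt.app (a, b)

/-- The naturality square of the comparison of tensor products. -/
def χnat (f : a ⟶ a') (g : b ⟶ b') :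
    Sq (tmap N.T (X.F.map f) (X.F.map g)) (X.F.map (tmap M.T f g)) (X.χ a b) (X.χ a' b') :=
  X.χt.naturality (a := (a, b)) (b := (a', b')) (f, g)

/-- The comparison of triple tensor products bracketed to the left. -/
def χL (a b c : B) : tobj N.T (tobj N.T (X.o a) (X.o b)) (X.o c) ⟶
    X.o (tobj M.T (tobj M.T a b) c) :=
  tmap N.T (X.χ a b) (𝟙 (X.o c)) ≫ X.χ (tobj M.T a b) c

/-- The comparison of triple tensor products bracketed to the right. -/
def χR (a b c : B) : tobj N.T (X.o a) (tobj N.T (X.o b) (X.o c)) ⟶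
    X.o (tobj M.T a (tobj M.T b c)) :=
  tmap N.T (𝟙 (X.o a)) (X.χ b c) ≫ X.χ a (tobj M.T b c)

/-- The comparison of units and tensor products on the left. -/
def ιL (a : B) : tobj N.T N.I (X.o a) ⟶ X.o (tobj M.T M.I a) :=
  tmap N.T X.ι (𝟙 (X.o a)) ≫ X.χ M.I a

/-- The comparison of units and tensor products on the right. -/
def ιR (a : B) : tobj N.T (X.o a) N.I ⟶ X.o (tobj M.T a M.I) :=
  tmap N.T (𝟙 (X.o a)) X.ι ≫ X.χ a M.I

/-- The associativity square. -/
def om (a b c : B) : Sq (N.α (X.o a) (X.o b) (X.o c)) (X.F.map (M.α a b c))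
    (X.χL a b c) (X.χR a b c) := X.ω a b c

/-- The left unit square. -/
def ga (a : B) : Sq (N.l (X.o a)) (X.F.map (M.l a)) (X.ιL a) (𝟙 (X.o a)) := X.γ a

/-- The right unit square. -/
def de (a : B) : Sq (N.r (X.o a)) (X.F.map (M.r a)) (X.ιR a) (𝟙 (X.o a)) := X.δ a

/-- The identity constraint of the underlying 2-functor as a square. -/
def idsq (a : B) : Sq (𝟙 (X.o a)) (X.F.map (𝟙 a)) (𝟙 (X.o a)) (𝟙 (X.o a)) :=
  whiskerLeftIso _ (X.F.mapId a).symm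

/-- The comparison of units as a square with horizontal identities. -/
def ιsq : Sq (𝟙 N.I) (X.F.map (𝟙 M.I)) X.ι X.ι :=
  λ_ X.ι ≪≫ (ρ_ X.ι).symm ≪≫ whiskerLeftIso X.ι (X.F.mapId M.I).symm

/-- The comparison of fourfold tensor products, from the leftmost bracketing. -/
def E₁ (a b c d : B) : tobj N.T (tobj N.T (tobj N.T (X.o a) (X.o b)) (X.o c)) (X.o d) ⟶
    X.o (tobj M.T (tobj M.T (tobj M.T a b) c) d) :=
  tmap N.T (tmap N.T (X.χ a b) (𝟙 _)) (𝟙 _) ≫ X.χL (tobj M.T a b) c d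

/-- The comparison of fourfold tensor products, from `(a (b c)) d`. -/
def E₂ (a b c d : B) : tobj N.T (tobj N.T (X.o a) (tobj N.T (X.o b) (X.o c))) (X.o d) ⟶
    X.o (tobj M.T (tobj M.T a (tobj M.T b c)) d) :=
  tmap N.T (tmap N.T (𝟙 _) (X.χ b c)) (𝟙 _) ≫ X.χL a (tobj M.T b c) d

/-- The comparison of fourfold tensor products, from `a ((b c) d)`. -/
def E₃ (a b c d : B) : tobj N.T (X.o a) (tobj N.T (tobj N.T (X.o b) (X.o c)) (X.o d)) ⟶
    X.o (tobj M.T a (tobj M.T (tobj M.T b c) d)) :=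
  tmap N.T (𝟙 _) (tmap N.T (X.χ b c) (𝟙 _)) ≫ X.χR a (tobj M.T b c) d

/-- The comparison of fourfold tensor products, from the rightmost bracketing. -/
def E₄ (a b c d : B) : tobj N.T (X.o a) (tobj N.T (X.o b) (tobj N.T (X.o c) (X.o d))) ⟶
    X.o (tobj M.T a (tobj M.T b (tobj M.T c d))) :=
  tmap N.T (𝟙 _) (tmap N.T (𝟙 _) (X.χ c d)) ≫ X.χR a b (tobj M.T c d)

/-- The comparison of fourfold tensor products, from `(a b) (c d)`. -/
def E₅ (a b c d : B) : tobj N.T (tobj N.T (X.o a) (X.o b)) (tobj N.T (X.o c) (X.o d)) ⟶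
    X.o (tobj M.T (tobj M.T a b) (tobj M.T c d)) :=
  tmap N.T (X.χ a b) (X.χ c d) ≫ X.χ (tobj M.T a b) (tobj M.T c d)

/-- The square over `α ⊗ d`. -/
def Q₁ (a b c d : B) : Sq (tmap N.T (N.α (X.o a) (X.o b) (X.o c)) (𝟙 (X.o d)))
    (X.F.map (tmap M.T (M.α a b c) (𝟙 d))) (X.E₁ a b c d) (X.E₂ a b c d) :=
  adj ((α_ _ _ _).symm ≪≫ whiskerRightIso (rcomp N.T _ _ _).symm _)
    (vcomp (tsq N.T (X.om a b c) (X.idsq d)) (X.χnat (M.α a b c) (𝟙 d)))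
    ((α_ _ _ _).symm ≪≫ whiskerRightIso (rcomp N.T _ _ _).symm _)

/-- The square over `α` at `a, b c, d`. -/
def Q₂ (a b c d : B) : Sq (N.α (X.o a) (tobj N.T (X.o b) (X.o c)) (X.o d))
    (X.F.map (M.α a (tobj M.T b c) d)) (X.E₂ a b c d) (X.E₃ a b c d) :=
  vcomp (N.αnat (𝟙 _) (X.χ b c) (𝟙 _)).symm (X.om a (tobj M.T b c) d)

/-- The square over `a ⊗ α`. -/
def Q₃ (a b c d : B) : Sq (tmap N.T (𝟙 (X.o a)) (N.α (X.o b) (X.o c) (X.o d)))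
    (X.F.map (tmap M.T (𝟙 a) (M.α b c d))) (X.E₃ a b c d) (X.E₄ a b c d) :=
  adj ((α_ _ _ _).symm ≪≫ whiskerRightIso (lcomp N.T _ _ _).symm _)
    (vcomp (tsq N.T (X.idsq a) (X.om b c d)) (X.χnat (𝟙 a) (M.α b c d)))
    ((α_ _ _ _).symm ≪≫ whiskerRightIso (lcomp N.T _ _ _).symm _)

/-- The square over `α` at `a b, c, d`. -/
def Q₄ (a b c d : B) : Sq (N.α (tobj N.T (X.o a) (X.o b)) (X.o c) (X.o d))
    (X.F.map (M.α (tobj M.T a b) c d)) (X.E₁ a b c d) (X.E₅ a b c d) :=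
  adj (Iso.refl _)
    (vcomp (N.αnat (X.χ a b) (𝟙 _) (𝟙 _)).symm (X.om (tobj M.T a b) c d))
    (whiskerRightIso (tiso N.T (ρ_ _).symm ((λ_ _).symm ≪≫ whiskerRightIso (tid N.T _ _).symm _)
      ≪≫ tcomp N.T) _ ≪≫ α_ _ _ _)

/-- The square over `α` at `a, b, c d`. -/
def Q₅ (a b c d : B) : Sq (N.α (X.o a) (X.o b) (tobj N.T (X.o c) (X.o d)))
    (X.F.map (M.α a b (tobj M.T c d))) (X.E₅ a b c d) (X.E₄ a b c d) :=
  adj (whiskerRightIso (tiso N.T ((λ_ _).symm ≪≫ whiskerRightIso (tid N.T _ _).symm _) (ρ_ _).symm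
      ≪≫ tcomp N.T) _ ≪≫ α_ _ _ _)
    (vcomp (N.αnat (𝟙 _) (𝟙 _) (X.χ c d)).symm (X.om a b (tobj M.T c d)))
    (Iso.refl _)

/-- The comparison of threefold tensor products with a unit in the middle, from `(a I) b`. -/
def U₁ (a b : B) : tobj N.T (tobj N.T (X.o a) N.I) (X.o b) ⟶ X.o (tobj M.T (tobj M.T a M.I) b) :=
  tmap N.T (tmap N.T (𝟙 _) X.ι) (𝟙 _) ≫ X.χL a M.I b

/-- The comparison of threefold tensor products with a unit in the middle, from `a (I b)`. -/
def U₂ (a b : B) : tobj N.T (X.o a) (tobj N.T N.I (X.o b)) ⟶ X.o (tobj M.T a (tobj M.T M.I b)) :=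
  tmap N.T (𝟙 _) (tmap N.T X.ι (𝟙 _)) ≫ X.χR a M.I b

/-- The square over `α` at `a, I, b`. -/
def S₁ (a b : B) : Sq (N.α (X.o a) N.I (X.o b)) (X.F.map (M.α a M.I b)) (X.U₁ a b) (X.U₂ a b) :=
  vcomp (N.αnat (𝟙 _) X.ι (𝟙 _)).symm (X.om a M.I b)

/-- The square over `a ⊗ l`. -/
def S₂ (a b : B) : Sq (tmap N.T (𝟙 (X.o a)) (N.l (X.o b))) (X.F.map (tmap M.T (𝟙 a) (M.l b)))
    (X.U₂ a b) (X.χ a b) :=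
  adj ((α_ _ _ _).symm ≪≫ whiskerRightIso (lcomp N.T _ _ _).symm _)
    (vcomp (tsq N.T (X.idsq a) (X.ga b)) (X.χnat (𝟙 a) (M.l b)))
    ((λ_ _).symm ≪≫ whiskerRightIso (tid N.T _ _).symm _)

/-- The square over `r ⊗ b`. -/
def S₃ (a b : B) : Sq (tmap N.T (N.r (X.o a)) (𝟙 (X.o b))) (X.F.map (tmap M.T (M.r a) (𝟙 b)))
    (X.U₁ a b) (X.χ a b) :=
  adj ((α_ _ _ _).symm ≪≫ whiskerRightIso (rcomp N.T _ _ _).symm _)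
    (vcomp (tsq N.T (X.de a) (X.idsq b)) (X.χnat (M.r a) (𝟙 b)))
    ((λ_ _).symm ≪≫ whiskerRightIso (tid N.T _ _).symm _)

end

/-- The equations of a weak monoidal 2-functor: the comparisons are equivalences, the structure
2-cells are modifications, and the two coherence equations hold. -/
structure IsMonoidal : Prop where
  χ_equiv (a b : B) : IsEquiv₁ (X.χ a b)
  ι_equiv : IsEquiv₁ X.ι
  ω_nat {a b c a' b' c' : B} (f : a ⟶ a') (g : b ⟶ b') (h : c ⟶ c') :
    tmap N.T (tmap N.T (X.F.map f) (X.F.map g)) (X.F.map h) ◁ (X.om a' b' c').hom ≫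
      (vcomp (vcomp (tsq N.T (X.χnat f g) (idV (X.F.map h))) (X.χnat (tmap M.T f g) h))
        (mapSq X.F (M.αnat f g h))).hom =
    (vcomp (N.αnat (X.F.map f) (X.F.map g) (X.F.map h))
      (vcomp (tsq N.T (idV (X.F.map f)) (X.χnat g h)) (X.χnat f (tmap M.T g h)))).hom ≫
      (X.om a b c).hom ▷ X.F.map (tmap M.T f (tmap M.T g h))
  γ_nat {a a' : B} (f : a ⟶ a') :
    tmap N.T (𝟙 N.I) (X.F.map f) ◁ (X.ga a').hom ≫
      (vcomp (vcomp (tsq N.T X.ιsq (idV (X.F.map f))) (X.χnat (𝟙 M.I) f))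
        (mapSq X.F (M.lnat f))).hom =
    (vcomp (N.lnat (X.F.map f)) (idV (X.F.map f))).hom ≫ (X.ga a).hom ▷ X.F.map f
  δ_nat {a a' : B} (f : a ⟶ a') :
    tmap N.T (X.F.map f) (𝟙 N.I) ◁ (X.de a').hom ≫
      (vcomp (vcomp (tsq N.T (idV (X.F.map f)) X.ιsq) (X.χnat f (𝟙 M.I)))
        (mapSq X.F (M.rnat f))).hom =
    (vcomp (N.rnat (X.F.map f)) (idV (X.F.map f))).hom ≫ (X.de a).hom ▷ X.F.map f
  /-- compatibility with the pentagonators -/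
  assoc (a b c d : B) :
    (hcomp (X.Q₁ a b c d) (hcomp (X.Q₂ a b c d) (X.Q₃ a b c d))).hom ≫
      X.E₁ a b c d ◁ (map32 X.F (M.π a b c d)).hom =
    (N.π (X.o a) (X.o b) (X.o c) (X.o d)).hom ▷ X.E₄ a b c d ≫
      (hcomp (X.Q₄ a b c d) (X.Q₅ a b c d)).hom
  /-- compatibility with the middle 2-unitors -/
  unit (a b : B) :
    (hcomp (X.S₁ a b) (X.S₂ a b)).hom ≫ X.U₁ a b ◁ (map21 X.F (M.μ a b)).hom =
    (N.μ (X.o a) (X.o b)).hom ▷ X.χ a b ≫ (X.S₃ a b).hom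

end MonFunData

/-- The data of a monoidal pseudo-natural transformation between weak monoidal 2-functors. -/
structure MonTransData {M : MonData B} {N : MonData C} (X Y : MonFunData M N) where
  /-- the underlying pseudo-natural transformation -/
  t : X.F ⟶ Y.F
  /-- compatibility with tensor products -/
  P (a b : B) : Sq (X.χ a b) (Y.χ a b) (tmap N.T (t.app a) (t.app b)) (t.app (tobj M.T a b))
  /-- compatibility with units -/
  U : Sq X.ι Y.ι (𝟙 N.I) (t.app M.I)

namespace MonTransData

variable {M : MonData B} {N : MonData C} {X Y : MonFunData M N} (θ : MonTransData X Y)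

/-- The component at an object. -/
def app (a : B) : X.o a ⟶ Y.o a := θ.t.app a

/-- The naturality square. -/
def nat {a b : B} (f : a ⟶ b) : Sq (X.F.map f) (Y.F.map f) (θ.app a) (θ.app b) :=
  θ.t.naturality f

/-- The equations of a monoidal pseudo-natural transformation. -/
structure IsMonoidal : Prop where
  P_nat {a b a' b' : B} (f : a ⟶ a') (g : b ⟶ b') :
    tmap N.T (X.F.map f) (X.F.map g) ◁ (θ.P a' b').hom ≫
      (vcomp (tsq N.T (θ.nat f) (θ.nat g)) (Y.χnat f g)).hom =
    (vcomp (X.χnat f g) (θ.nat (tmap M.T f g))).hom ≫ (θ.P a b).hom ▷ Y.F.map (tmap M.T f g)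
  assoc (a b c : B) :
    (hcomp (N.αnat (θ.app a) (θ.app b) (θ.app c)).symm
      (hcomp (tsq N.T (idH (θ.app a)) (θ.P b c)) (θ.P a (tobj M.T b c)))).hom ≫
      tmap N.T (tmap N.T (θ.app a) (θ.app b)) (θ.app c) ◁ (Y.om a b c).hom =
    (X.om a b c).hom ▷ θ.app (tobj M.T a (tobj M.T b c)) ≫
      (hcomp (hcomp (tsq N.T (θ.P a b) (idH (θ.app c))) (θ.P (tobj M.T a b) c))
        (θ.nat (M.α a b c))).hom
  unit_left (a : B) :
    (hcomp (N.lnat (θ.app a)).symm (idH (θ.app a))).hom ≫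
      tmap N.T (𝟙 N.I) (θ.app a) ◁ (Y.ga a).hom =
    (X.ga a).hom ▷ θ.app a ≫
      (hcomp (hcomp (tsq N.T θ.U (idH (θ.app a))) (θ.P M.I a)) (θ.nat (M.l a))).hom
  unit_right (a : B) :
    (hcomp (N.rnat (θ.app a)).symm (idH (θ.app a))).hom ≫
      tmap N.T (θ.app a) (𝟙 N.I) ◁ (Y.de a).hom =
    (X.de a).hom ▷ θ.app a ≫
      (hcomp (hcomp (tsq N.T (idH (θ.app a)) θ.U) (θ.P a M.I)) (θ.nat (M.r a))).hom

/-- A pseudo-natural transformation is invertible if its components are equivalences. -/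
def IsInvertible : Prop := ∀ a : B, IsEquiv₁ (θ.app a)

/-- The equations of a monoidal modification. -/
structure IsMonMod {θ θ' : MonTransData X Y} (Γ : θ.t ⟶ θ'.t) : Prop where
  tensor (a b : B) :
    X.χ a b ◁ Γ.as.app (tobj M.T a b) ≫ (θ'.P a b).hom =
      (θ.P a b).hom ≫ N.T.map₂ (a := (X.o a, X.o b)) (b := (Y.o a, Y.o b))
        (f := (θ.app a, θ.app b)) (g := (θ'.app a, θ'.app b))
        (Γ.as.app a, Γ.as.app b) ▷ Y.χ a b
  unit : X.ι ◁ Γ.as.app M.I ≫ θ'.U.hom = θ.U.hom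

end MonTransData

/-- A weak 2-functor is a biequivalence if it is essentially surjective on objects up to
equivalence, essentially surjective on 1-cells up to isomorphism, and bijective on 2-cells. -/
structure IsBiequivalence (F : B ⥤ᵖ C) : Prop where
  surj (c : C) : ∃ b : B, Nonempty (F.obj b ≌ c)
  full {a b : B} (g : F.obj a ⟶ F.obj b) : ∃ f : a ⟶ b, Nonempty (F.map f ≅ g)
  bij {a b : B} (f g : a ⟶ b) : Function.Bijective fun η : f ⟶ g => F.map₂ η

end MonBicat

namespace MonBicat

universe w₁ v₁ u₁ w₂ v₂ u₂ w₃ v₃ u₃ w₄ v₄ u₄ u v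

/-- The objects of the bicategory `B²H`: there is exactly one. -/
structure BB (H : Type u) : Type where

/-- The 1-cells of the bicategory `B²H`: there is exactly one. -/
structure BB.Hom (H : Type u) : Type where

namespace BB

variable (H : Type u) [CommGroup H]

/-- The 2-cells of `B²H` are the elements of `H`, composed by multiplication. -/
instance : Category (BB.Hom H) where
  Hom _ _ := H
  id _ := (1 : H)
  comp η θ := (η * θ : H)
  id_comp := one_mul (M := H)
  comp_id := mul_one (M := H)
  assoc := mul_assoc (G := H)

instance : Bicategory (BB H) where
  Hom _ _ := BB.Hom H
  id _ := ⟨⟩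
  comp _ _ := ⟨⟩
  homCategory _ _ := inferInstance
  whiskerLeft _ _ _ η := η
  whiskerRight η _ := η
  associator _ _ _ := Iso.refl _
  leftUnitor _ := Iso.refl _
  rightUnitor _ := Iso.refl _
  whisker_exchange η θ := mul_comm (G := H) θ η

variable {H}

/-- The element of `H` underlying a 2-cell of `B²H`. -/
def val {a b : BB H} {f g : a ⟶ b} (η : f ⟶ g) : H := η

section
variable {a b c d : BB H}

theorem val_ext {f g : a ⟶ b} {η θ : f ⟶ g} (h : val η = val θ) : η = θ := h

@[simp] theorem val_id (f : a ⟶ b) : val (𝟙 f) = 1 := rfl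
@[simp] theorem val_comp {f g h : a ⟶ b} (η : f ⟶ g) (θ : g ⟶ h) :
    val (η ≫ θ) = val η * val θ := rfl
@[simp] theorem val_whiskerLeft (f : a ⟶ b) {g h : b ⟶ c} (η : g ⟶ h) :
    val (f ◁ η) = val η := rfl
@[simp] theorem val_whiskerRight {f g : a ⟶ b} (η : f ⟶ g) (h : b ⟶ c) :
    val (η ▷ h) = val η := rfl
@[simp] theorem val_associator (f : a ⟶ b) (g : b ⟶ c) (h : c ⟶ d) :
    val (α_ f g h).hom = 1 := rfl
@[simp] theorem val_associator_inv (f : a ⟶ b) (g : b ⟶ c) (h : c ⟶ d) :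
    val (α_ f g h).inv = 1 := rfl
@[simp] theorem val_leftUnitor (f : a ⟶ b) : val (λ_ f).hom = 1 := rfl
@[simp] theorem val_leftUnitor_inv (f : a ⟶ b) : val (λ_ f).inv = 1 := rfl
@[simp] theorem val_rightUnitor (f : a ⟶ b) : val (ρ_ f).hom = 1 := rfl
@[simp] theorem val_rightUnitor_inv (f : a ⟶ b) : val (ρ_ f).inv = 1 := rfl

end

variable (H)

/-- The tensor product of `B²H` multiplies 2-cells. -/
def tensor : (BB H × BB H) ⥤ᵖ BB H where
  obj _ := ⟨⟩
  map _ := ⟨⟩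
  map₂ η := (show H from val η.1 * val η.2)
  mapId _ := Iso.refl _
  mapComp _ _ := Iso.refl _
  map₂_id _ := mul_one (M := H) 1
  map₂_comp η θ := mul_mul_mul_comm (G := H) η.1 θ.1 η.2 θ.2
  map₂_whisker_left _ _ _ _ := val_ext (by simp; rfl)
  map₂_whisker_right _ _ := val_ext (by simp; rfl)
  map₂_associator _ _ _ := show (1 * 1 : H) = 1 * (1 * (1 * (1 * 1))) by simp
  map₂_left_unitor _ := show (1 * 1 : H) = 1 * (1 * 1) by simp
  map₂_right_unitor _ := show (1 * 1 : H) = 1 * (1 * 1) by simp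

/-- The monoidal structure of `B²H`; all structure cells are identities. -/
def mon : MonData (BB H) where
  T := tensor H
  I := ⟨⟩
  as :=
    { app := fun _ => ⟨⟩
      naturality := fun _ => Iso.refl _
      naturality_naturality := fun η =>
        show ((val η.1.1 * val η.1.2) * val η.2 : H) * 1 =
          1 * (val η.1.1 * (val η.1.2 * val η.2)) by simp [mul_assoc]
      naturality_id := fun _ =>
        show (1 * ((1 * (1 * 1)) * ((1 * 1) * 1)) : H) = ((1 * 1) * 1) * (1 * 1) by simp
      naturality_comp := fun _ _ =>
        show (1 * ((1 * (1 * 1)) * ((1 * 1) * 1)) : H) =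
          ((1 * 1) * 1) * (1 * (1 * (1 * (1 * 1)))) by simp }
  lu :=
    { app := fun _ => ⟨⟩
      naturality := fun _ => Iso.refl _
      naturality_naturality := fun η => show (1 * val η : H) * 1 = 1 * val η by simp
      naturality_id := fun _ => show (1 * 1 : H) = ((1 * 1) * 1) * (1 * 1) by simp
      naturality_comp := fun _ _ =>
        show (1 * 1 : H) = ((1 * 1) * 1) * (1 * (1 * (1 * (1 * 1)))) by simp }
  ru :=
    { app := fun _ => ⟨⟩
      naturality := fun _ => Iso.refl _
      naturality_naturality := fun η => show (val η * 1 : H) * 1 = 1 * val η by simp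
      naturality_id := fun _ => show (1 * 1 : H) = ((1 * 1) * 1) * (1 * 1) by simp
      naturality_comp := fun _ _ =>
        show (1 * 1 : H) = ((1 * 1) * 1) * (1 * (1 * (1 * (1 * 1)))) by simp }
  pent _ _ _ _ := Iso.refl _
  mid _ _ := Iso.refl _
  left _ _ := Iso.refl _
  right _ _ := Iso.refl _

end BB

end MonBicat

namespace MonBicat

universe w₁ v₁ u₁ w₂ v₂ u₂ w₃ v₃ u₃ w₄ v₄ u₄ u v

/-- The fundamental 2-groupoid of a topological space: objects are points, 1-cells are paths and
2-cells are homotopy classes of homotopies of paths relative to the end points (2-tracks). -/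
structure Pi2 (X : Type u) where
  /-- the underlying point -/
  pt : X

namespace Pi2

open unitInterval

/-- The class of a path as a morphism of the fundamental groupoid. -/
def pc {Y : Type u} [TopologicalSpace Y] {a b : Y} (U : Path a b) :
    FundamentalGroupoid.mk a ⟶ FundamentalGroupoid.mk b := Path.Homotopic.Quotient.mk U

section Reparametrisation

variable {X : Type u} [TopologicalSpace X] {x y z w : X}

/-- Reparametrisation of a path. -/
def rep (φ : Path (0 : I) 1) (p : Path x y) : Path x y where
  toFun t := p (φ t)
  source' := by simp
  target' := by simp

/-- The straight line between two reparametrisations. -/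
def line (φ ψ : Path (0 : I) 1) : Path φ ψ where
  toFun s :=
    { toFun := fun t => ⟨(1 - (s : ℝ)) * φ t + s * ψ t, by
        have h1 := s.2.1
        have h2 := s.2.2
        have h3 := (φ t).2.1
        have h4 := (φ t).2.2
        have h5 := (ψ t).2.1
        have h6 := (ψ t).2.2
        constructor <;> nlinarith⟩
      source' := by ext; simp
      target' := by ext; simp }
  continuous_toFun := by
    rw [← Path.continuous_uncurry_iff]
    apply Continuous.subtype_mk
    fun_prop
  source' := by ext; simp
  target' := by ext; simp

theorem continuous_rep : Continuous fun a : Path (0 : I) 1 × Path x y => rep a.1 a.2 := by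
  rw [← Path.continuous_uncurry_iff]
  show Continuous fun b : (Path (0 : I) 1 × Path x y) × I => b.1.2 (b.1.1 b.2)
  fun_prop

/-- The path of paths between two reparametrisations of a path. -/
def rp (φ ψ : Path (0 : I) 1) (r : Path x y) : Path (rep φ r) (rep ψ r) :=
  (line φ ψ).map (f := fun ξ => rep ξ r) (continuous_rep.comp (.prodMk continuous_id continuous_const))

/-- The class of the canonical homotopy between two reparametrisations of a path. -/
def rcell {p q r : Path x y} (φ ψ : Path (0 : I) 1) (hp : p = rep φ r) (hq : q = rep ψ r) :
    FundamentalGroupoid.mk p ⟶ FundamentalGroupoid.mk q := pc ((rp φ ψ r).cast hp hq)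

theorem trans_cont_left (f : Path x y) : Continuous fun p : Path y z => f.trans p :=
  Path.continuous_trans.comp (.prodMk continuous_const continuous_id)

theorem trans_cont_right (h : Path y z) : Continuous fun p : Path x y => p.trans h :=
  Path.continuous_trans.comp (.prodMk continuous_id continuous_const)

/-- The reparametrisation that compares the two ways of composing three paths. -/
def φa : Path (0 : I) 1 where
  toFun t := ⟨Path.Homotopy.transAssocReparamAux t, Path.Homotopy.transAssocReparamAux_mem_I t⟩
  continuous_toFun := by fun_prop
  source' := Subtype.ext Path.Homotopy.transAssocReparamAux_zero
  target' := Subtype.ext Path.Homotopy.transAssocReparamAux_one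

/-- The reparametrisation that is constant on the second half of the interval. -/
def φr : Path (0 : I) 1 := Path.id.trans (Path.refl 1)

/-- The reparametrisation that is constant on the first half of the interval. -/
def φl : Path (0 : I) 1 := (Path.refl 0).trans Path.id

theorem rep_id (p : Path x y) : p = rep Path.id p := by ext t; rfl

theorem rep_φa (f : Path x y) (g : Path y z) (h : Path z w) :
    (f.trans g).trans h = rep φa (f.trans (g.trans h)) := Path.Homotopy.trans_assoc_reparam f g h

theorem rep_φr (f : Path x y) : f.trans (Path.refl y) = rep φr f := by
  ext t
  simp only [Path.trans_apply, rep, φr, Path.coe_mk_mk]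
  split_ifs
  · rfl
  · simp

theorem rep_φl (f : Path x y) : (Path.refl x).trans f = rep φl f := by
  ext t
  simp only [Path.trans_apply, rep, φl, Path.coe_mk_mk]
  split_ifs
  · simp
  · rfl

end Reparametrisation

section Exchange

variable {A B Y : Type*} [TopologicalSpace A] [TopologicalSpace B] [TopologicalSpace Y]

theorem exchange {m : A → B → Y} (hm : Continuous fun a : A × B => m a.1 a.2) {a a' : A} {b b' : B}
    {x y y' z : Y} (P : Path a a') (Q : Path b b') (U : Path x y) (V : Path y z) (V' : Path x y')
    (U' : Path y' z) (hU : ∀ s, U s = m (P s) b) (hV : ∀ s, V s = m a' (Q s))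
    (hV' : ∀ s, V' s = m a (Q s)) (hU' : ∀ s, U' s = m (P s) b') :
    pc U ≫ pc V = pc V' ≫ pc U' := by
  obtain rfl : x = m a b := by simpa using hU 0
  obtain rfl : y = m a' b := by simpa using hU 1
  obtain rfl : y' = m a b' := by simpa using hV' 1
  obtain rfl : z = m a' b' := by simpa using hU' 1
  have e1 : U.trans V = ((P.trans (Path.refl a')).prod ((Path.refl b).trans Q)).map hm := by
    ext t
    simp only [Path.trans_apply, Path.map_coe, Function.comp_apply, Path.prod_coe]
    split_ifs <;> simp [hU, hV]
  have e2 : V'.trans U' = (((Path.refl a).trans P).prod (Q.trans (Path.refl b'))).map hm := by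
    ext t
    simp only [Path.trans_apply, Path.map_coe, Function.comp_apply, Path.prod_coe]
    split_ifs <;> simp [hU', hV']
  have e3 : ((P.trans (Path.refl a')).prod ((Path.refl b).trans Q)).Homotopic
      (((Path.refl a).trans P).prod (Q.trans (Path.refl b'))) :=
    ⟨Path.Homotopic.prodHomotopy
      (((Path.Homotopic.trans_refl P).trans (Path.Homotopic.refl_trans P).symm).some)
      (((Path.Homotopic.refl_trans Q).trans (Path.Homotopic.trans_refl Q).symm).some)⟩
  show Path.Homotopic.Quotient.mk (U.trans V) = Path.Homotopic.Quotient.mk (V'.trans U')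
  rw [e1, e2]
  exact Quotient.sound (e3.map ⟨_, hm⟩)

end Exchange

section Lifting

variable {X : Type u} [TopologicalSpace X]

/-- A 2-cell that is the image of a 2-cell between paths in the real line. -/
def Lifts (φ : C(ℝ, X)) {x y : X} {f g : Path x y} (c : FundamentalGroupoid.mk f ⟶ ⟨g⟩)
    {p q : ℝ} (f' g' : Path p q) : Prop :=
  ∃ (U : Path f g) (V : Path f' g'), c = pc U ∧ ∀ s t, U s t = φ (V s t)

theorem Lifts.unique {φ : C(ℝ, X)} {x y : X} {f g : Path x y} {c d : FundamentalGroupoid.mk f ⟶ ⟨g⟩}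
    {p q : ℝ} {f' g' : Path p q} (hc : Lifts φ c f' g') (hd : Lifts φ d f' g') : c = d := by
  obtain ⟨U, V, rfl, hU⟩ := hc
  obtain ⟨U', V', rfl, hU'⟩ := hd
  have hf : ∀ t, f t = φ (f' t) := fun t => by simpa using hU 0 t
  have hg : ∀ t, g t = φ (g' t) := fun t => by simpa using hU 1 t
  have hx : φ p = x := by simpa using (hf 0).symm
  have hy : φ q = y := by simpa using (hf 1).symm
  refine Quotient.sound ⟨
    { toFun := fun a =>
        { toFun := fun t => φ ((1 - (a.1 : ℝ)) * V a.2 t + a.1 * V' a.2 t)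
          source' := by
            simp only [Path.source]; rw [← hx]; congr 1; ring
          target' := by
            simp only [Path.target]; rw [← hy]; congr 1; ring }
      continuous_toFun := ?_
      map_zero_left := ?_
      map_one_left := ?_
      prop' := ?_ }⟩
  · rw [← Path.continuous_uncurry_iff]
    show Continuous fun b : (I × I) × I =>
      φ ((1 - (b.1.1 : ℝ)) * V b.1.2 b.2 + b.1.1 * V' b.1.2 b.2)
    fun_prop
  · intro s; ext t; simp [hU]
  · intro s; ext t; simp [hU']
  · rintro r s (rfl | rfl)
    · ext t; simp [hf]; congr 1; ring
    · ext t; simp [hg]; congr 1; ring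

variable {φ : C(ℝ, X)} {x y z w : X}

theorem Lifts.comp {f g h : Path x y} {c : FundamentalGroupoid.mk f ⟶ ⟨g⟩}
    {d : FundamentalGroupoid.mk g ⟶ ⟨h⟩} {p q : ℝ} {f' g' h' : Path p q} (hc : Lifts φ c f' g')
    (hd : Lifts φ d g' h') : Lifts φ (c ≫ d) f' h' := by
  obtain ⟨U, V, rfl, hU⟩ := hc
  obtain ⟨U', V', rfl, hU'⟩ := hd
  refine ⟨U.trans U', V.trans V', rfl, fun s t => ?_⟩
  simp only [Path.trans_apply]
  split_ifs
  · exact hU _ _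
  · exact hU' _ _

theorem lift_trans {f : Path x y} {g : Path y z} {p q r : ℝ} {f' : Path p q} {g' : Path q r}
    (hf : ∀ t, f t = φ (f' t)) (hg : ∀ t, g t = φ (g' t)) (t : I) :
    f.trans g t = φ (f'.trans g' t) := by
  simp only [Path.trans_apply]
  split_ifs
  · exact hf _
  · exact hg _

theorem lift_refl {p : ℝ} (hx : φ p = x) (t : I) : Path.refl x t = φ (Path.refl p t) := hx.symm

theorem Lifts.rcell {f g h : Path x y} {p q : ℝ} {h' : Path p q} (hh : ∀ t, h t = φ (h' t))
    {ξ τ : Path (0 : I) 1} {hf : f = rep ξ h} {hg : g = rep τ h} {f' g' : Path p q}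
    (hf' : f' = rep ξ h') (hg' : g' = rep τ h') : Lifts φ (rcell ξ τ hf hg) f' g' :=
  ⟨_, (rp ξ τ h').cast hf' hg', rfl, fun _ _ => hh _⟩

theorem exists_lift₁ (f : Path x y) (ψ : C(ℝ, X)) (hψ : ψ 0 = y) :
    ∃ φ : C(ℝ, X), (∀ t : I, f t = φ t) ∧ ∀ t : ℝ, 0 ≤ t → φ (t + 1) = ψ t := by
  refine ⟨⟨fun t => if t ≤ 1 then f.extend t else ψ (t - 1), ?_⟩, fun t => ?_, fun t ht => ?_⟩
  · refine Continuous.if_le (by fun_prop) (by fun_prop) continuous_id continuous_const ?_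
    rintro t rfl
    simp [hψ]
  · simp [t.2.2]
  · rcases ht.eq_or_lt with rfl | ht
    · simp [hψ]
    · simp [ht]

/-- The unit speed path of length one in the real line. -/
def seg (n : ℝ) : Path n (n + 1) where
  toFun t := t + n
  source' := by simp
  target' := by simp [add_comm]

theorem exists_lift (f : Path x y) (g : Path y z) {x' y' : X} (h : Path z x') (k : Path x' y') :
    ∃ φ : C(ℝ, X), (∀ t, f t = φ (seg 0 t)) ∧ (∀ t, g t = φ (seg (0 + 1) t)) ∧
      (∀ t, h t = φ (seg (0 + 1 + 1) t)) ∧ (∀ t, k t = φ (seg (0 + 1 + 1 + 1) t)) := by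
  obtain ⟨φ₄, h₄, -⟩ := exists_lift₁ k ⟨fun _ => y', continuous_const⟩ rfl
  obtain ⟨φ₃, h₃, h₃'⟩ := exists_lift₁ h φ₄ (by simpa using (h₄ 0).symm)
  obtain ⟨φ₂, h₂, h₂'⟩ := exists_lift₁ g φ₃ (by simpa using (h₃ 0).symm)
  obtain ⟨φ₁, h₁, h₁'⟩ := exists_lift₁ f φ₂ (by simpa using (h₂ 0).symm)
  refine ⟨φ₁, fun t => ?_, fun t => ?_, fun t => ?_, fun t => ?_⟩ <;>
    have := t.2.1 <;> simp only [seg, Path.coe_mk_mk, ← add_assoc, add_zero]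
  · exact h₁ t
  · rw [h₁' _ this, h₂]
  · rw [h₁' _ (by positivity), h₂' _ this, h₃]
  · rw [h₁' _ (by positivity), h₂' _ (by positivity), h₃' _ this, h₄]

end Lifting

section Bicat

variable {X : Type u} [TopologicalSpace X]

instance : CategoryStruct (Pi2 X) where
  Hom x y := FundamentalGroupoid (Path x.pt y.pt)
  id x := ⟨Path.refl x.pt⟩
  comp f g := ⟨f.as.trans g.as⟩

instance (x y : Pi2 X) : Groupoid (x ⟶ y) :=
  inferInstanceAs (Groupoid (FundamentalGroupoid (Path x.pt y.pt)))

/-- A 2-cell as an isomorphism. -/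
def ic {x y : Pi2 X} {f g : x ⟶ y} (c : f ⟶ g) : f ≅ g := (Groupoid.isoEquivHom f g).symm c

/-- The associator. -/
def assoc {x y z w : Pi2 X} (f : x ⟶ y) (g : y ⟶ z) (h : z ⟶ w) : (f ≫ g) ≫ h ⟶ f ≫ g ≫ h :=
  rcell φa Path.id (rep_φa f.as g.as h.as) (rep_id _)

/-- The right unitor. -/
def runit {x y : Pi2 X} (f : x ⟶ y) : f ≫ 𝟙 y ⟶ f := rcell φr Path.id (rep_φr f.as) (rep_id _)

/-- The left unitor. -/
def lunit {x y : Pi2 X} (f : x ⟶ y) : 𝟙 x ≫ f ⟶ f := rcell φl Path.id (rep_φl f.as) (rep_id _)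

/-- Left whiskering. -/
def wl {x y z : Pi2 X} (f : x ⟶ y) {g h : y ⟶ z} (η : g ⟶ h) : f ≫ g ⟶ f ≫ h :=
  Path.Homotopic.Quotient.map η ⟨_, trans_cont_left f.as⟩

/-- Right whiskering. -/
def wr {x y z : Pi2 X} {f g : x ⟶ y} (η : f ⟶ g) (h : y ⟶ z) : f ≫ h ⟶ g ≫ h :=
  Path.Homotopic.Quotient.map η ⟨_, trans_cont_right h.as⟩

theorem ind {x y : Pi2 X} {f g : x ⟶ y} {motive : (f ⟶ g) → Prop}
    (h : ∀ U : Path f.as g.as, motive (pc U)) (η : f ⟶ g) : motive η :=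
  Path.Homotopic.Quotient.ind h η

theorem lift_wl {φ : C(ℝ, X)} {x y z : Pi2 X} {f : x ⟶ y} {g h : y ⟶ z} {c : g ⟶ h} {p q r : ℝ}
    {f' : Path p q} {g' h' : Path q r} (hf : ∀ t, f.as t = φ (f' t)) (hc : Lifts φ c g' h') :
    Lifts φ (wl f c) (f'.trans g') (f'.trans h') := by
  obtain ⟨U, V, rfl, hU⟩ := hc
  exact ⟨_, V.map (trans_cont_left f'), rfl, fun s => lift_trans hf (hU s)⟩

theorem lift_wr {φ : C(ℝ, X)} {x y z : Pi2 X} {f g : x ⟶ y} {h : y ⟶ z} {c : f ⟶ g} {p q r : ℝ}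
    {f' g' : Path p q} {h' : Path q r} (hh : ∀ t, h.as t = φ (h' t)) (hc : Lifts φ c f' g') :
    Lifts φ (wr c h) (f'.trans h') (g'.trans h') := by
  obtain ⟨U, V, rfl, hU⟩ := hc
  exact ⟨_, V.map (trans_cont_right h'), rfl, fun s => lift_trans (hU s) hh⟩

theorem lift_assoc {φ : C(ℝ, X)} {x y z w : Pi2 X} {f : x ⟶ y} {g : y ⟶ z} {h : z ⟶ w}
    {p q r s : ℝ} {f' : Path p q} {g' : Path q r} {h' : Path r s} (hf : ∀ t, f.as t = φ (f' t))
    (hg : ∀ t, g.as t = φ (g' t)) (hh : ∀ t, h.as t = φ (h' t)) :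
    Lifts φ (assoc f g h) ((f'.trans g').trans h') (f'.trans (g'.trans h')) :=
  Lifts.rcell (lift_trans hf (lift_trans hg hh)) (rep_φa _ _ _) (rep_id _)

instance : Bicategory (Pi2 X) where
  homCategory x y := inferInstance
  whiskerLeft f _ _ η := wl f η
  whiskerRight η h := wr η h
  associator f g h := ic (assoc f g h)
  leftUnitor f := ic (lunit f)
  rightUnitor f := ic (runit f)
  whiskerLeft_id _ _ := rfl
  id_whiskerRight _ _ := rfl
  whiskerLeft_comp {x y z} f g h k η θ := by
    induction η using ind with | h U
    induction θ using ind with | h V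
    exact congrArg pc (U.map_trans V (trans_cont_left f.as))
  comp_whiskerRight {x y z} f g h η θ k := by
    induction η using ind with | h U
    induction θ using ind with | h V
    exact congrArg pc (U.map_trans V (trans_cont_right k.as))
  id_whiskerLeft η := by
    rw [← Category.assoc, Iso.eq_comp_inv]
    induction η using ind with | h U
    exact (exchange continuous_rep (line φl Path.id) U _ _ _ _ (fun _ => rfl) (fun _ => rfl)
      (fun s => rep_φl (U s)) (fun _ => rfl)).symm
  comp_whiskerLeft f g _ _ η := by
    rw [← Category.assoc, Iso.eq_comp_inv]
    induction η using ind with | h U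
    exact (exchange (m := fun ξ p => rep ξ (f.as.trans (g.as.trans p)))
      (continuous_rep.comp (.prodMk continuous_fst ((trans_cont_left f.as).comp
        ((trans_cont_left g.as).comp continuous_snd)))) (line φa Path.id) U _ _ _ _
      (fun _ => rfl) (fun _ => rfl) (fun s => rep_φa f.as g.as (U s)) (fun _ => rfl)).symm
  whiskerRight_id η := by
    rw [← Category.assoc, Iso.eq_comp_inv]
    induction η using ind with | h U
    exact (exchange continuous_rep (line φr Path.id) U _ _ _ _ (fun _ => rfl) (fun _ => rfl)
      (fun s => rep_φr (U s)) (fun _ => rfl)).symm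
  whiskerRight_comp η g h := by
    rw [Iso.eq_inv_comp]
    induction η using ind with | h U
    exact exchange (m := fun ξ p => rep ξ (p.trans (g.as.trans h.as)))
      (continuous_rep.comp (.prodMk continuous_fst ((trans_cont_right (g.as.trans h.as)).comp
        continuous_snd))) (line φa Path.id) U _ _ _ _
      (fun _ => rfl) (fun _ => rfl) (fun s => rep_φa (U s) g.as h.as) (fun _ => rfl)
  whisker_assoc f _ _ η h := by
    rw [← Category.assoc, Iso.eq_comp_inv]
    induction η using ind with | h U
    exact (exchange (m := fun ξ p => rep ξ (f.as.trans (p.trans h.as)))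
      (continuous_rep.comp (.prodMk continuous_fst ((trans_cont_left f.as).comp
        ((trans_cont_right h.as).comp continuous_snd)))) (line φa Path.id) U _ _ _ _
      (fun _ => rfl) (fun _ => rfl) (fun s => rep_φa f.as (U s) h.as) (fun _ => rfl)).symm
  whisker_exchange η θ := by
    induction η using ind with | h U
    induction θ using ind with | h V
    exact (exchange (m := fun p q => p.trans q) Path.continuous_trans U V _ _ _ _ (fun _ => rfl)
      (fun _ => rfl) (fun _ => rfl) (fun _ => rfl)).symm
  pentagon f g h k := by
    obtain ⟨φ, h1, h2, h3, h4⟩ := exists_lift f.as g.as h.as k.as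
    exact ((lift_wr h4 (lift_assoc h1 h2 h3)).comp ((lift_assoc h1 (lift_trans h2 h3) h4).comp
      (lift_wl h1 (lift_assoc h2 h3 h4)))).unique
      ((lift_assoc (lift_trans h1 h2) h3 h4).comp (lift_assoc h1 h2 (lift_trans h3 h4)))
  triangle {x y z} f g := by
    obtain ⟨φ, h1, h2, -, -⟩ := exists_lift f.as g.as (Path.refl _) (Path.refl _)
    have h0 : φ (0 + 1) = y.pt := by simpa [seg] using (h1 1).symm
    exact ((lift_assoc h1 (lift_refl h0) h2).comp (lift_wl h1
      (Lifts.rcell h2 (rep_φl _) (rep_id _)))).unique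
      (lift_wr h2 (Lifts.rcell h1 (rep_φr _) (rep_id _)))

end Bicat

end Pi2

end MonBicat

namespace MonBicat

universe w₁ v₁ u₁ w₂ v₂ u₂ w₃ v₃ u₃ w₄ v₄ u₄ u v

namespace Pi2

open unitInterval

section Repr

variable {X : Type u} [TopologicalSpace X]

theorem pc_heq {x y x' y' : X} {f g : Path x y} {f' g' : Path x' y'} (U : Path f g)
    (V : Path f' g') (h : ∀ s t, U s t = V s t) : HEq (pc U) (pc V) := by
  obtain rfl : x = x' := by simpa using h 0 0
  obtain rfl : y = y' := by simpa using h 0 1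
  obtain rfl : f = f' := by ext t; simpa using h 0 t
  obtain rfl : g = g' := by ext t; simpa using h 1 t
  obtain rfl : U = V := by ext s; exact h s _
  rfl

end Repr

variable {G : Type u} [TopologicalSpace G] [Group G] [IsTopologicalGroup G]

theorem mul_cont {x y x' y' : G} :
    Continuous fun p : Path x y × Path x' y' => p.1.mul p.2 := by
  rw [← Path.continuous_uncurry_iff]
  show Continuous fun b : (Path x y × Path x' y') × I => b.1.1 b.2 * b.1.2 b.2
  fun_prop

/-- The pointwise product of 2-cells. -/
def mul₂ {x y x' y' : Pi2 G} {f g : x ⟶ y} {f' g' : x' ⟶ y'} (η : f ⟶ g) (θ : f' ⟶ g') :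
    FundamentalGroupoid.mk (f.as.mul f'.as) ⟶ FundamentalGroupoid.mk (g.as.mul g'.as) :=
  Path.Homotopic.Quotient.map (Path.Homotopic.prod η θ) ⟨_, mul_cont⟩

theorem mul_trans {x y z x' y' z' : G} (f : Path x y) (f' : Path x' y') (g : Path y z)
    (g' : Path y' z') :
    (f.trans g).mul (f'.trans g') = (f.mul f').trans (g.mul g') := by
  ext t
  show f.trans g t * f'.trans g' t = _
  simp only [Path.trans_apply]
  split_ifs <;> rfl

theorem mul_trans_apply {x y z x' y' z' : G} (f : Path x y) (f' : Path x' y') (g : Path y z)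
    (g' : Path y' z') (t : I) :
    f.trans g t * f'.trans g' t = (f.mul f').trans (g.mul g') t := by
  rw [← mul_trans]; rfl

theorem mul₂_comp {x y x' y' : Pi2 G} {f g h : x ⟶ y} {f' g' h' : x' ⟶ y'} (η : f ⟶ g)
    (θ : f' ⟶ g') (κ : g ⟶ h) (ξ : g' ⟶ h') : mul₂ (η ≫ κ) (θ ≫ ξ) = mul₂ η θ ≫ mul₂ κ ξ := by
  induction η using ind with | h U
  induction θ using ind with | h V
  induction κ using ind with | h U'
  induction ξ using ind with | h V'
  show pc (((U.trans U').prod (V.trans V')).map mul_cont) =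
    pc (((U.prod V).map mul_cont).trans ((U'.prod V').map mul_cont))
  rw [← Path.map_trans, Path.trans_prod_eq_prod_trans]

variable (G)

/-- The tensor product of the fundamental 2-groupoid of a topological group: the pointwise product
of points, paths and homotopies. It is a strict 2-functor. -/
def tensorCore : StrictPseudofunctorCore (Pi2 G × Pi2 G) (Pi2 G) where
  obj := fun x => ⟨x.1.pt * x.2.pt⟩
  map := fun f => ⟨f.1.as.mul f.2.as⟩
  map₂ := fun η => mul₂ η.1 η.2
  map_id := fun _ => rfl
  map_comp := fun f g =>
    congrArg FundamentalGroupoid.mk (mul_trans f.1.as f.2.as g.1.as g.2.as)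
  map₂_id := fun _ => rfl
  map₂_comp := fun η θ => mul₂_comp η.1 η.2 θ.1 θ.2
  map₂_whisker_left := fun f _ _ η => by
    obtain ⟨η, θ⟩ := η
    induction η using ind with | h U
    induction θ using ind with | h V
    refine (conj_eqToHom_iff_heq' _ _ _ _).2 (pc_heq _ _ fun s t => ?_)
    exact mul_trans_apply f.1.as f.2.as (U s) (V s) t
  map₂_whisker_right := fun η f => by
    obtain ⟨η, θ⟩ := η
    induction η using ind with | h U
    induction θ using ind with | h V
    refine (conj_eqToHom_iff_heq' _ _ _ _).2 (pc_heq _ _ fun s t => ?_)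
    exact mul_trans_apply (U s) (V s) f.1.as f.2.as t
  map₂_associator := fun f g h => by
    refine (conj_eqToHom_iff_heq' _ _ _ _).2 (pc_heq _ _ fun s t => ?_)
    refine (mul_trans_apply _ _ _ _ (line φa Path.id s t)).trans ?_
    rw [mul_trans]
    rfl
  map₂_left_unitor := fun f => by
    exact eq_of_heq ((heq_eqToHom_comp_iff _ _ _).2 (pc_heq _ _ fun s t => rfl))
  map₂_right_unitor := fun f => by
    exact eq_of_heq ((heq_eqToHom_comp_iff _ _ _).2 (pc_heq _ _ fun s t => rfl))

/-- The tensor product of the fundamental 2-groupoid of a topological group as a 2-functor. -/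
def tensor : (Pi2 G × Pi2 G) ⥤ᵖ Pi2 G := (StrictPseudofunctor.mk' (tensorCore G)).toPseudofunctor

end Pi2

end MonBicat

namespace MonBicat

universe w₁ v₁ u₁ w₂ v₂ u₂ w₃ v₃ u₃ w₄ v₄ u₄ u v

section Strict

variable {A : Type u₁} [Bicategory.{w₁, v₁} A] {B : Type u₂} [Bicategory.{w₂, v₂} B]
  {C : Type u₃} [Bicategory.{w₃, v₃} C] {D : Type u₄} [Bicategory.{w₄, v₄} D]

/-- A 2-functor is strict if its constraints are identities. -/
structure IsStrict (F : A ⥤ᵖ B) : Prop where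
  id (a : A) : ∃ h, F.mapId a = eqToIso h
  comp {a b c : A} (f : a ⟶ b) (g : b ⟶ c) : ∃ h, F.mapComp f g = eqToIso h

theorem IsStrict.ext {F G : A ⥤ᵖ B} (hF : IsStrict F) (hG : IsStrict G)
    (h₀ : ∀ a, F.obj a = G.obj a) (h₁ : ∀ {a b : A} (f : a ⟶ b), HEq (F.map f) (G.map f))
    (h₂ : ∀ {a b : A} {f g : a ⟶ b} (η : f ⟶ g), HEq (F.map₂ η) (G.map₂ η)) : F = G := by
  obtain ⟨⟨⟨⟨oF, mF⟩, nF⟩, _, _⟩, iF, cF⟩ := F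
  obtain ⟨⟨⟨⟨oG, mG⟩, nG⟩, _, _⟩, iG, cG⟩ := G
  obtain rfl : oF = oG := funext h₀
  obtain rfl : @mF = @mG := by
    funext a b f
    exact eq_of_heq (h₁ f)
  obtain rfl : @nF = @nG := by
    funext a b f g η
    exact eq_of_heq (h₂ η)
  obtain rfl : iF = iG := by
    funext a
    obtain ⟨_, h⟩ := hF.id a
    obtain ⟨_, h'⟩ := hG.id a
    exact h.trans h'.symm
  obtain rfl : @cF = @cG := by
    funext a b c f g
    obtain ⟨_, h⟩ := hF.comp f g
    obtain ⟨_, h'⟩ := hG.comp f g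
    exact h.trans h'.symm
  rfl

theorem IsStrict.of_strict (F : StrictPseudofunctor A B) : IsStrict F.toPseudofunctor where
  id a := ⟨_, F.mapId_eq_eqToIso a⟩
  comp f g := ⟨_, F.mapComp_eq_eqToIso f g⟩

theorem map₂Iso_eqToIso (F : A ⥤ᵖ B) {a b : A} {f g : a ⟶ b} (h : f = g) :
    F.map₂Iso (eqToIso h) = eqToIso (congrArg F.map h) := by
  subst h
  ext
  exact F.map₂_id f

theorem IsStrict.compose {F : A ⥤ᵖ B} {G : B ⥤ᵖ C} (hF : IsStrict F) (hG : IsStrict G) :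
    IsStrict (F.comp G) where
  id a := by
    obtain ⟨h, e⟩ := hF.id a
    obtain ⟨h', e'⟩ := hG.id (F.obj a)
    exact ⟨(congrArg G.map h).trans h', by
      simp only [Pseudofunctor.comp, e, e', map₂Iso_eqToIso]
      exact eqToIso_trans _ _⟩
  comp f g := by
    obtain ⟨h, e⟩ := hF.comp f g
    obtain ⟨h', e'⟩ := hG.comp (F.map f) (F.map g)
    exact ⟨(congrArg G.map h).trans h', by
      simp only [Pseudofunctor.comp, e, e', map₂Iso_eqToIso]
      exact eqToIso_trans _ _⟩

theorem prod_eqToIso {a b : A} {c d : C} {f g : a ⟶ b} {f' g' : c ⟶ d} (h : f = g) (h' : f' = g') :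
    (Iso.prod (eqToIso h) (eqToIso h') : ((f, f') : (a, c) ⟶ (b, d)) ≅ (g, g')) =
      eqToIso (Prod.ext h h') := by
  subst h h'
  rfl

theorem IsStrict.prod {F : A ⥤ᵖ B} {G : C ⥤ᵖ D} (hF : IsStrict F) (hG : IsStrict G) :
    IsStrict (prodMap F G) where
  id a := by
    obtain ⟨h, e⟩ := hF.id a.1
    obtain ⟨h', e'⟩ := hG.id a.2
    refine ⟨Prod.ext h h', .trans ?_ (prod_eqToIso h h')⟩
    rw [← e, ← e']
    rfl
  comp f g := by
    obtain ⟨h, e⟩ := hF.comp f.1 g.1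
    obtain ⟨h', e'⟩ := hG.comp f.2 g.2
    refine ⟨Prod.ext h h', .trans ?_ (prod_eqToIso h h')⟩
    rw [← e, ← e']
    rfl

theorem isStrict_id : IsStrict (Pseudofunctor.id A) := ⟨fun _ => ⟨rfl, rfl⟩, fun _ _ => ⟨rfl, rfl⟩⟩

theorem isStrict_reassoc : IsStrict (reassoc A B C) := ⟨fun _ => ⟨rfl, rfl⟩, fun _ _ => ⟨rfl, rfl⟩⟩

theorem isStrict_sectR (a : A) (h : 𝟙 a = 𝟙 a ≫ 𝟙 a) (e : ρ_ (𝟙 a) = eqToIso h.symm) :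
    IsStrict (Bicategory.Prod.sectR a B).toPseudofunctor where
  id b := ⟨rfl, rfl⟩
  comp f g := by
    refine ⟨Prod.ext h rfl, .trans ?_ (prod_eqToIso h rfl)⟩
    show Iso.prod (ρ_ (𝟙 a)).symm (Iso.refl (f ≫ g)) = _
    rw [e]
    rfl

theorem isStrict_sectL (a : A) (h : 𝟙 a = 𝟙 a ≫ 𝟙 a) (e : λ_ (𝟙 a) = eqToIso h.symm) :
    IsStrict (Bicategory.Prod.sectL B a).toPseudofunctor where
  id b := ⟨rfl, rfl⟩
  comp f g := by
    refine ⟨Prod.ext rfl h, .trans ?_ (prod_eqToIso rfl h)⟩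
    show Iso.prod (Iso.refl (f ≫ g)) (λ_ (𝟙 a)).symm = _
    rw [e]
    rfl

/-- A 1-cell that is isomorphic to an identity, in a given way. -/
def Can {a b : A} (f : a ⟶ b) := (h : a = b) ×' (f ≅ eqToHom h)

namespace Can

variable {a b c : A}

/-- The canonical isomorphism. -/
def iso {f g : a ⟶ b} (x : Can f) (y : Can g) : f ≅ g := x.2 ≪≫ y.2.symm

/-- An identity. -/
def id (a : A) : Can (𝟙 a) := ⟨rfl, Iso.refl _⟩

/-- A composite. -/
def comp {f : a ⟶ b} {g : b ⟶ c} (x : Can f) (y : Can g) : Can (f ≫ g) :=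
  ⟨x.1.trans y.1, whiskerRightIso x.2 g ≪≫ whiskerLeftIso _ y.2 ≪≫
    (eqToHomTransIso x.1 y.1).symm⟩

/-- A tensor product. -/
def tensor (T : (A × A) ⥤ᵖ A) {a' b' : A} {f : a ⟶ b} {g : a' ⟶ b'} (x : Can f) (y : Can g) :
    Can (tmap T f g) :=
  ⟨by rw [x.1, y.1], tiso T x.2 y.2 ≪≫ by
    obtain ⟨rfl, _⟩ := x
    obtain ⟨rfl, _⟩ := y
    exact tid T a a'⟩

/-- A component of an identity of 2-functors. -/
def app {F G : A ⥤ᵖ B} (h : F = G) (a : A) :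
    Can (Pseudofunctor.StrongTrans.app (eqToHom h : F ⟶ G) a) :=
  ⟨by rw [h], eqToIso (by subst h; rfl)⟩

end Can

/-- The structure of a monoidal bicategory on a bicategory with a strictly associative and strictly
unital tensor product. All structure cells are identities, up to the constraints of the
bicategory and of the tensor product. -/
def MonData.ofStrict (T : (A × A) ⥤ᵖ A) (I : A)
    (h : (prodMap T (Pseudofunctor.id A)).comp T =
      (reassoc A A A).comp ((prodMap (Pseudofunctor.id A) T).comp T))
    (hl : tensorL T I = Pseudofunctor.id A) (hr : tensorR T I = Pseudofunctor.id A) :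
    MonData A where
  T := T
  I := I
  as := eqToHom h
  lu := eqToHom hl
  ru := eqToHom hr
  pent a b c d := Can.iso
    (((Can.app h ((a, b), c)).tensor T (Can.id d)).comp ((Can.app h ((a, T.obj (b, c)), d)).comp
      ((Can.id a).tensor T (Can.app h ((b, c), d)))))
    ((Can.app h ((T.obj (a, b), c), d)).comp (Can.app h ((a, b), T.obj (c, d))))
  mid a b := Can.iso ((Can.app h ((a, I), b)).comp ((Can.id a).tensor T (Can.app hl b)))
    ((Can.app hr a).tensor T (Can.id b))
  left a b := Can.iso ((Can.app h ((I, a), b)).comp (Can.app hl (T.obj (a, b))))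
    ((Can.app hl a).tensor T (Can.id b))
  right a b := Can.iso ((Can.app h ((a, b), I)).comp ((Can.id a).tensor T (Can.app hr b)))
    (Can.app hr (T.obj (a, b)))

end Strict

namespace Pi2

open unitInterval

theorem mk_heq {X : Type u} [TopologicalSpace X] {x y x' y' : Pi2 X} {f : x ⟶ y} {f' : x' ⟶ y'}
    (h : ∀ t, f.as t = f'.as t) : HEq f f' := by
  obtain ⟨x⟩ := x
  obtain ⟨y⟩ := y
  obtain ⟨x'⟩ := x'
  obtain ⟨y'⟩ := y'
  obtain ⟨f⟩ := f
  obtain ⟨f'⟩ := f'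
  obtain rfl : x = x' := by simpa using h 0
  obtain rfl : y = y' := by simpa using h 1
  obtain rfl : f = f' := by ext t; exact h t
  rfl

variable (G : Type u) [TopologicalSpace G] [Group G] [IsTopologicalGroup G]

theorem isStrict_tensor : IsStrict (tensor G) := .of_strict _

theorem tensor_assoc : (prodMap (tensor G) (Pseudofunctor.id (Pi2 G))).comp (tensor G) =
    (reassoc (Pi2 G) (Pi2 G) (Pi2 G)).comp
      ((prodMap (Pseudofunctor.id (Pi2 G)) (tensor G)).comp (tensor G)) := by
  refine IsStrict.ext (((isStrict_tensor G).prod isStrict_id).compose (isStrict_tensor G))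
    (isStrict_reassoc.compose ((isStrict_id.prod (isStrict_tensor G)).compose (isStrict_tensor G)))
    (fun a => congrArg Pi2.mk (mul_assoc _ _ _)) (fun f => mk_heq fun t => mul_assoc _ _ _)
    (fun η => ?_)
  obtain ⟨⟨η, θ⟩, κ⟩ := η
  induction η using ind with | h U
  induction θ using ind with | h V
  induction κ using ind with | h W
  exact pc_heq _ _ fun s t => mul_assoc (U s t) (V s t) (W s t)

theorem refl_trans_refl {X : Type u} [TopologicalSpace X] (x : Pi2 X) : 𝟙 x = 𝟙 x ≫ 𝟙 x :=
  congrArg FundamentalGroupoid.mk Path.refl_trans_refl.symm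

theorem rightUnitor_refl {X : Type u} [TopologicalSpace X] (x : Pi2 X) :
    ρ_ (𝟙 x) = eqToIso (refl_trans_refl x).symm := by
  ext
  refine eq_of_heq (HEq.trans ?_ (eqToHom_heq_id_cod _ _ (refl_trans_refl x).symm).symm)
  exact pc_heq ((rp φr Path.id _).cast _ _) (Path.refl _) fun s t => rfl

theorem leftUnitor_refl {X : Type u} [TopologicalSpace X] (x : Pi2 X) :
    λ_ (𝟙 x) = eqToIso (refl_trans_refl x).symm := by
  rw [← rightUnitor_refl]
  ext
  exact unitors_equal

theorem tensor_one_left : tensorL (tensor G) ⟨1⟩ = Pseudofunctor.id (Pi2 G) := by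
  refine IsStrict.ext ((isStrict_sectR _ (refl_trans_refl _) (rightUnitor_refl _)).compose (isStrict_tensor G))
    isStrict_id (fun a => congrArg Pi2.mk (one_mul _)) (fun f => mk_heq fun t => one_mul _)
    (fun η => ?_)
  induction η using ind with | h U
  exact pc_heq _ _ fun s t => one_mul (U s t)

theorem tensor_one_right : tensorR (tensor G) ⟨1⟩ = Pseudofunctor.id (Pi2 G) := by
  refine IsStrict.ext ((isStrict_sectL _ (refl_trans_refl _) (leftUnitor_refl _)).compose (isStrict_tensor G))
    isStrict_id (fun a => congrArg Pi2.mk (mul_one _)) (fun f => mk_heq fun t => mul_one _)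
    (fun η => ?_)
  induction η using ind with | h U
  exact pc_heq _ _ fun s t => mul_one (U s t)

/-- The monoidal structure on the fundamental 2-groupoid of a topological group. -/
def mon : MonData (Pi2 G) :=
  MonData.ofStrict (tensor G) ⟨1⟩ (tensor_assoc G) (tensor_one_left G) (tensor_one_right G)

end Pi2

end MonBicat

namespace MonBicat

universe w₁ v₁ u₁ w₂ v₂ u₂ w₃ v₃ u₃ w₄ v₄ u₄ u v

section SquareLemmas

variable {B : Type u₁} [Bicategory.{w₁, v₁} B] {C : Type u₂} [Bicategory.{w₂, v₂} C] (F : B ⥤ᵖ C)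

theorem mapSq_hom {a b c d : B} {f : a ⟶ b} {g : c ⟶ d} {u : a ⟶ c} {v : b ⟶ d}
    (Q : Sq f g u v) :
    (mapSq F Q).hom = (F.mapComp f v).inv ≫ F.map₂ Q.hom ≫ (F.mapComp u g).hom := rfl

theorem map₂_associator_inv {a b c d : B} (f : a ⟶ b) (g : b ⟶ c) (h : c ⟶ d) :
    F.map₂ (α_ f g h).inv = (F.mapComp f (g ≫ h)).hom ≫ F.map f ◁ (F.mapComp g h).hom ≫
      (α_ (F.map f) (F.map g) (F.map h)).inv ≫ (F.mapComp f g).inv ▷ F.map h ≫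
        (F.mapComp (f ≫ g) h).inv := by
  rw [← cancel_mono (F.map₂ (α_ f g h).hom), ← PrelaxFunctor.map₂_comp, Iso.inv_hom_id,
    F.map₂_associator]
  simp

theorem map₂_rightUnitor_inv {a b : B} (f : a ⟶ b) :
    F.map₂ (ρ_ f).inv = (ρ_ (F.map f)).inv ≫ F.map f ◁ (F.mapId b).inv ≫ (F.mapComp f (𝟙 b)).inv := by
  rw [← cancel_mono (F.map₂ (ρ_ f).hom), ← PrelaxFunctor.map₂_comp, Iso.inv_hom_id,
    F.map₂_right_unitor]
  simp

theorem mapSq_nat {a b c d : B} {f f' : a ⟶ b} {g g' : c ⟶ d} {u : a ⟶ c} {v : b ⟶ d}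
    (Q : Sq f g u v) (Q' : Sq f' g' u v) (i : f ⟶ f') (j : g ⟶ g')
    (h : i ▷ v ≫ Q'.hom = Q.hom ≫ u ◁ j) :
    F.map₂ i ▷ F.map v ≫ (mapSq F Q').hom = (mapSq F Q).hom ≫ F.map u ◁ F.map₂ j := by
  have := congrArg F.map₂ h
  simp only [PrelaxFunctor.map₂_comp, Pseudofunctor.map₂_whisker_left,
    Pseudofunctor.map₂_whisker_right, Category.assoc] at this
  simp only [mapSq_hom, Category.assoc]
  rw [← cancel_epi (F.mapComp f v).hom, ← cancel_mono (F.mapComp u g').inv]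
  simpa using this

theorem mapSq_unit {a b : B} {f : a ⟶ a} {g : b ⟶ b} {u : a ⟶ b} (Q : Sq f g u u) (i : f ⟶ 𝟙 a)
    (j : g ⟶ 𝟙 b) (h : Q.hom ≫ u ◁ j = i ▷ u ≫ (λ_ u).hom ≫ (ρ_ u).inv) :
    (mapSq F Q).hom ≫ F.map u ◁ (F.map₂ j ≫ (F.mapId b).hom) =
      (F.map₂ i ≫ (F.mapId a).hom) ▷ F.map u ≫ (λ_ (F.map u)).hom ≫ (ρ_ (F.map u)).inv := by
  have := congrArg F.map₂ h
  simp only [PrelaxFunctor.map₂_comp, Pseudofunctor.map₂_whisker_left,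
    Pseudofunctor.map₂_whisker_right, Category.assoc, Pseudofunctor.map₂_left_unitor,
    map₂_rightUnitor_inv] at this
  rw [mapSq_hom, Category.assoc, Iso.inv_comp_eq]
  have h2 := this =≫ ((F.mapComp u (𝟙 b)).hom ≫ F.map u ◁ (F.mapId b).hom)
  simpa using h2

theorem mapSq_hcomp {a b c d e k : B} {f : a ⟶ b} {g : c ⟶ d} {u : a ⟶ c} {v : b ⟶ d} {f' : b ⟶ e}
    {g' : d ⟶ k} {w : e ⟶ k} {h : a ⟶ e} {h' : c ⟶ k} (S : Sq h h' u w) (Q : Sq f g u v)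
    (R : Sq f' g' v w) (i : h ⟶ f ≫ f') (j : h' ⟶ g ≫ g')
    (hS : S.hom ≫ u ◁ j = i ▷ w ≫ (hcomp Q R).hom) :
    (mapSq F S).hom ≫ F.map u ◁ (F.map₂ j ≫ (F.mapComp g g').hom) =
      (F.map₂ i ≫ (F.mapComp f f').hom) ▷ F.map w ≫ (hcomp (mapSq F Q) (mapSq F R)).hom := by
  have := congrArg F.map₂ hS
  simp only [hcomp, Iso.trans_hom, whiskerLeftIso_hom, Iso.symm_hom, whiskerRightIso_hom,
    PrelaxFunctor.map₂_comp, Pseudofunctor.map₂_whisker_left, Pseudofunctor.map₂_whisker_right,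
    Category.assoc, Pseudofunctor.map₂_associator, map₂_associator_inv,
    Iso.inv_hom_id_assoc, ← comp_whiskerRight_assoc,
    ← Bicategory.whiskerLeft_comp_assoc] at this
  have h2 := this =≫ ((F.mapComp u (g ≫ g')).hom ≫ F.map u ◁ (F.mapComp g g').hom)
  rw [mapSq_hom, Category.assoc, Iso.inv_comp_eq]
  simpa [mapSq_hom, hcomp] using h2

end SquareLemmas

section Whiskering

variable {A : Type u₁} [Bicategory.{w₁, v₁} A] {B : Type u₂} [Bicategory.{w₂, v₂} B]
  {C : Type u₃} [Bicategory.{w₃, v₃} C] {D : Type u₄} [Bicategory.{w₄, v₄} D]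

/-- Whiskering of a pseudo-natural transformation with a 2-functor applied afterwards. -/
def wR {F G : A ⥤ᵖ B} (η : F ⟶ G) (X : B ⥤ᵖ C) : F.comp X ⟶ G.comp X where
  app a := X.map (η.app a)
  naturality f := mapSq X (η.naturality f)
  naturality_naturality ξ := mapSq_nat X _ _ _ _ (η.naturality_naturality ξ)
  naturality_id a := mapSq_unit X _ _ _ (η.naturality_id a)
  naturality_comp f g := mapSq_hcomp X _ _ _ _ _ (η.naturality_comp f g)

theorem nat_unit {X Y : B ⥤ᵖ C} (θ : X ⟶ Y) {a : B} {f : a ⟶ a} (i : f ⟶ 𝟙 a) :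
    (θ.naturality f).hom ≫ θ.app a ◁ (Y.map₂ i ≫ (Y.mapId a).hom) =
      (X.map₂ i ≫ (X.mapId a).hom) ▷ θ.app a ≫ (λ_ (θ.app a)).hom ≫ (ρ_ (θ.app a)).inv := by
  rw [Bicategory.whiskerLeft_comp, comp_whiskerRight, Category.assoc, ← θ.naturality_id,
    ← Category.assoc, ← θ.naturality_naturality, Category.assoc]

theorem nat_comp {X Y : B ⥤ᵖ C} (θ : X ⟶ Y) {a b c : B} {f : a ⟶ b} {g : b ⟶ c} {h : a ⟶ c}
    (i : h ⟶ f ≫ g) :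
    (θ.naturality h).hom ≫ θ.app a ◁ (Y.map₂ i ≫ (Y.mapComp f g).hom) =
      (X.map₂ i ≫ (X.mapComp f g).hom) ▷ θ.app c ≫
        (hcomp (θ.naturality f) (θ.naturality g)).hom := by
  rw [Bicategory.whiskerLeft_comp, comp_whiskerRight, Category.assoc, ← Category.assoc,
    ← θ.naturality_naturality, Category.assoc, θ.naturality_comp]
  rfl

/-- Whiskering of a pseudo-natural transformation with a 2-functor applied before. -/
def wL (F : A ⥤ᵖ B) {X Y : B ⥤ᵖ C} (θ : X ⟶ Y) : F.comp X ⟶ F.comp Y where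
  app a := θ.app (F.obj a)
  naturality f := θ.naturality (F.map f)
  naturality_naturality ξ := θ.naturality_naturality (F.map₂ ξ)
  naturality_id a := nat_unit θ (F.mapId a).hom
  naturality_comp f g := nat_comp θ (F.mapComp f g).hom

end Whiskering

end MonBicat

namespace MonBicat

universe w₁ v₁ u₁ w₂ v₂ u₂ w₃ v₃ u₃ w₄ v₄ u₄ u v

section Composite

theorem map₂_assoc {B : Type u₁} [Bicategory.{w₁, v₁} B] {C : Type u₂} [Bicategory.{w₂, v₂} C]
    (F : B ⥤ᵖ C) {a b : B} {f g h : a ⟶ b} (p : f ⟶ g) (q : g ⟶ h) {k : F.obj a ⟶ F.obj b}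
    (r : F.map h ⟶ k) : F.map₂ p ≫ F.map₂ q ≫ r = F.map₂ (p ≫ q) ≫ r := by
  rw [F.map₂_comp, Category.assoc]

theorem replace {B : Type u₁} [Bicategory.{w₁, v₁} B] {a b c d : B} {f f' : a ⟶ b} {g g' : c ⟶ d}
    {u : a ⟶ c} {v : b ⟶ d} {Q : f ≫ v ⟶ u ≫ g} {R : f' ≫ v ⟶ u ≫ g'} {i i' : f ⟶ f'}
    {j j' : g ⟶ g'} (h : Q ≫ u ◁ j = i ▷ v ≫ R) (hj : j' = j) (hi : i' = i) :
    Q ≫ u ◁ j' = i' ▷ v ≫ R := by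
  rw [hj, hi, h]

variable {A : Type u₁} [Bicategory.{w₁, v₁} A] {B : Type u₂} [Bicategory.{w₂, v₂} B]
  {C : Type u₃} [Bicategory.{w₃, v₃} C]

variable {S : (A × A) ⥤ᵖ A} {T : (B × B) ⥤ᵖ B} {U : (C × C) ⥤ᵖ C} {Y : A ⥤ᵖ B} {X : B ⥤ᵖ C}

/-- The first factor of the comparison of tensor products for a composite. -/
def compχ₁ (Y : A ⥤ᵖ B) (η : (prodMap X X).comp U ⟶ T.comp X) :
    (prodMap (Y.comp X) (Y.comp X)).comp U ⟶ (prodMap Y Y).comp (T.comp X) where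
  app a := η.app ((prodMap Y Y).obj a)
  naturality f := η.naturality ((prodMap Y Y).map f)
  naturality_naturality ξ := η.naturality_naturality ((prodMap Y Y).map₂ ξ)
  naturality_id a := replace (nat_unit η ((prodMap Y Y).mapId a).hom) rfl
    (map₂_assoc U ((prodMap X X).map₂ ((prodMap Y Y).mapId a).hom)
      ((prodMap X X).mapId ((prodMap Y Y).obj a)).hom (U.mapId _).hom).symm
  naturality_comp f g := replace (nat_comp η ((prodMap Y Y).mapComp f g).hom) rfl
    (map₂_assoc U ((prodMap X X).map₂ ((prodMap Y Y).mapComp f g).hom)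
      ((prodMap X X).mapComp ((prodMap Y Y).map f) ((prodMap Y Y).map g)).hom
      (U.mapComp _ _).hom).symm

/-- The second factor of the comparison of tensor products for a composite. -/
def compχ₂ (X : B ⥤ᵖ C) (η : (prodMap Y Y).comp T ⟶ S.comp Y) :
    (prodMap Y Y).comp (T.comp X) ⟶ S.comp (Y.comp X) where
  app a := X.map (η.app a)
  naturality f := mapSq X (η.naturality f)
  naturality_naturality ξ := mapSq_nat X _ _ _ _ (η.naturality_naturality ξ)
  naturality_id a := replace (mapSq_unit X _ _ _ (η.naturality_id a)) (map₂_assoc X _ _ _)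
    (map₂_assoc X _ _ _)
  naturality_comp f g := replace (mapSq_hcomp X _ _ _ _ _ (η.naturality_comp f g))
    (map₂_assoc X _ _ _) (map₂_assoc X _ _ _)

/-- The comparison of tensor products for a composite. -/
def compχ (η : (prodMap X X).comp U ⟶ T.comp X) (θ : (prodMap Y Y).comp T ⟶ S.comp Y) :
    (prodMap (Y.comp X) (Y.comp X)).comp U ⟶ S.comp (Y.comp X) := compχ₁ Y η ≫ compχ₂ X θ

end Composite

section Reorder

variable {B : Type u₁} [Bicategory.{w₁, v₁} B]

/-- Exchanging the two middle factors of a composite of four 1-cells. -/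
def reorder {a b c c' d e : B} {m : a ⟶ c} {p : a ⟶ b} {q : b ⟶ c} {r : c ⟶ d} {s : d ⟶ e}
    {q' : b ⟶ c'} {r' : c' ⟶ d} {k : c' ⟶ e} (i : m ≅ p ≫ q) (x : q ≫ r ≅ q' ≫ r')
    (j : k ≅ r' ≫ s) : m ≫ r ≫ s ≅ (p ≫ q') ≫ k :=
  whiskerRightIso i _ ≪≫ α_ _ _ _ ≪≫ whiskerLeftIso p ((α_ _ _ _).symm ≪≫
    whiskerRightIso x s ≪≫ α_ _ _ _) ≪≫ (α_ _ _ _).symm ≪≫ whiskerLeftIso _ j.symm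

end Reorder

namespace MonFunData

variable {B : Type u₁} [Bicategory.{w₁, v₁} B] {C : Type u₂} [Bicategory.{w₂, v₂} C]
  {D : Type u₃} [Bicategory.{w₃, v₃} D] {M : MonData B} {N : MonData C} {K : MonData D}

/-- Naturality of the comparison of tensor products with respect to `f ⊗ 1`. -/
def χnatR (Z : MonFunData M N) {a a' : B} (f : a ⟶ a') (b : B) :
    tmap N.T (Z.F.map f) (𝟙 (Z.o b)) ≫ Z.χ a' b ≅ Z.χ a b ≫ Z.F.map (tmap M.T f (𝟙 b)) :=
  whiskerRightIso (tiso N.T (Iso.refl _) (Z.F.mapId b).symm) _ ≪≫ Z.χnat f (𝟙 b)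

/-- Naturality of the comparison of tensor products with respect to `1 ⊗ f`. -/
def χnatL (Z : MonFunData M N) (a : B) {b b' : B} (f : b ⟶ b') :
    tmap N.T (𝟙 (Z.o a)) (Z.F.map f) ≫ Z.χ a b' ≅ Z.χ a b ≫ Z.F.map (tmap M.T (𝟙 a) f) :=
  whiskerRightIso (tiso N.T (Z.F.mapId a).symm (Iso.refl _)) _ ≪≫ Z.χnat (𝟙 a) f

/-- The composite of two weak monoidal 2-functors, `Y` followed by `X`. -/
def comp (X : MonFunData N K) (Y : MonFunData M N) : MonFunData M K where
  F := Y.F.comp X.F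
  χt := compχ X.χt Y.χt
  ι := X.ι ≫ X.F.map Y.ι
  ω a b c := adj
    (reorder (rcomp K.T _ _ _) (X.χnatR (Y.χ a b) (Y.o c)) (X.F.mapComp _ _))
    (vcomp (X.om (Y.o a) (Y.o b) (Y.o c)) (mapSq X.F (Y.om a b c)))
    (reorder (lcomp K.T _ _ _) (X.χnatL (Y.o a) (Y.χ b c)) (X.F.mapComp _ _))
  γ a := adj
    (reorder (rcomp K.T _ _ _) (X.χnatR Y.ι (Y.o a)) (X.F.mapComp _ _))
    (vcomp (X.ga (Y.o a)) (mapSq X.F (Y.ga a)))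
    ((λ_ _).symm ≪≫ whiskerLeftIso _ (X.F.mapId _).symm)
  δ a := adj
    (reorder (lcomp K.T _ _ _) (X.χnatL (Y.o a) Y.ι) (X.F.mapComp _ _))
    (vcomp (X.de (Y.o a)) (mapSq X.F (Y.de a)))
    ((λ_ _).symm ≪≫ whiskerLeftIso _ (X.F.mapId _).symm)

/-- The comparison of a tensor product of identities with an identity. -/
def collapse (N : MonData C) (a b : C) : tmap N.T (𝟙 a) (𝟙 b) ≫ 𝟙 (tobj N.T a b) ≅
    𝟙 (tobj N.T a b) := ρ_ _ ≪≫ tid N.T a b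

/-- The identity monoidal 2-functor. -/
def id (M : MonData B) : MonFunData M M where
  F := Pseudofunctor.id B
  χt :=
    { app := fun a => 𝟙 (M.T.obj a)
      naturality := fun f => idV (M.T.map f)
      naturality_naturality := fun ξ => (Pseudofunctor.StrongTrans.id M.T).naturality_naturality ξ
      naturality_id := fun a => replace ((Pseudofunctor.StrongTrans.id M.T).naturality_id a)
        (Category.comp_id (M.T.mapId a).hom)
        ((congrArg (fun k => k ≫ (M.T.mapId a).hom) (M.T.map₂_id (𝟙 a))).trans
          (Category.id_comp (M.T.mapId a).hom))
      naturality_comp := fun f g => replace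
        ((Pseudofunctor.StrongTrans.id M.T).naturality_comp f g)
        (Category.comp_id (M.T.mapComp f g).hom)
        ((congrArg (fun k => k ≫ (M.T.mapComp f g).hom) (M.T.map₂_id (f ≫ g))).trans
          (Category.id_comp (M.T.mapComp f g).hom)) }
  ι := 𝟙 M.I
  ω a b c := adj (collapse M _ _) (idV (M.α a b c)) (collapse M _ _)
  γ a := adj (collapse M _ _) (idV (M.l a)) (Iso.refl _)
  δ a := adj (collapse M _ _) (idV (M.r a)) (Iso.refl _)

end MonFunData

end MonBicat

namespace MonBicat

universe w₁ v₁ u₁ w₂ v₂ u₂ w₃ v₃ u₃ w₄ v₄ u₄ u v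

section HomBicategory

variable {B : Type u₁} [Bicategory.{w₁, v₁} B] {C : Type u₂} [Bicategory.{w₂, v₂} C]
  {M : MonData B} {N : MonData C}

instance : CategoryStruct (MonFunData M N) where
  Hom X Y := MonTransData X Y
  id X :=
    { t := 𝟙 X.F
      P := fun a b => adj (tid N.T _ _) (idV (X.χ a b)) (Iso.refl _)
      U := idV X.ι }
  comp θ κ :=
    { t := θ.t ≫ κ.t
      P := fun a b => adj (tcomp N.T) (vcomp (θ.P a b) (κ.P a b)) (Iso.refl _)
      U := adj (λ_ (𝟙 N.I)).symm (vcomp θ.U κ.U) (Iso.refl _) }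

/-- The 2-cells are the modifications between the underlying pseudo-natural transformations. -/
instance (X Y : MonFunData M N) : Category (X ⟶ Y) where
  Hom θ κ := θ.t ⟶ κ.t
  id θ := 𝟙 θ.t
  comp Γ Θ := Pseudofunctor.StrongTrans.homCategory.comp Γ Θ
  id_comp Γ := Category.id_comp (X := MonTransData.t _) Γ
  comp_id Γ := Category.comp_id (X := MonTransData.t _) Γ
  assoc Γ Θ Λ := Category.assoc (W := MonTransData.t _) Γ Θ Λ

/-- A modification as a 2-cell. -/
def ofIso {X Y : MonFunData M N} {θ κ : X ⟶ Y} (i : θ.t ≅ κ.t) : θ ≅ κ :=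
  ⟨i.hom, i.inv, i.hom_inv_id, i.inv_hom_id⟩

instance : Bicategory (MonFunData M N) where
  homCategory X Y := inferInstance
  whiskerLeft θ _ _ Γ := Bicategory.whiskerLeft (MonTransData.t θ) Γ
  whiskerRight Γ κ := Bicategory.whiskerRight (f := MonTransData.t _) Γ (MonTransData.t κ)
  associator θ κ ξ := ofIso (α_ θ.t κ.t ξ.t)
  leftUnitor θ := ofIso (λ_ θ.t)
  rightUnitor θ := ofIso (ρ_ θ.t)
  whiskerLeft_id θ κ := Bicategory.whiskerLeft_id θ.t κ.t
  whiskerLeft_comp θ _ _ _ Γ Θ := Bicategory.whiskerLeft_comp θ.t (g := MonTransData.t _) Γ Θ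
  id_whiskerLeft Γ := Bicategory.id_whiskerLeft (f := MonTransData.t _) Γ
  comp_whiskerLeft θ κ _ _ Γ := Bicategory.comp_whiskerLeft θ.t κ.t (h := MonTransData.t _) Γ
  id_whiskerRight θ κ := Bicategory.id_whiskerRight θ.t κ.t
  comp_whiskerRight Γ Θ κ := Bicategory.comp_whiskerRight (f := MonTransData.t _) Γ Θ κ.t
  whiskerRight_id Γ := Bicategory.whiskerRight_id (f := MonTransData.t _) Γ
  whiskerRight_comp Γ θ κ := Bicategory.whiskerRight_comp (f := MonTransData.t _) Γ θ.t κ.t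
  whisker_assoc θ _ _ Γ κ := Bicategory.whisker_assoc θ.t (g := MonTransData.t _) Γ κ.t
  whisker_exchange Γ Θ := Bicategory.whisker_exchange (f := MonTransData.t _) (h := MonTransData.t _) Γ Θ
  pentagon θ κ ξ ζ := Bicategory.pentagon θ.t κ.t ξ.t ζ.t
  triangle θ κ := Bicategory.triangle θ.t κ.t

end HomBicategory

end MonBicat

namespace MonBicat

universe w₁ v₁ u₁ w₂ v₂ u₂ w₃ v₃ u₃ w₄ v₄ u₄ u v

section Elementary

variable {A : Type u₁} [Bicategory.{w₁, v₁} A] {B : Type u₂} [Bicategory.{w₂, v₂} B]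
  {C : Type u₃} [Bicategory.{w₃, v₃} C]

theorem mapSq_vcomp (F : B ⥤ᵖ C) {a b c d e k : B} {f : a ⟶ b} {g : c ⟶ d} {h : e ⟶ k}
    {u : a ⟶ c} {v : b ⟶ d} {u' : c ⟶ e} {v' : d ⟶ k} (Q : Sq f g u v) (R : Sq g h u' v') :
    F.map f ◁ (F.mapComp v v').hom ≫ (vcomp (mapSq F Q) (mapSq F R)).hom =
      (mapSq F (vcomp Q R)).hom ≫ (F.mapComp u u').hom ▷ F.map h := by
  simp [vcomp, mapSq_hom, map₂_associator_inv]

theorem strongTrans_comp_naturality {F G H : B ⥤ᵖ C} (η : F ⟶ G) (θ : G ⟶ H) {a b : B} (f : a ⟶ b) :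
    (η ≫ θ).naturality f = vcomp (η.naturality f) (θ.naturality f) := by
  rfl

theorem strongTrans_id_naturality (F : B ⥤ᵖ C) {a b : B} (f : a ⟶ b) :
    (𝟙 F : F ⟶ F).naturality f = idV (F.map f) := rfl

/-- Whiskering preserves composition. -/
def wRcomp {F G H : A ⥤ᵖ B} (η : F ⟶ G) (θ : G ⟶ H) (X : B ⥤ᵖ C) :
    wR (η ≫ θ) X ≅ wR η X ≫ wR θ X :=
  Pseudofunctor.StrongTrans.isoMk (fun a => X.mapComp (η.app a) (θ.app a)) fun f =>
    mapSq_vcomp X (η.naturality f) (θ.naturality f)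

theorem map₂_leftUnitor_inv (F : B ⥤ᵖ C) {a b : B} (f : a ⟶ b) :
    F.map₂ (λ_ f).inv = (λ_ (F.map f)).inv ≫ (F.mapId a).inv ▷ F.map f ≫
      (F.mapComp (𝟙 a) f).inv := by
  rw [← cancel_mono (F.map₂ (λ_ f).hom), ← PrelaxFunctor.map₂_comp, Iso.inv_hom_id,
    F.map₂_left_unitor]
  simp

theorem mapSq_idV (F : B ⥤ᵖ C) {a b : B} (f : a ⟶ b) :
    F.map f ◁ (F.mapId b).hom ≫ (idV (F.map f)).hom =
      (mapSq F (idV f)).hom ≫ (F.mapId a).hom ▷ F.map f := by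
  simp [idV, mapSq_hom, map₂_leftUnitor_inv]

/-- Whiskering preserves identities. -/
def wRid (F : A ⥤ᵖ B) (X : B ⥤ᵖ C) : wR (𝟙 F) X ≅ 𝟙 (F.comp X) :=
  Pseudofunctor.StrongTrans.isoMk (fun a => X.mapId (F.obj a)) fun f => mapSq_idV X (F.map f)

/-- The interchange of two whiskered transformations. -/
def inter {F G : A ⥤ᵖ B} {X Y : B ⥤ᵖ C} (η : F ⟶ G) (θ : X ⟶ Y) :
    wR η X ≫ wL G θ ≅ wL F θ ≫ wR η Y :=
  Pseudofunctor.StrongTrans.isoMk (fun a => θ.naturality (η.app a)) fun {a b} f => by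
    have h := θ.naturality_naturality (η.naturality f).hom
    rw [Pseudofunctor.StrongTrans.naturality_comp_hom,
      Pseudofunctor.StrongTrans.naturality_comp_hom] at h
    have h2 := ((α_ (X.map (F.map f)) (X.map (η.app b)) (θ.app (G.obj b))).inv ≫
      (X.mapComp (F.map f) (η.app b)).inv ▷ θ.app (G.obj b)) ≫= (h =≫
      (θ.app (F.obj a) ◁ (Y.mapComp (η.app a) (G.map f)).hom ≫
        (α_ (θ.app (F.obj a)) (Y.map (η.app a)) (Y.map (G.map f))).inv))
    show X.map (F.map f) ◁ (θ.naturality (η.app b)).hom ≫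
      (vcomp (θ.naturality (F.map f)) (mapSq Y (η.naturality f))).hom =
      (vcomp (mapSq X (η.naturality f)) (θ.naturality (G.map f))).hom ≫
        (θ.naturality (η.app a)).hom ▷ Y.map (G.map f)
    simp only [vcomp, mapSq_hom, Iso.trans_hom, Iso.symm_hom, whiskerRightIso_hom, whiskerLeftIso_hom]
    simpa using h2.symm

/-- Whiskering of modifications. -/
def wR₂ {F G : A ⥤ᵖ B} {η θ : F ⟶ G} (Γ : η ⟶ θ) (X : B ⥤ᵖ C) : wR η X ⟶ wR θ X where
  as :=
    { app := fun a => X.map₂ (Γ.as.app a)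
      naturality := fun f => by
        have := congrArg X.map₂ (Γ.as.naturality f)
        simp only [PrelaxFunctor.map₂_comp, Pseudofunctor.map₂_whisker_left,
          Pseudofunctor.map₂_whisker_right, Category.assoc] at this
        show X.map (F.map f) ◁ X.map₂ _ ≫ (mapSq X (θ.naturality f)).hom =
          (mapSq X (η.naturality f)).hom ≫ X.map₂ _ ▷ X.map (G.map f)
        rw [mapSq_hom, mapSq_hom, Category.assoc, Category.assoc, Iso.eq_inv_comp]
        have h2 := this =≫ (X.mapComp _ _).hom
        simpa using h2 }

/-- Whiskering of modifications. -/
def wL₂ (F : A ⥤ᵖ B) {X Y : B ⥤ᵖ C} {η θ : X ⟶ Y} (Γ : η ⟶ θ) : wL F η ⟶ wL F θ where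
  as :=
    { app := fun a => Γ.as.app (F.obj a)
      naturality := fun f => Γ.as.naturality (F.map f) }

end Elementary

end MonBicat

namespace MonBicat

universe w₁ v₁ u₁ w₂ v₂ u₂ w₃ v₃ u₃ w₄ v₄ u₄ u v

section Pasting

variable {C : Type u₂} [Bicategory.{w₂, v₂} C] {x y z w x' y' z' w' x'' y'' z'' w'' d : C}

/-- A 2-cell that distributes a composite over two composites. -/
def paste {f : x ⟶ y} {g : y ⟶ z} {fg : x ⟶ z} {s : y ⟶ y'} {t : z ⟶ z'} {g' : y' ⟶ z'}
    (m : fg ⟶ f ≫ g) (n : g ≫ t ⟶ s ≫ g') (k : z' ⟶ d) : fg ≫ t ≫ k ⟶ (f ≫ s) ≫ g' ≫ k :=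
  m ▷ (t ≫ k) ≫ (α_ f _ _).hom ≫ f ◁ ((α_ _ _ _).inv ≫ n ▷ k ≫ (α_ _ _ _).hom) ≫ (α_ f s _).inv

theorem paste_assoc {f : x ⟶ y} {g : y ⟶ z} {h : z ⟶ w} {fg : x ⟶ z} {gh : y ⟶ w} {fgh : x ⟶ w}
    {fgh₁ : x ⟶ w} {s : y ⟶ y'} {t : z ⟶ z'} {u : w ⟶ w'} {g' : y' ⟶ z'} {h' : z' ⟶ w'}
    {gh' : y' ⟶ w'} {t' : z' ⟶ z''} {u' : w' ⟶ w''} {h'' : z'' ⟶ w''} (k : w'' ⟶ d)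
    (m₁ : fgh₁ ⟶ fg ≫ h) (m₂ : fg ⟶ f ≫ g) (m₃ : fgh ⟶ f ≫ gh) (m₄ : gh ⟶ g ≫ h)
    (a : fgh₁ ⟶ fgh) (ha : a ≫ m₃ ≫ f ◁ m₄ = m₁ ≫ m₂ ▷ h ≫ (α_ f g h).hom)
    (n₁ : Sq h h' t u) (n₂ : Sq h' h'' t' u') (n₃ : Sq g g' s t) (n₄ : Sq gh gh' s u)
    (m₅ : gh' ⟶ g' ≫ h') (hn : n₄.hom ≫ s ◁ m₅ = m₄ ▷ u ≫ (hcomp n₃ n₁).hom) :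
    paste m₁ (vcomp n₁ n₂).hom k ≫ paste m₂ n₃.hom t' ▷ (h'' ≫ k) ≫ (α_ _ _ _).hom =
      (a ▷ ((u ≫ u') ≫ k) ≫ fgh ◁ (α_ _ _ _).hom) ≫ paste m₃ n₄.hom (u' ≫ k) ≫
        (f ≫ s) ◁ paste m₅ n₂.hom k := by
  have e1 : paste m₁ (vcomp n₁ n₂).hom k ≫ paste m₂ n₃.hom t' ▷ (h'' ≫ k) ≫ (α_ _ _ _).hom =
      m₁ ▷ ((u ≫ u') ≫ k) ⊗≫ (fg ◁ (n₁.hom ▷ (u' ≫ k) ⊗≫ t ◁ n₂.hom ▷ k) ≫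
        m₂ ▷ (t ≫ (t' ≫ h'') ≫ k)) ⊗≫ f ◁ n₃.hom ▷ ((t' ≫ h'') ≫ k) ⊗≫
        𝟙 ((f ≫ s) ≫ (g' ≫ t') ≫ h'' ≫ k) := by
    simp only [paste, vcomp, Iso.trans_hom, Iso.symm_hom, whiskerLeftIso_hom, whiskerRightIso_hom]
    bicategory
  have e2 : (a ▷ ((u ≫ u') ≫ k) ≫ fgh ◁ (α_ _ _ _).hom) ≫ paste m₃ n₄.hom (u' ≫ k) ≫
        (f ≫ s) ◁ paste m₅ n₂.hom k = (a ≫ m₃) ▷ ((u ≫ u') ≫ k) ⊗≫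
        f ◁ (n₄.hom ≫ s ◁ m₅) ▷ (u' ≫ k) ⊗≫ f ◁ s ◁ g' ◁ n₂.hom ▷ k ⊗≫
        𝟙 ((f ≫ s) ≫ (g' ≫ t') ≫ h'' ≫ k) := by
    simp only [paste]
    bicategory
  have e3 : (a ≫ m₃) ▷ ((u ≫ u') ≫ k) ⊗≫
        f ◁ (m₄ ▷ u ≫ (hcomp n₃ n₁).hom) ▷ (u' ≫ k) ⊗≫ f ◁ s ◁ g' ◁ n₂.hom ▷ k ⊗≫
        𝟙 ((f ≫ s) ≫ (g' ≫ t') ≫ h'' ≫ k) = (a ≫ m₃ ≫ f ◁ m₄) ▷ ((u ≫ u') ≫ k) ⊗≫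
        f ◁ g ◁ n₁.hom ▷ (u' ≫ k) ⊗≫ f ◁ (n₃.hom ▷ (h' ≫ u' ≫ k) ≫
          (s ≫ g') ◁ (α_ _ _ _).inv ≫ (s ≫ g') ◁ (n₂.hom ▷ k)) ⊗≫
        𝟙 ((f ≫ s) ≫ (g' ≫ t') ≫ h'' ≫ k) := by
    simp only [hcomp, Iso.trans_hom, Iso.symm_hom, whiskerLeftIso_hom, whiskerRightIso_hom]
    bicategory
  rw [e1, e2, hn, e3, ha, ← Bicategory.whiskerLeft_comp, ← whisker_exchange, whisker_exchange]
  bicategory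

end Pasting

section GodementComponents

variable {B : Type u₁} [Bicategory.{w₁, v₁} B] {C : Type u₂} [Bicategory.{w₂, v₂} C]
  {X X' X'' : B ⥤ᵖ C} {x y z w : B} {d : C}

/-- The component of the compatibility of horizontal composition with composition. -/
def mc (θ : X ⟶ X') (f : x ⟶ y) (g : y ⟶ z) (k : X'.obj z ⟶ d) :
    X.map (f ≫ g) ≫ θ.app z ≫ k ⟶ (X.map f ≫ θ.app y) ≫ X'.map g ≫ k :=
  paste (X.mapComp f g).hom (θ.naturality g).hom k

theorem mc_comp {f f' f'' : x ⟶ y} {k k' k'' : X.obj y ⟶ d} (i : f ⟶ f') (i' : f' ⟶ f'')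
    (j : k ⟶ k') (j' : k' ⟶ k'') :
    X.map₂ (i ≫ i') ▷ k ≫ X.map f'' ◁ (j ≫ j') =
      (X.map₂ i ▷ k ≫ X.map f' ◁ j) ≫ X.map₂ i' ▷ k' ≫ X.map f'' ◁ j' := by
  simp [whisker_exchange_assoc]

theorem mc_nat_k (θ : X ⟶ X') (f : x ⟶ y) (g : y ⟶ z) {k k' : X'.obj z ⟶ d} (j : k ⟶ k') :
    X.map (f ≫ g) ◁ θ.app z ◁ j ≫ mc θ f g k' =
      mc θ f g k ≫ (X.map f ≫ θ.app y) ◁ X'.map g ◁ j := by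
  simp only [mc, paste, Category.assoc]
  rw [← Category.assoc, whisker_exchange]
  simp only [Category.assoc, associator_naturality_right_assoc]
  simp only [← Bicategory.whiskerLeft_comp_assoc, associator_inv_naturality_right_assoc, whisker_exchange_assoc, associator_naturality_right]
  simp

theorem mc_nat_g (θ : X ⟶ X') (f : x ⟶ y) {g g' : y ⟶ z} {k : X'.obj z ⟶ d} (i : g ⟶ g') :
    X.map₂ (f ◁ i) ▷ (θ.app z ≫ k) ≫ mc θ f g' k =
      mc θ f g k ≫ (X.map f ≫ θ.app y) ◁ (X'.map₂ i ▷ k) := by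
  have h := congrArg (fun t => X.map f ◁ (t ▷ k)) (θ.naturality_naturality i)
  simp only [comp_whiskerRight, Bicategory.whiskerLeft_comp] at h
  simp [mc, paste]
  rw [reassoc_of% h]
  simp

theorem mc_left (θ : X ⟶ X') (f : x ⟶ y) {g g' : y ⟶ z} {k k' : X'.obj z ⟶ d} (i : g ⟶ g')
    (j : k ⟶ k') :
    (X.map₂ (f ◁ i) ▷ (θ.app z ≫ k) ≫ X.map (f ≫ g') ◁ θ.app z ◁ j) ≫ mc θ f g' k' =
      mc θ f g k ≫ (X.map f ≫ θ.app y) ◁ (X'.map₂ i ▷ k ≫ X'.map g' ◁ j) := by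
  rw [Category.assoc, mc_nat_k, reassoc_of% (mc_nat_g θ f i), Bicategory.whiskerLeft_comp]

theorem mc_nat_f (θ : X ⟶ X') {f f' : x ⟶ y} (i : f ⟶ f') (g : y ⟶ z) (k : X'.obj z ⟶ d) :
    X.map₂ (i ▷ g) ▷ (θ.app z ≫ k) ≫ mc θ f' g k =
      mc θ f g k ≫ (X.map₂ i ▷ θ.app y) ▷ (X'.map g ≫ k) := by
  have h : X.map₂ (i ▷ g) ≫ (X.mapComp f' g).hom = (X.mapComp f g).hom ≫ X.map₂ i ▷ X.map g := by
    simp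
  have h2 := congrArg (fun t => t ▷ (θ.app z ≫ k)) h
  simp only [comp_whiskerRight] at h2
  simp only [mc, paste, Category.assoc]
  rw [reassoc_of% h2]
  simp only [associator_naturality_left_assoc, ← whisker_exchange_assoc,
    associator_inv_naturality_left]

theorem mc_nat_θ {θ θ' : X ⟶ X'} (Θ : θ ⟶ θ') (f : x ⟶ y) (g : y ⟶ z)
    (k : X'.obj z ⟶ d) :
    X.map (f ≫ g) ◁ Θ.as.app z ▷ k ≫ mc θ' f g k =
      mc θ f g k ≫ (X.map f ◁ Θ.as.app y) ▷ (X'.map g ≫ k) := by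
  have h := congrArg (fun t => X.map f ◁ (t ▷ k)) (Θ.as.naturality g)
  simp only [comp_whiskerRight, Bicategory.whiskerLeft_comp] at h
  simp only [mc, paste, Category.assoc]
  rw [← Category.assoc, whisker_exchange]
  have h' := X.map f ◁ (α_ _ _ _).inv ≫= h
  simp at h'
  simp [reassoc_of% h']

theorem mc_right {θ θ' : X ⟶ X'} (Θ : θ ⟶ θ') {f f' : x ⟶ y} (i : f ⟶ f') (g : y ⟶ z)
    (k : X'.obj z ⟶ d) :
    (X.map₂ (i ▷ g) ▷ (θ.app z ≫ k) ≫ X.map (f' ≫ g) ◁ Θ.as.app z ▷ k) ≫ mc θ' f' g k =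
      mc θ f g k ≫ (X.map₂ i ▷ θ.app y ≫ X.map f' ◁ Θ.as.app y) ▷ (X'.map g ≫ k) := by
  rw [Category.assoc, mc_nat_θ, reassoc_of% (mc_nat_f θ i g k), comp_whiskerRight]

theorem mc_assoc (θ : X ⟶ X') (θ' : X' ⟶ X'') (f : x ⟶ y) (g : y ⟶ z) (h : z ⟶ w)
    (k : X''.obj w ⟶ d) :
    mc (θ ≫ θ') (f ≫ g) h k ≫ mc θ f g (θ'.app z) ▷ (X''.map h ≫ k) ≫ (α_ _ _ _).hom =
      (X.map₂ (α_ f g h).hom ▷ ((θ.app w ≫ θ'.app w) ≫ k) ≫ X.map (f ≫ g ≫ h) ◁ (α_ _ _ _).hom) ≫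
       mc θ f (g ≫ h) (θ'.app w ≫ k) ≫ _ ◁ mc θ' g h k := by
  refine paste_assoc k _ _ _ (X.mapComp g h).hom _ ?_ (θ.naturality h) (θ'.naturality h) (θ.naturality g)
    (θ.naturality (g ≫ h)) _ ?_
  · simp
  · rw [θ.naturality_comp]
    rfl

theorem mc_lunit (f : x ⟶ y) (k : X.obj y ⟶ d) :
    X.map₂ (λ_ f).hom ▷ (𝟙 _ ≫ k) ≫ X.map f ◁ (λ_ k).hom =
      mc (𝟙 X) (𝟙 x) f k ≫ ((X.mapId x).hom ▷ 𝟙 _ ≫ (ρ_ _).hom) ▷ _ ≫ (λ_ _).hom := by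
  have h (m : X.map (𝟙 x ≫ f) ⟶ X.map (𝟙 x) ≫ X.map f) (i : X.map (𝟙 x) ⟶ 𝟙 (X.obj x)) :
      (m ≫ i ▷ X.map f ≫ (λ_ (X.map f)).hom) ▷ (𝟙 _ ≫ k) ≫ X.map f ◁ (λ_ k).hom =
        paste m (idV (X.map f)).hom k ≫ (i ▷ 𝟙 _ ≫ (ρ_ _).hom) ▷ _ ≫ (λ_ _).hom := by
    simp only [paste, idV, Iso.trans_hom, Iso.symm_hom]
    bicategory
  rw [X.map₂_left_unitor]
  exact h _ _

theorem mc_runit (θ : X ⟶ X') (f : x ⟶ y) :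
    X.map₂ (ρ_ f).hom ▷ (θ.app y ≫ 𝟙 _) ≫ X.map f ◁ (ρ_ (θ.app y)).hom =
      mc θ f (𝟙 y) (𝟙 _) ≫ _ ◁ ((X'.mapId y).hom ▷ 𝟙 _ ≫ (ρ_ _).hom) ≫ (ρ_ _).hom := by
  simp [mc, paste]

end GodementComponents

end MonBicat

namespace MonBicat

universe w₁ v₁ u₁ w₂ v₂ u₂ w₃ v₃ u₃ w₄ v₄ u₄ u v

section Godement

variable {B : Type u₁} [Bicategory.{w₁, v₁} B]

/-- The horizontal composite of two pseudo-natural transformations. -/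
def god {F F' X X' : B ⥤ᵖ B} (θ : X ⟶ X') (η : F ⟶ F') : F.comp X ⟶ F'.comp X' :=
  wR η X ≫ wL F' θ

/-- Horizontal composition is compatible with composition. -/
def godComp {F F' F'' X X' X'' : B ⥤ᵖ B} (θ : X ⟶ X') (θ' : X' ⟶ X'') (η : F ⟶ F')
    (η' : F' ⟶ F'') : god (θ ≫ θ') (η ≫ η') ≅ god θ η ≫ god θ' η' :=
  whiskerRightIso (wRcomp η η' X) (wL F'' θ ≫ wL F'' θ') ≪≫
    α_ _ _ _ ≪≫ whiskerLeftIso _ ((α_ _ _ _).symm ≪≫ whiskerRightIso (inter η' θ) _ ≪≫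
      α_ _ _ _) ≪≫ (α_ _ _ _).symm

/-- Horizontal composition is compatible with identities. -/
def godId (F X : B ⥤ᵖ B) : god (𝟙 X) (𝟙 F) ≅ 𝟙 (F.comp X) :=
  whiskerRightIso (wRid F X) (𝟙 (F.comp X)) ≪≫ ρ_ _

/-- Horizontal composition of modifications. -/
def god₂ {F F' X X' : B ⥤ᵖ B} {θ θ' : X ⟶ X'} {η η' : F ⟶ F'} (Θ : θ ⟶ θ') (Γ : η ⟶ η') :
    god θ η ⟶ god θ' η' := wR₂ Γ X ▷ wL F' θ ≫ wR η' X ◁ wL₂ F' Θ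

section
variable {F F' F'' X X' X'' : B ⥤ᵖ B}

theorem god_app (θ : X ⟶ X') (η : F ⟶ F') (a : B) :
    (god θ η).app a = X.map (η.app a) ≫ θ.app (F'.obj a) := rfl

theorem godComp_app (θ : X ⟶ X') (θ' : X' ⟶ X'') (η : F ⟶ F') (η' : F' ⟶ F'') (a : B) :
    (godComp θ θ' η η').hom.as.app a =
      mc θ (η.app a) (η'.app a) (θ'.app (F''.obj a)) := rfl

theorem godId_app (F X : B ⥤ᵖ B) (a : B) :
    (godId F X).hom.as.app a = (X.mapId (F.obj a)).hom ▷ 𝟙 _ ≫ (ρ_ _).hom := rfl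

theorem god₂_app {θ θ' : X ⟶ X'} {η η' : F ⟶ F'} (Θ : θ ⟶ θ') (Γ : η ⟶ η') (a : B) :
    (god₂ Θ Γ).as.app a =
      X.map₂ (Γ.as.app a) ▷ θ.app (F'.obj a) ≫ X.map (η'.app a) ◁ Θ.as.app (F'.obj a) := rfl

end

/-- Composition of weak 2-functors as a weak 2-functor. -/
def godT : ((B ⥤ᵖ B) × (B ⥤ᵖ B)) ⥤ᵖ (B ⥤ᵖ B) where
  obj X := X.2.comp X.1
  map θ := god θ.1 θ.2
  map₂ Γ := god₂ Γ.1 Γ.2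
  mapId X := godId X.2 X.1
  mapComp θ κ := godComp θ.1 κ.1 θ.2 κ.2
  map₂_id {X Y} θ := by
    ext a
    have h {x y : B} (f : x ⟶ y) {z : B} (k : X.1.obj y ⟶ z) :
        X.1.map₂ (𝟙 f) ▷ k ≫ X.1.map f ◁ 𝟙 k = 𝟙 _ := by simp
    exact h (θ.2.app a) _
  map₂_comp Γ Γ' := by
    ext a
    exact mc_comp _ _ _ _
  map₂_whisker_left θ κ κ' Γ := by
    rw [← Category.assoc, Iso.eq_comp_inv]
    ext a
    exact mc_left θ.1 _ _ _
  map₂_whisker_right Γ κ := by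
    rw [← Category.assoc, Iso.eq_comp_inv]
    ext a
    exact mc_right Γ.1 _ _ _
  map₂_associator θ κ ξ := by
    have H : (godComp (θ.1 ≫ κ.1) ξ.1 (θ.2 ≫ κ.2) ξ.2).hom ≫
        (godComp θ.1 κ.1 θ.2 κ.2).hom ▷ god ξ.1 ξ.2 ≫ (α_ _ _ _).hom =
        god₂ (α_ θ.1 κ.1 ξ.1).hom (α_ θ.2 κ.2 ξ.2).hom ≫
          (godComp θ.1 (κ.1 ≫ ξ.1) θ.2 (κ.2 ≫ ξ.2)).hom ≫
            god θ.1 θ.2 ◁ (godComp κ.1 ξ.1 κ.2 ξ.2).hom := by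
      ext a
      exact mc_assoc _ _ _ _ _ _
    have e := H =≫ (god θ.1 θ.2 ◁ (godComp κ.1 ξ.1 κ.2 ξ.2).inv ≫
      (godComp θ.1 (κ.1 ≫ ξ.1) θ.2 (κ.2 ≫ ξ.2)).inv)
    simp only [Category.assoc, whiskerLeft_hom_inv_assoc, Iso.hom_inv_id, Category.comp_id] at e
    exact e.symm
  map₂_left_unitor θ := by
    ext a
    exact mc_lunit _ _
  map₂_right_unitor θ := by
    ext a
    exact mc_runit _ _

end Godement

namespace MonFunData

variable {B : Type u₁} [Bicategory.{w₁, v₁} B] {M : MonData B}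

/-- The horizontal composite of two monoidal pseudo-natural transformations. -/
def god {X X' Y Y' : MonFunData M M} (θ : X ⟶ X') (κ : Y ⟶ Y') : X.comp Y ⟶ X'.comp Y' where
  t := MonBicat.god θ.t κ.t
  P a b := adj (tcomp M.T)
    (vcomp (hcomp (X.χnat (κ.app a) (κ.app b)).symm (mapSq X.F (κ.P a b)))
      (hcomp (θ.P (Y'.o a) (Y'.o b)) (θ.nat (Y'.χ a b)))) (Iso.refl _)
  U := adj (λ_ (𝟙 M.I)).symm
    (vcomp (hcomp X.ιsq.symm (mapSq X.F κ.U)) (hcomp θ.U (θ.nat Y'.ι))) (Iso.refl _)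

/-- The underlying weak 2-functors of a pair. -/
abbrev under (X : MonFunData M M × MonFunData M M) : (B ⥤ᵖ B) × (B ⥤ᵖ B) := (X.1.F, X.2.F)

/-- The underlying pseudo-natural transformations of a pair. -/
abbrev under₁ {X Y : MonFunData M M × MonFunData M M} (θ : X ⟶ Y) : under X ⟶ under Y :=
  (MonTransData.t θ.1, MonTransData.t θ.2)

/-- The underlying modifications of a pair. -/
abbrev under₂ {X Y : MonFunData M M × MonFunData M M} {θ κ : X ⟶ Y} (Γ : θ ⟶ κ) :
    under₁ θ ⟶ under₁ κ := Γ

/-- The tensor product of weak monoidal 2-functors is given by composition. -/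
def tensor (M : MonData B) : (MonFunData M M × MonFunData M M) ⥤ᵖ MonFunData M M where
  obj X := X.1.comp X.2
  map θ := god θ.1 θ.2
  map₂ Γ := god₂ Γ.1 Γ.2
  mapId X := ofIso (godId X.2.F X.1.F)
  mapComp θ κ := ofIso (godComp θ.1.t κ.1.t θ.2.t κ.2.t)
  map₂_id θ := godT.map₂_id (under₁ θ)
  map₂_comp Γ Γ' := godT.map₂_comp (under₂ Γ) (under₂ Γ')
  map₂_whisker_left θ _ _ Γ := godT.map₂_whisker_left (under₁ θ) (under₂ Γ)
  map₂_whisker_right Γ κ := godT.map₂_whisker_right (under₂ Γ) (under₁ κ)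
  map₂_associator θ κ ξ := godT.map₂_associator (under₁ θ) (under₁ κ) (under₁ ξ)
  map₂_left_unitor θ := godT.map₂_left_unitor (under₁ θ)
  map₂_right_unitor θ := godT.map₂_right_unitor (under₁ θ)

end MonFunData

end MonBicat

namespace MonBicat

universe w₁ v₁ u₁ w₂ v₂ u₂ w₃ v₃ u₃ w₄ v₄ u₄ u v

section IdentitySquares

variable {B : Type u₁} [Bicategory.{w₁, v₁} B] {C : Type u₂} [Bicategory.{w₂, v₂} C] {x y : B}
  {f g h : x ⟶ y}

/-- A square with equal horizontal edges whose vertical edges are trivialised, such that it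
becomes an identity square. -/
def IsIdSq {u : x ⟶ x} {v : y ⟶ y} (Q : Sq f f u v) (j : u ≅ 𝟙 x) (k : v ≅ 𝟙 y) : Prop :=
  f ◁ k.hom ≫ (idV f).hom = Q.hom ≫ j.hom ▷ f

/-- The composite of two trivialised 1-cells is trivialised. -/
def triv {u u' : x ⟶ x} (j : u ≅ 𝟙 x) (j' : u' ≅ 𝟙 x) : u ≫ u' ≅ 𝟙 x :=
  whiskerRightIso j u' ≪≫ λ_ u' ≪≫ j'

/-- The image of a trivialised 1-cell is trivialised. -/
def trivMap (F : B ⥤ᵖ C) {u : x ⟶ x} (j : u ≅ 𝟙 x) : F.map u ≅ 𝟙 (F.obj x) :=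
  F.map₂Iso j ≪≫ F.mapId x

theorem isIdSq_idV : IsIdSq (idV f) (Iso.refl _) (Iso.refl _) := by simp [IsIdSq]

theorem IsIdSq.vcomp {u u' : x ⟶ x} {v v' : y ⟶ y} {Q : Sq f f u v} {R : Sq f f u' v'}
    {j : u ≅ 𝟙 x} {j' : u' ≅ 𝟙 x} {k : v ≅ 𝟙 y} {k' : v' ≅ 𝟙 y} (hQ : IsIdSq Q j k)
    (hR : IsIdSq R j' k') : IsIdSq (vcomp Q R) (triv j j') (triv k k') := by
  unfold IsIdSq at *
  simp only [MonBicat.vcomp, triv, Iso.trans_hom, Iso.symm_hom, whiskerLeftIso_hom,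
    whiskerRightIso_hom]
  calc _ = 𝟙 _ ⊗≫ (f ◁ k.hom ≫ (idV f).hom) ▷ v' ⊗≫ (f ◁ k'.hom ≫ (idV f).hom) ⊗≫ 𝟙 _ := by
        simp only [idV, Iso.trans_hom, Iso.symm_hom]; bicategory
    _ = 𝟙 _ ⊗≫ Q.hom ▷ v' ⊗≫ (j.hom ▷ (f ≫ v') ≫ 𝟙 x ◁ R.hom) ⊗≫ j'.hom ▷ f ⊗≫ 𝟙 _ := by
        rw [hQ, hR]; bicategory
    _ = _ := by rw [← whisker_exchange]; bicategory

theorem IsIdSq.map (F : B ⥤ᵖ C) {u : x ⟶ x} {v : y ⟶ y} {Q : Sq f f u v} {j : u ≅ 𝟙 x}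
    {k : v ≅ 𝟙 y} (hQ : IsIdSq Q j k) : IsIdSq (mapSq F Q) (trivMap F j) (trivMap F k) := by
  have h := congrArg F.map₂ hQ
  simp only [PrelaxFunctor.map₂_comp, Pseudofunctor.map₂_whisker_left,
    Pseudofunctor.map₂_whisker_right, Category.assoc, idV, Iso.trans_hom, Iso.symm_hom,
    map₂_leftUnitor_inv, Pseudofunctor.map₂_right_unitor] at h
  have h2 := (F.mapComp f v).inv ≫= h =≫ ((F.mapComp (𝟙 x) f).hom ≫ (F.mapId x).hom ▷ F.map f)
  simp only [IsIdSq, mapSq_hom, trivMap, idV]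
  simpa using h2

theorem IsIdSq.iso {u u' : x ⟶ x} {v v' : y ⟶ y} {Q : Sq f f u v} {R : Sq f f u' v'}
    {j : u ≅ 𝟙 x} {j' : u' ≅ 𝟙 x} {k : v ≅ 𝟙 y} {k' : v' ≅ 𝟙 y} (hQ : IsIdSq Q j k)
    (hR : IsIdSq R j' k') :
    f ◁ (k ≪≫ k'.symm).hom ≫ R.hom = Q.hom ≫ (j ≪≫ j'.symm).hom ▷ f := by
  have h := hQ =≫ j'.inv ▷ f
  simp only [IsIdSq] at h hR
  have h2 : R.hom = f ◁ k'.hom ≫ (idV f).hom ≫ j'.inv ▷ f := by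
    rw [← Category.assoc, hR]; simp
  simp only [Iso.trans_hom, Iso.symm_hom, Bicategory.whiskerLeft_comp, comp_whiskerRight,
    Category.assoc, h2]
  simpa using h

/-- A 2-isomorphism as a square with vertical identities. -/
def isoV (e : f ≅ g) : Sq f g (𝟙 x) (𝟙 y) := ρ_ f ≪≫ e ≪≫ (λ_ g).symm

theorem isoV_nat {f' g' : x ⟶ y} {e : f ≅ g} {e' : f' ≅ g'} {i : f ⟶ f'} {j : g ⟶ g'}
    (H : i ≫ e'.hom = e.hom ≫ j) : i ▷ 𝟙 y ≫ (isoV e').hom = (isoV e).hom ≫ 𝟙 x ◁ j := by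
  simp [isoV, reassoc_of% H]

theorem isoV_unit {f g : x ⟶ x} {e : f ≅ g} {i : f ⟶ 𝟙 x} {j : g ⟶ 𝟙 x} (H : e.hom ≫ j = i) :
    (isoV e).hom ≫ 𝟙 x ◁ j = i ▷ 𝟙 x ≫ (λ_ (𝟙 x)).hom ≫ (ρ_ (𝟙 x)).inv := by
  simp [isoV, ← H, unitors_equal]

theorem isoV_comp {z : B} {f' g' : y ⟶ z} {h h' : x ⟶ z} {e : f ≅ g} {e' : f' ≅ g'} {e'' : h ≅ h'}
    {i : h ⟶ f ≫ f'} {j : h' ⟶ g ≫ g'} (H : e''.hom ≫ j = i ≫ f ◁ e'.hom ≫ e.hom ▷ g') :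
    (isoV e'').hom ≫ 𝟙 x ◁ j = i ▷ 𝟙 z ≫ (hcomp (isoV e) (isoV e')).hom := by
  simp only [isoV, hcomp, Iso.trans_hom, Iso.symm_hom, whiskerLeftIso_hom, whiskerRightIso_hom]
  calc _ = 𝟙 _ ⊗≫ (e''.hom ≫ j) ⊗≫ 𝟙 _ := by bicategory
    _ = _ := by rw [H]; bicategory

theorem isoV_vcomp {x' y' : B} {f' : x' ⟶ y'} {u u' : x ⟶ x'} {v v' : y ⟶ y'} (Q : Sq f f' u v)
    (R : Sq f f' u' v') (i : u ≅ u') (j : v ≅ v') (H : f ◁ j.hom ≫ R.hom = Q.hom ≫ i.hom ▷ f') :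
    f ◁ (isoV j).hom ≫ (vcomp (idV f) R).hom = (vcomp Q (idV f')).hom ≫ (isoV i).hom ▷ f' := by
  simp only [isoV, vcomp, idV, Iso.trans_hom, Iso.symm_hom, whiskerLeftIso_hom,
    whiskerRightIso_hom]
  calc _ = 𝟙 _ ⊗≫ (f ◁ j.hom ≫ R.hom) ⊗≫ 𝟙 _ := by bicategory
    _ = _ := by rw [H]; bicategory

theorem vcomp_assoc {a b c d a' b' c' d' : B} {f₁ : a ⟶ a'} {f₂ : b ⟶ b'} {f₃ : c ⟶ c'}
    {f₄ : d ⟶ d'} {u₁ : a ⟶ b} {v₁ : a' ⟶ b'} {u₂ : b ⟶ c} {v₂ : b' ⟶ c'} {u₃ : c ⟶ d}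
    {v₃ : c' ⟶ d'} (P : Sq f₁ f₂ u₁ v₁) (Q : Sq f₂ f₃ u₂ v₂) (R : Sq f₃ f₄ u₃ v₃) {u : a ⟶ c}
    {v : a' ⟶ c'} (S : Sq f₁ f₃ u v) (i : u ≅ u₁ ≫ u₂) (j : v ≅ v₁ ≫ v₂)
    (H : f₁ ◁ j.hom ≫ (vcomp P Q).hom = S.hom ≫ i.hom ▷ f₃) :
    f₁ ◁ ((α_ _ _ _).symm ≪≫ whiskerRightIso j.symm v₃).hom ≫ (vcomp S R).hom = (vcomp P (vcomp Q R)).hom ≫ ((α_ _ _ _).symm ≪≫ whiskerRightIso i.symm u₃).hom ▷ f₄ := by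
  simp only [vcomp, Iso.trans_hom, Iso.symm_hom, whiskerLeftIso_hom,
    whiskerRightIso_hom] at *
  have H' : S.hom = (f₁ ◁ j.hom ≫ (α_ f₁ v₁ v₂).inv ≫ P.hom ▷ v₂ ≫ (α_ u₁ f₂ v₂).hom ≫
      u₁ ◁ Q.hom ≫ (α_ u₁ u₂ f₃).inv) ≫ i.inv ▷ f₃ := by rw [H]; simp
  rw [H']
  calc _ = 𝟙 _ ⊗≫ (f₁ ◁ (j.inv ≫ j.hom) ▷ v₃) ⊗≫ P.hom ▷ (v₂ ≫ v₃) ⊗≫ u₁ ◁ Q.hom ▷ v₃ ⊗≫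
        (i.inv ▷ (f₃ ≫ v₃) ≫ u ◁ R.hom) ⊗≫ 𝟙 _ := by bicategory
    _ = _ := by rw [← whisker_exchange, Iso.inv_hom_id]; bicategory

end IdentitySquares

end MonBicat

namespace MonBicat

universe w₁ v₁ u₁ w₂ v₂ u₂ w₃ v₃ u₃ w₄ v₄ u₄ u v

section Composition

variable {B : Type u₁} [Bicategory.{w₁, v₁} B]

theorem mapSq_compose (Y X : B ⥤ᵖ B) {a b c d : B} {f : a ⟶ b} {g : c ⟶ d} {u : a ⟶ c} {v : b ⟶ d}
    (Q : Sq f g u v) : mapSq (Y.comp X) Q = mapSq X (mapSq Y Q) := by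
  ext
  have h : ((X.mapComp (Y.map f) (Y.map v)).inv ≫ X.map₂ (Y.mapComp f v).inv) ≫
      X.map₂ (Y.map₂ Q.hom) ≫ X.map₂ (Y.mapComp u g).hom ≫ (X.mapComp (Y.map u) (Y.map g)).hom =
      (X.mapComp (Y.map f) (Y.map v)).inv ≫ X.map₂ ((Y.mapComp f v).inv ≫ Y.map₂ Q.hom ≫
        (Y.mapComp u g).hom) ≫ (X.mapComp (Y.map u) (Y.map g)).hom := by
    simp only [PrelaxFunctor.map₂_comp, Category.assoc]
  exact h

theorem mapSq_identity {a b c d : B} {f : a ⟶ b} {g : c ⟶ d} {u : a ⟶ c} {v : b ⟶ d}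
    (Q : Sq f g u v) : mapSq (Pseudofunctor.id B) Q = Q := by
  ext
  exact (Category.id_comp _).trans (Category.comp_id Q.hom)

theorem vcomp_idV {a b c d : B} {f : a ⟶ b} {g : c ⟶ d} {u : a ⟶ c} {v : b ⟶ d}
    (Q : Sq f g u v) : f ◁ (ρ_ v).hom ≫ Q.hom = (vcomp Q (idV g)).hom ≫ (ρ_ u).hom ▷ g := by
  simp only [vcomp, idV, Iso.trans_hom, Iso.symm_hom, whiskerLeftIso_hom, whiskerRightIso_hom]
  bicategory

theorem IsIdSq.vcomp_right {a b c d : B} {f : a ⟶ b} {g : c ⟶ d} {u : a ⟶ c} {v : b ⟶ d}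
    {u' : a ⟶ a} {v' : b ⟶ b} {Q : Sq f f u' v'} {j : u' ≅ 𝟙 a} {k : v' ≅ 𝟙 b} (hQ : IsIdSq Q j k)
    (R : Sq f g u v) :
    f ◁ (whiskerRightIso k v ≪≫ λ_ v).hom ≫ R.hom =
      (MonBicat.vcomp Q R).hom ≫ (whiskerRightIso j u ≪≫ λ_ u).hom ▷ g := by
  simp only [IsIdSq] at hQ
  simp only [MonBicat.vcomp, Iso.trans_hom, Iso.symm_hom, whiskerLeftIso_hom, whiskerRightIso_hom]
  calc _ = 𝟙 _ ⊗≫ (f ◁ k.hom ≫ (idV f).hom) ▷ v ⊗≫ R.hom ⊗≫ 𝟙 _ := by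
        simp only [idV, Iso.trans_hom, Iso.symm_hom]; bicategory
    _ = 𝟙 _ ⊗≫ Q.hom ▷ v ⊗≫ (j.hom ▷ (f ≫ v) ≫ 𝟙 a ◁ R.hom) ⊗≫ 𝟙 _ := by
        rw [hQ]; bicategory
    _ = _ := by rw [← whisker_exchange]; bicategory

/-- Associativity of the composition of weak 2-functors; the components are identities. -/
def asT (X Y Z : B ⥤ᵖ B) : Z.comp (Y.comp X) ⟶ (Z.comp Y).comp X where
  app a := 𝟙 (X.obj (Y.obj (Z.obj a)))
  naturality f := idV (X.map (Y.map (Z.map f)))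
  naturality_naturality ξ := (𝟙 (Z.comp (Y.comp X)) : _ ⟶ _).naturality_naturality ξ
  naturality_id a := replace ((𝟙 (Z.comp (Y.comp X)) : _ ⟶ _).naturality_id a)
    (map₂_assoc X _ _ _).symm rfl
  naturality_comp f g := replace ((𝟙 (Z.comp (Y.comp X)) : _ ⟶ _).naturality_comp f g)
    (map₂_assoc X _ _ _).symm rfl

/-- Left unitality of the composition of weak 2-functors; the components are identities. -/
def luT (X : B ⥤ᵖ B) : X.comp (Pseudofunctor.id B) ⟶ X where
  app a := 𝟙 (X.obj a)
  naturality f := idV (X.map f)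
  naturality_naturality ξ := (𝟙 X : X ⟶ X).naturality_naturality ξ
  naturality_id a := replace ((𝟙 X : X ⟶ X).naturality_id a) rfl
    (Category.comp_id _)
  naturality_comp f g := replace ((𝟙 X : X ⟶ X).naturality_comp f g) rfl
    (Category.comp_id _)

/-- Right unitality of the composition of weak 2-functors; the components are identities. -/
def ruT (X : B ⥤ᵖ B) : (Pseudofunctor.id B).comp X ⟶ X where
  app a := 𝟙 (X.obj a)
  naturality f := idV (X.map f)
  naturality_naturality ξ := (𝟙 X : X ⟶ X).naturality_naturality ξ
  naturality_id a := replace ((𝟙 X : X ⟶ X).naturality_id a) rfl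
    ((congrArg (fun k => k ≫ (X.mapId a).hom) (X.map₂_id _)).trans (Category.id_comp _))
  naturality_comp f g := replace ((𝟙 X : X ⟶ X).naturality_comp f g) rfl
    ((congrArg (fun k => k ≫ (X.mapComp f g).hom) (X.map₂_id _)).trans (Category.id_comp _))

/-- Naturality of the associativity. -/
def asN {X X' Y Y' Z Z' : B ⥤ᵖ B} (θ : X ⟶ X') (κ : Y ⟶ Y') (ξ : Z ⟶ Z') :
    god (god θ κ) ξ ≫ asT X' Y' Z' ≅ asT X Y Z ≫ god θ (god κ ξ) :=
  Pseudofunctor.StrongTrans.isoMk (fun a => isoV ((α_ _ _ _).symm ≪≫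
      whiskerRightIso (X.mapComp (Y.map (ξ.app a)) (κ.app (Z'.obj a))).symm
        (θ.app (Y'.obj (Z'.obj a))))) fun {a b} f => by
    refine isoV_vcomp (vcomp (mapSq (Y.comp X) (ξ.naturality f)) (vcomp (mapSq X (κ.naturality (Z'.map f))) (θ.naturality (Y'.map (Z'.map f))))) (vcomp (mapSq X (vcomp (mapSq Y (ξ.naturality f)) (κ.naturality (Z'.map f)))) (θ.naturality (Y'.map (Z'.map f)))) _ _ ?_
    have e : mapSq (Y.comp X) (ξ.naturality f) = mapSq X (mapSq Y (ξ.naturality f)) :=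
      mapSq_compose _ _ _
    rw [e]
    exact vcomp_assoc _ _ _ _ _ _ (mapSq_vcomp X (mapSq Y (ξ.naturality f)) (κ.naturality (Z'.map f)))

/-- Naturality of the left unitality. -/
def luN {X X' : B ⥤ᵖ B} (θ : X ⟶ X') :
    god (𝟙 (Pseudofunctor.id B)) θ ≫ luT X' ≅ luT X ≫ θ :=
  Pseudofunctor.StrongTrans.isoMk (fun a => isoV (ρ_ (θ.app a))) fun {a b} f => by
    refine isoV_vcomp (vcomp (mapSq (Pseudofunctor.id B) (θ.naturality f)) (idV (X'.map f))) (θ.naturality f) _ _ ?_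
    have e : mapSq (Pseudofunctor.id B) (θ.naturality f) = θ.naturality f := mapSq_identity _
    rw [e]
    exact vcomp_idV _

/-- Naturality of the right unitality. -/
def ruN {X X' : B ⥤ᵖ B} (θ : X ⟶ X') :
    god θ (𝟙 (Pseudofunctor.id B)) ≫ ruT X' ≅ ruT X ≫ θ :=
  Pseudofunctor.StrongTrans.isoMk (fun a => isoV (whiskerRightIso (X.mapId a) (θ.app a) ≪≫ λ_ _)) fun {a b} f => by
    refine isoV_vcomp (vcomp (mapSq X (idV f)) (θ.naturality f)) (θ.naturality f) _ _ ?_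
    exact IsIdSq.vcomp_right (mapSq_idV X f) _

end Composition

end MonBicat

namespace MonBicat

universe w₁ v₁ u₁ w₂ v₂ u₂ w₃ v₃ u₃ w₄ v₄ u₄ u v

section Components

variable {B : Type u₁} [Bicategory.{w₁, v₁} B] (X : B ⥤ᵖ B) {x y z : B} {w : B}

/-- The component of the naturality of the associativity of composition. -/
abbrev asIso (f : x ⟶ y) (k : y ⟶ z) (t : X.obj z ⟶ w) :
    X.map f ≫ X.map k ≫ t ≅ X.map (f ≫ k) ≫ t :=
  (α_ _ _ _).symm ≪≫ whiskerRightIso (X.mapComp f k).symm t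

theorem as_nat {f f' : x ⟶ y} {k k' : y ⟶ z} {t t' : X.obj z ⟶ w} (i : f ⟶ f') (l : k ⟶ k')
    (m : t ⟶ t') :
    (X.map₂ i ▷ (X.map k ≫ t) ≫ X.map f' ◁ (X.map₂ l ▷ t ≫ X.map k' ◁ m)) ≫
      (asIso X f' k' t').hom =
    (asIso X f k t).hom ≫ (X.map₂ (i ▷ k ≫ f' ◁ l) ▷ t ≫ X.map (f' ≫ k') ◁ m) := by
  simp only [Iso.trans_hom, Iso.symm_hom, whiskerRightIso_hom, PrelaxFunctor.map₂_comp,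
    Pseudofunctor.map₂_whisker_left, Pseudofunctor.map₂_whisker_right]
  have h := whisker_exchange (X.mapComp f' k').inv m
  simp
  rw [← h]
  simp

theorem as_unit {u : x ⟶ x} (j : u ⟶ 𝟙 x) {o : u ⟶ u} (ho : o = 𝟙 u) :
    (asIso X u (𝟙 x) (𝟙 _)).hom ≫ (X.map₂ (j ▷ 𝟙 x ≫ (ρ_ _).hom) ▷ 𝟙 _ ≫ X.map (𝟙 x) ◁ 𝟙 _) ≫
      (X.mapId x).hom ▷ 𝟙 _ ≫ (ρ_ _).hom =
    (X.map₂ o ▷ _ ≫ X.map u ◁ ((X.mapId x).hom ▷ 𝟙 _ ≫ (ρ_ _).hom)) ≫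
      (X.map₂ j ≫ (X.mapId x).hom) ▷ 𝟙 _ ≫ (ρ_ _).hom := by
  simp [ho]

theorem nat_compInv {X X' : B ⥤ᵖ B} (θ : X ⟶ X') (f : x ⟶ y) (g : y ⟶ z) :
    (X.mapComp f g).inv ▷ θ.app z ≫ (θ.naturality (f ≫ g)).hom =
      (hcomp (θ.naturality f) (θ.naturality g)).hom ≫ θ.app x ◁ (X'.mapComp f g).inv := by
  have h := (X.mapComp f g).inv ▷ θ.app z ≫= θ.naturality_comp f g =≫
    θ.app x ◁ (X'.mapComp f g).inv
  simp only [Category.assoc, whiskerLeft_hom_inv, Category.comp_id, inv_hom_whiskerRight_assoc] at h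
  rw [h]
  simp [hcomp]

theorem map₂_paste {y' z' d : B} {p : x ⟶ z} {f : x ⟶ y}
    {g : y ⟶ z} {g' : y' ⟶ z'} {s : y ⟶ y'} {t : z ⟶ z'} (m : p ⟶ f ≫ g) (n : g ≫ t ⟶ s ≫ g')
    (k : z' ⟶ d) :
    (X.mapComp p (t ≫ k)).inv ≫ X.map₂ (paste m n k) ≫ (X.mapComp (f ≫ s) (g' ≫ k)).hom =
      X.map p ◁ (X.mapComp t k).hom ⊗≫ (X.map₂ m ≫ (X.mapComp f g).hom) ▷ (X.map t ≫ X.map k) ⊗≫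
      X.map f ◁ ((X.mapComp g t).inv ≫ X.map₂ n ≫ (X.mapComp s g').hom) ▷ X.map k ⊗≫
      (X.map f ≫ X.map s) ◁ (X.mapComp g' k).inv ≫ (X.mapComp f s).inv ▷ X.map (g' ≫ k) := by
  simp [paste, map₂_associator_inv, bicategoricalComp]

theorem as_comp {X' : B ⥤ᵖ B} (θ : X ⟶ X') {x y z y' z' d e : B} {p : x ⟶ z} {f : x ⟶ y}
    {g : y ⟶ z} {g' : y' ⟶ z'} {s : y ⟶ y'} {t : z ⟶ z'} (m : p ⟶ f ≫ g) (n : Sq g g' s t)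
    (k : z' ⟶ d) (r : X'.obj d ⟶ e) {o : p ⟶ p} (ho : o = 𝟙 p) :
    (asIso X p (t ≫ k) (θ.app d ≫ r)).hom ≫
      (X.map₂ (paste m n.hom k) ▷ (θ.app d ≫ r) ≫ X.map ((f ≫ s) ≫ g' ≫ k) ◁ 𝟙 _) ≫
      mc θ (f ≫ s) (g' ≫ k) r =
    ((X.map₂ o ▷ _ ≫ X.map p ◁ mc θ t k r) ≫
      paste (X.map₂ m ≫ (X.mapComp f g).hom) (vcomp (mapSq X n) (θ.naturality g')).hom
        (X'.map k ≫ r)) ≫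
      (X.map f ≫ X.map s ≫ θ.app y') ◁ (asIso X' g' k r).hom ≫
      (asIso X f s (θ.app y')).hom ▷ (X'.map (g' ≫ k) ≫ r) := by
  have hN := nat_compInv θ g' k
  have hP := map₂_paste X m n.hom k
  calc _ = 𝟙 _ ⊗≫ ((X.mapComp p (t ≫ k)).inv ≫ X.map₂ (paste m n.hom k) ≫
        (X.mapComp (f ≫ s) (g' ≫ k)).hom) ▷ (θ.app d ≫ r) ⊗≫
        X.map (f ≫ s) ◁ (θ.naturality (g' ≫ k)).hom ▷ r ⊗≫ 𝟙 _ := by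
        simp only [mc, paste, Iso.trans_hom, Iso.symm_hom, whiskerRightIso_hom]; bicategory
    _ = 𝟙 _ ⊗≫ X.map p ◁ (X.mapComp t k).hom ▷ (θ.app d ≫ r) ⊗≫
        (X.map₂ m ≫ (X.mapComp f g).hom) ▷ (X.map t ≫ X.map k ≫ θ.app d ≫ r) ⊗≫
        X.map f ◁ (mapSq X n).hom ▷ (X.map k ≫ θ.app d ≫ r) ⊗≫
        (X.map f ≫ X.map s) ◁ (X.mapComp g' k).inv ▷ (θ.app d ≫ r) ⊗≫
        ((X.mapComp f s).inv ▷ (X.map (g' ≫ k) ≫ θ.app d) ≫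
          X.map (f ≫ s) ◁ (θ.naturality (g' ≫ k)).hom) ▷ r ⊗≫ 𝟙 _ := by
        rw [hP, mapSq_hom]; bicategory
    _ = 𝟙 _ ⊗≫ X.map p ◁ (X.mapComp t k).hom ▷ (θ.app d ≫ r) ⊗≫
        (X.map₂ m ≫ (X.mapComp f g).hom) ▷ (X.map t ≫ X.map k ≫ θ.app d ≫ r) ⊗≫
        X.map f ◁ (mapSq X n).hom ▷ (X.map k ≫ θ.app d ≫ r) ⊗≫
        (X.map f ≫ X.map s) ◁ ((X.mapComp g' k).inv ▷ θ.app d ≫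
          (θ.naturality (g' ≫ k)).hom) ▷ r ⊗≫
        (X.mapComp f s).inv ▷ (θ.app y' ≫ X'.map (g' ≫ k) ≫ r) ⊗≫ 𝟙 _ := by
        rw [← whisker_exchange]; bicategory
    _ = 𝟙 _ ⊗≫ X.map p ◁ (X.mapComp t k).hom ▷ (θ.app d ≫ r) ⊗≫
        (X.map₂ m ≫ (X.mapComp f g).hom) ▷ (X.map t ≫ X.map k ≫ θ.app d ≫ r) ⊗≫
        X.map f ◁ ((mapSq X n).hom ▷ (X.map k ≫ θ.app d) ≫
          (X.map s ≫ X.map g') ◁ (θ.naturality k).hom) ▷ r ⊗≫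
        (X.map f ≫ X.map s) ◁ (θ.naturality g').hom ▷ (X'.map k ≫ r) ⊗≫
        (X.map f ≫ X.map s ≫ θ.app y') ◁ (X'.mapComp g' k).inv ▷ r ⊗≫
        (X.mapComp f s).inv ▷ (θ.app y' ≫ X'.map (g' ≫ k) ≫ r) ⊗≫ 𝟙 _ := by
        rw [hN]
        simp only [hcomp, Iso.trans_hom, Iso.symm_hom, whiskerLeftIso_hom, whiskerRightIso_hom]
        bicategory
    _ = 𝟙 _ ⊗≫ X.map p ◁ (X.mapComp t k).hom ▷ (θ.app d ≫ r) ⊗≫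
        ((X.map₂ m ≫ (X.mapComp f g).hom) ▷ (X.map t ≫ X.map k ≫ θ.app d) ≫
          (X.map f ≫ X.map g) ◁ X.map t ◁ (θ.naturality k).hom) ▷ r ⊗≫
        X.map f ◁ (mapSq X n).hom ▷ (θ.app z' ≫ X'.map k ≫ r) ⊗≫
        (X.map f ≫ X.map s) ◁ (θ.naturality g').hom ▷ (X'.map k ≫ r) ⊗≫
        (X.map f ≫ X.map s ≫ θ.app y') ◁ (X'.mapComp g' k).inv ▷ r ⊗≫
        (X.mapComp f s).inv ▷ (θ.app y' ≫ X'.map (g' ≫ k) ≫ r) ⊗≫ 𝟙 _ := by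
        rw [← whisker_exchange]; bicategory
    _ = _ := by
        rw [← whisker_exchange, ho]
        simp only [mc, paste, vcomp, Iso.trans_hom, Iso.symm_hom, whiskerLeftIso_hom,
          whiskerRightIso_hom, X.map₂_id, id_whiskerRight, Category.id_comp]
        bicategory

theorem lu_nat {f f' : x ⟶ y} (i : f ⟶ f') :
    (i ▷ 𝟙 y ≫ f' ◁ 𝟙 (𝟙 y)) ≫ (ρ_ f').hom = (ρ_ f).hom ≫ i := by
  simp

theorem ru_nat {f f' : X.obj x ⟶ y} (i : f ⟶ f') :
    (X.map₂ (𝟙 (𝟙 x)) ▷ f ≫ X.map (𝟙 x) ◁ i) ≫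
      (whiskerRightIso (X.mapId x) f' ≪≫ λ_ _).hom =
    (whiskerRightIso (X.mapId x) f ≪≫ λ_ _).hom ≫ i := by
  simp [whisker_exchange_assoc]

theorem lu_unit : (ρ_ (𝟙 x)).hom ≫ 𝟙 (𝟙 x) = 𝟙 (𝟙 x) ▷ 𝟙 x ≫ (ρ_ (𝟙 x)).hom := by
  simp

theorem ru_unit :
    (whiskerRightIso (X.mapId x) (𝟙 _) ≪≫ λ_ _).hom ≫ 𝟙 (𝟙 (X.obj x)) =
      (X.mapId x).hom ▷ 𝟙 _ ≫ (ρ_ _).hom := by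
  simp [unitors_equal]

theorem lu_comp (f : x ⟶ y) (g : y ⟶ z) :
    (ρ_ (f ≫ g)).hom ≫ 𝟙 (f ≫ g) =
      (((𝟙 (f ≫ g)) ▷ 𝟙 z ≫ (f ≫ g) ◁ (ρ_ (𝟙 z)).inv) ≫
        paste (𝟙 (f ≫ g)) (idV g).hom (𝟙 z)) ≫
          (f ≫ 𝟙 y) ◁ (ρ_ g).hom ≫ (ρ_ f).hom ▷ g := by
  simp only [paste, idV, Iso.trans_hom, Iso.symm_hom]
  bicategory

theorem ru_comp {X X' : B ⥤ᵖ B} (θ : X ⟶ X') (k : X'.obj x ⟶ y) :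
    (whiskerRightIso (X.mapId x) (θ.app x ≫ k) ≪≫ λ_ _).hom ≫ 𝟙 (θ.app x ≫ k) =
      ((X.map₂ (λ_ (𝟙 x)).inv ▷ (θ.app x ≫ k) ≫ X.map (𝟙 x ≫ 𝟙 x) ◁ 𝟙 (θ.app x ≫ k)) ≫
        mc θ (𝟙 x) (𝟙 x) k) ≫ (X.map (𝟙 x) ≫ θ.app x) ◁ (whiskerRightIso (X'.mapId x) k ≪≫ λ_ _).hom ≫
          (whiskerRightIso (X.mapId x) (θ.app x) ≪≫ λ_ _).hom ▷ k := by
  have h := θ.naturality_id x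
  calc _ = 𝟙 _ ⊗≫ 𝟙 _ ◁ (X.mapId x).hom ▷ (θ.app x ≫ k) ⊗≫ ((X.mapId x).inv ≫
        (X.mapId x).hom) ▷ (θ.app x ≫ k) ⊗≫ 𝟙 _ := by
        rw [Iso.inv_hom_id]
        simp only [Iso.trans_hom, whiskerRightIso_hom]
        bicategory
    _ = 𝟙 _ ⊗≫ (𝟙 _ ◁ (X.mapId x).hom ≫ (X.mapId x).inv ▷ 𝟙 _) ▷ (θ.app x ≫ k) ⊗≫
        (X.mapId x).hom ▷ (θ.app x ≫ k) ⊗≫ 𝟙 _ := by bicategory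
    _ = 𝟙 _ ⊗≫ (X.mapId x).inv ▷ X.map (𝟙 x) ▷ (θ.app x ≫ k) ⊗≫
        X.map (𝟙 x) ◁ ((X.mapId x).hom ▷ θ.app x ≫ (λ_ _).hom ≫ (ρ_ _).inv) ▷ k ⊗≫
        (X.mapId x).hom ▷ (θ.app x ≫ k) ⊗≫ 𝟙 _ := by
        rw [whisker_exchange]; bicategory
    _ = 𝟙 _ ⊗≫ ((λ_ _).inv ≫ (X.mapId x).inv ▷ X.map (𝟙 x) ≫ (X.mapComp (𝟙 x) (𝟙 x)).inv ≫
          (X.mapComp (𝟙 x) (𝟙 x)).hom) ▷ (θ.app x ≫ k) ⊗≫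
        X.map (𝟙 x) ◁ ((θ.naturality (𝟙 x)).hom ≫ θ.app x ◁ (X'.mapId x).hom) ▷ k ⊗≫
        (X.mapId x).hom ▷ (θ.app x ≫ k) ⊗≫ 𝟙 _ := by
        rw [h, Iso.inv_hom_id]; bicategory
    _ = _ := by
        rw [map₂_leftUnitor_inv]
        simp only [mc, paste, Iso.trans_hom, whiskerRightIso_hom]
        bicategory

end Components

end MonBicat

namespace MonBicat

universe w₁ v₁ u₁ w₂ v₂ u₂ w₃ v₃ u₃ w₄ v₄ u₄ u v

section Composition

variable {B : Type u₁} [Bicategory.{w₁, v₁} B] {C : Type u₂} [Bicategory.{w₂, v₂} C]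

theorem reassoc_mapId (W : (B × (B × B)) ⥤ᵖ C) (x : (B × B) × B) :
    (((reassoc B B B).comp W).mapId x).hom = (W.mapId ((reassoc B B B).obj x)).hom :=
  (congrArg (fun k => k ≫ (W.mapId ((reassoc B B B).obj x)).hom) (W.map₂_id _)).trans
    (Category.id_comp _)

theorem reassoc_mapComp (W : (B × (B × B)) ⥤ᵖ C) {x y z : (B × B) × B} (f : x ⟶ y) (g : y ⟶ z) :
    (((reassoc B B B).comp W).mapComp f g).hom =
      (W.mapComp ((reassoc B B B).map f) ((reassoc B B B).map g)).hom :=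
  (congrArg (fun k => k ≫ (W.mapComp ((reassoc B B B).map f) ((reassoc B B B).map g)).hom)
    (W.map₂_id _)).trans (Category.id_comp _)

theorem tensorL_mapId (T : (B × B) ⥤ᵖ B) (x y : B) :
    ((tensorL T x).mapId y).hom = (T.mapId (x, y)).hom :=
  (congrArg (fun k => k ≫ (T.mapId (x, y)).hom) (T.map₂_id _)).trans (Category.id_comp _)

theorem tensorR_mapId (T : (B × B) ⥤ᵖ B) (x y : B) :
    ((tensorR T x).mapId y).hom = (T.mapId (y, x)).hom :=
  (congrArg (fun k => k ≫ (T.mapId (y, x)).hom) (T.map₂_id _)).trans (Category.id_comp _)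

/-- Associativity of the composition of weak 2-functors. -/
def godAs : (prodMap godT (Pseudofunctor.id (B ⥤ᵖ B))).comp godT ⟶
    (reassoc (B ⥤ᵖ B) (B ⥤ᵖ B) (B ⥤ᵖ B)).comp
      ((prodMap (Pseudofunctor.id (B ⥤ᵖ B)) godT).comp godT) where
  app X := asT X.1.1 X.1.2 X.2
  naturality θ := asN θ.1.1 θ.1.2 θ.2
  naturality_naturality Γ := by
    ext a
    exact isoV_nat (as_nat _ _ _ _)
  naturality_id X := by
    rw [reassoc_mapId]
    ext a
    exact isoV_unit (as_unit X.1.1 (X.1.2.mapId (X.2.obj a)).hom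
      (X.1.2.map₂_id _))
  naturality_comp {x y z} θ κ := by
    rw [reassoc_mapComp]
    ext a
    exact isoV_comp (as_comp x.1.1 θ.1.1 (x.1.2.mapComp (θ.2.app a) (κ.2.app a)).hom
      (θ.1.2.naturality (κ.2.app a)) (κ.1.2.app (z.2.obj a)) (κ.1.1.app (z.1.2.obj (z.2.obj a)))
      (x.1.2.map₂_id _))

/-- Left unitality of the composition of weak 2-functors. -/
def godLu : tensorL godT (Pseudofunctor.id B) ⟶ Pseudofunctor.id (B ⥤ᵖ B) where
  app X := luT X
  naturality θ := luN θ
  naturality_naturality Γ := by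
    ext a
    exact isoV_nat (lu_nat _)
  naturality_id X := by
    rw [tensorL_mapId]
    ext a
    exact isoV_unit lu_unit
  naturality_comp θ κ := by
    ext a
    exact isoV_comp (lu_comp (θ.app a) (κ.app a))

/-- Right unitality of the composition of weak 2-functors. -/
def godRu : tensorR godT (Pseudofunctor.id B) ⟶ Pseudofunctor.id (B ⥤ᵖ B) where
  app X := ruT X
  naturality θ := ruN θ
  naturality_naturality Γ := by
    ext a
    exact isoV_nat (ru_nat _ _)
  naturality_id X := by
    rw [tensorR_mapId]
    ext a
    exact isoV_unit (ru_unit X)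
  naturality_comp θ κ := by
    ext a
    exact isoV_comp (ru_comp θ (κ.app a))

end Composition

end MonBicat

namespace MonBicat

universe w₁ v₁ u₁ w₂ v₂ u₂ w₃ v₃ u₃ w₄ v₄ u₄ u v

section Coherence

variable {B : Type u₁} [Bicategory.{w₁, v₁} B]

/-- The pentagonator of the composition of weak 2-functors. -/
def pentG (X Y Z W : B ⥤ᵖ B) :
    god (asT X Y Z) (𝟙 W) ≫ asT X (Z.comp Y) W ≫ god (𝟙 X) (asT Y Z W) ≅
      asT (Y.comp X) Z W ≫ asT X Y (W.comp Z) :=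
  Pseudofunctor.StrongTrans.isoMk
    (fun a => triv (triv (trivMap (Z.comp (Y.comp X)) (Iso.refl (𝟙 (W.obj a)))) (Iso.refl _))
      (triv (Iso.refl _) (triv (trivMap X (Iso.refl (𝟙 (Y.obj (Z.obj (W.obj a)))))) (Iso.refl _))) ≪≫
      (triv (Iso.refl _) (Iso.refl (𝟙 (X.obj (Y.obj (Z.obj (W.obj a))))))).symm)
    fun _ => IsIdSq.iso
      (((isIdSq_idV.map (Z.comp (Y.comp X))).vcomp isIdSq_idV).vcomp
        (isIdSq_idV.vcomp ((isIdSq_idV.map X).vcomp isIdSq_idV)))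
      (isIdSq_idV.vcomp isIdSq_idV)

/-- The middle 2-unitor of the composition of weak 2-functors. -/
def midG (X Y : B ⥤ᵖ B) :
    asT X (Pseudofunctor.id B) Y ≫ god (𝟙 X) (luT Y) ≅ god (ruT X) (𝟙 Y) :=
  Pseudofunctor.StrongTrans.isoMk
    (fun a => triv (Iso.refl _) (triv (trivMap X (Iso.refl (𝟙 (Y.obj a)))) (Iso.refl _)) ≪≫
      (triv (trivMap ((Pseudofunctor.id B).comp X) (Iso.refl (𝟙 (Y.obj a)))) (Iso.refl _)).symm)
    fun _ => IsIdSq.iso (isIdSq_idV.vcomp ((isIdSq_idV.map X).vcomp isIdSq_idV))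
      ((isIdSq_idV.map ((Pseudofunctor.id B).comp X)).vcomp isIdSq_idV)

/-- The left 2-unitor of the composition of weak 2-functors. -/
def leftG (X Y : B ⥤ᵖ B) :
    asT (Pseudofunctor.id B) X Y ≫ luT (Y.comp X) ≅ god (luT X) (𝟙 Y) :=
  Pseudofunctor.StrongTrans.isoMk
    (fun a => triv (Iso.refl _) (Iso.refl (𝟙 (X.obj (Y.obj a)))) ≪≫
      (triv (trivMap (X.comp (Pseudofunctor.id B)) (Iso.refl (𝟙 (Y.obj a)))) (Iso.refl _)).symm)
    fun _ => IsIdSq.iso (isIdSq_idV.vcomp isIdSq_idV)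
      ((isIdSq_idV.map (X.comp (Pseudofunctor.id B))).vcomp isIdSq_idV)

/-- The right 2-unitor of the composition of weak 2-functors. -/
def rightG (X Y : B ⥤ᵖ B) :
    asT X Y (Pseudofunctor.id B) ≫ god (𝟙 X) (ruT Y) ≅ ruT (Y.comp X) :=
  Pseudofunctor.StrongTrans.isoMk
    (fun a => triv (Iso.refl _) (triv (trivMap X (Iso.refl (𝟙 (Y.obj a)))) (Iso.refl _)) ≪≫
      (Iso.refl (𝟙 (X.obj (Y.obj a)))).symm)
    fun _ => IsIdSq.iso (isIdSq_idV.vcomp ((isIdSq_idV.map X).vcomp isIdSq_idV)) isIdSq_idV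

end Coherence

variable {B : Type u₁} [Bicategory.{w₁, v₁} B] {M : MonData B}

namespace MonFunData

/-- The associator of the composition of weak monoidal 2-functors. -/
def asc (X Y Z : MonFunData M M) : (X.comp Y).comp Z ⟶ X.comp (Y.comp Z) where
  t := asT X.F Y.F Z.F
  P a b := adj (tid M.T _ _) (isoV (α_ (X.χ (Y.o (Z.o a)) (Y.o (Z.o b))) _ _ ≪≫
    whiskerLeftIso _ (X.F.mapComp (Y.χ (Z.o a) (Z.o b)) (Y.F.map (Z.χ a b))).symm)) (Iso.refl _)
  U := isoV (α_ X.ι _ _ ≪≫ whiskerLeftIso _ (X.F.mapComp Y.ι (Y.F.map Z.ι)).symm)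

/-- The left unitor of the composition of weak monoidal 2-functors. -/
def luc (X : MonFunData M M) : (id M).comp X ⟶ X where
  t := luT X.F
  P a b := adj (tid M.T _ _) (isoV (λ_ (X.χ a b))) (Iso.refl _)
  U := isoV (λ_ X.ι)

/-- The right unitor of the composition of weak monoidal 2-functors. -/
def ruc (X : MonFunData M M) : X.comp (id M) ⟶ X where
  t := ruT X.F
  P a b := adj (tid M.T _ _) (isoV (whiskerLeftIso (X.χ a b) (X.F.mapId _) ≪≫ ρ_ _)) (Iso.refl _)
  U := isoV (whiskerLeftIso X.ι (X.F.mapId _) ≪≫ ρ_ _)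

/-- The underlying weak 2-functors of a triple. -/
abbrev under3 (X : (MonFunData M M × MonFunData M M) × MonFunData M M) :
    ((B ⥤ᵖ B) × (B ⥤ᵖ B)) × (B ⥤ᵖ B) := (under X.1, X.2.F)

/-- The underlying pseudo-natural transformations of a triple. -/
abbrev under3₁ {X Y : (MonFunData M M × MonFunData M M) × MonFunData M M} (θ : X ⟶ Y) :
    under3 X ⟶ under3 Y := (under₁ θ.1, MonTransData.t θ.2)

/-- The underlying modifications of a triple. -/
abbrev under3₂ {X Y : (MonFunData M M × MonFunData M M) × MonFunData M M} {θ κ : X ⟶ Y}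
    (Γ : θ ⟶ κ) : under3₁ θ ⟶ under3₁ κ := Γ

end MonFunData

open MonFunData

set_option maxHeartbeats 1000000 in
/-- The monoidal structure on the bicategory of weak monoidal 2-functors from a monoidal bicategory
to itself, with the composition as tensor product. -/
def endo (M : MonData B) : MonData (MonFunData M M) where
  T := MonFunData.tensor M
  I := MonFunData.id M
  as :=
    { app := fun X => asc X.1.1 X.1.2 X.2
      naturality := fun θ => ofIso (asN (MonTransData.t θ.1.1) (MonTransData.t θ.1.2) (MonTransData.t θ.2))
      naturality_naturality := fun Γ => godAs.naturality_naturality (under3₂ Γ)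
      naturality_id := fun X => godAs.naturality_id (under3 X)
      naturality_comp := fun θ κ => godAs.naturality_comp (under3₁ θ) (under3₁ κ) }
  lu :=
    { app := fun X => luc X
      naturality := fun θ => ofIso (luN (MonTransData.t θ))
      naturality_naturality := fun {_ _ θ κ} Γ =>
        godLu.naturality_naturality (f := MonTransData.t θ) (g := MonTransData.t κ) Γ
      naturality_id := fun X => godLu.naturality_id X.F
      naturality_comp := fun θ κ =>
        godLu.naturality_comp (MonTransData.t θ) (MonTransData.t κ) }
  ru :=
    { app := fun X => ruc X
      naturality := fun θ => ofIso (ruN (MonTransData.t θ))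
      naturality_naturality := fun {_ _ θ κ} Γ =>
        godRu.naturality_naturality (f := MonTransData.t θ) (g := MonTransData.t κ) Γ
      naturality_id := fun X => godRu.naturality_id X.F
      naturality_comp := fun θ κ =>
        godRu.naturality_comp (MonTransData.t θ) (MonTransData.t κ) }
  pent X Y Z W := ofIso (pentG X.F Y.F Z.F W.F)
  mid X Y := ofIso (midG X.F Y.F)
  left X Y := ofIso (leftG X.F Y.F)
  right X Y := ofIso (rightG X.F Y.F)

end MonBicat

namespace MonBicat

universe w₁ v₁ u₁ w₂ v₂ u₂ w₃ v₃ u₃ w₄ v₄ u₄ u v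

namespace MonData

variable {B : Type u₁} [Bicategory.{w₁, v₁} B]

/-- A class of objects, of 1-cells and of 2-cells of a bicategory. -/
structure Cells (B : Type u₁) [Bicategory.{w₁, v₁} B] where
  /-- the objects -/
  P₀ : B → Prop
  /-- the 1-cells -/
  P₁ {X Y : B} : (X ⟶ Y) → Prop
  /-- the 2-cells -/
  P₂ {X Y : B} {f g : X ⟶ Y} : (f ⟶ g) → Prop

variable (D : MonData B) (S : Cells B)

/-- The objects generated by a class of objects under tensor products. -/
inductive Gen₀ : B → Prop
  | base {X : B} : S.P₀ X → Gen₀ X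
  | unit : Gen₀ D.I
  | tensor {X Y : B} : Gen₀ X → Gen₀ Y → Gen₀ (D.T.obj (X, Y))

/-- The 1-cells generated by a class of 1-cells under the operations of a monoidal bicategory. -/
inductive Gen₁ : ∀ {X Y : B}, (X ⟶ Y) → Prop
  | base {X Y : B} {f : X ⟶ Y} : Gen₀ D S X → Gen₀ D S Y → S.P₁ f → Gen₁ f
  | id {X : B} : Gen₀ D S X → Gen₁ (𝟙 X)
  | comp {X Y Z : B} {f : X ⟶ Y} {g : Y ⟶ Z} : Gen₁ f → Gen₁ g → Gen₁ (f ≫ g)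
  | tensor {X Y X' Y' : B} {f : X ⟶ Y} {g : X' ⟶ Y'} : Gen₁ f → Gen₁ g →
      Gen₁ (tmap D.T f g)
  | as {X Y Z : B} : Gen₀ D S X → Gen₀ D S Y → Gen₀ D S Z → Gen₁ (D.α X Y Z)
  | lu {X : B} : Gen₀ D S X → Gen₁ (D.l X)
  | ru {X : B} : Gen₀ D S X → Gen₁ (D.r X)

/-- The 2-cells generated by a class of 2-cells under the operations of a monoidal bicategory and
under inverses. -/
inductive Gen₂ : ∀ {X Y : B} {f g : X ⟶ Y}, (f ⟶ g) → Prop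
  | base {X Y : B} {f g : X ⟶ Y} {η : f ⟶ g} : Gen₁ D S f → Gen₁ D S g → S.P₂ η →
      Gen₂ η
  | id {X Y : B} {f : X ⟶ Y} : Gen₁ D S f → Gen₂ (𝟙 f)
  | comp {X Y : B} {f g h : X ⟶ Y} {η : f ⟶ g} {θ : g ⟶ h} : Gen₂ η → Gen₂ θ → Gen₂ (η ≫ θ)
  | inv {X Y : B} {f g : X ⟶ Y} {i : f ≅ g} : Gen₂ i.hom → Gen₂ i.inv
  | whiskerLeft {X Y Z : B} {f : X ⟶ Y} {g h : Y ⟶ Z} {η : g ⟶ h} : Gen₁ D S f → Gen₂ η →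
      Gen₂ (f ◁ η)
  | whiskerRight {X Y Z : B} {f g : X ⟶ Y} {h : Y ⟶ Z} {η : f ⟶ g} : Gen₂ η → Gen₁ D S h →
      Gen₂ (η ▷ h)
  | associator {X Y Z W : B} {f : X ⟶ Y} {g : Y ⟶ Z} {h : Z ⟶ W} : Gen₁ D S f → Gen₁ D S g →
      Gen₁ D S h → Gen₂ (α_ f g h).hom
  | leftUnitor {X Y : B} {f : X ⟶ Y} : Gen₁ D S f → Gen₂ (λ_ f).hom
  | rightUnitor {X Y : B} {f : X ⟶ Y} : Gen₁ D S f → Gen₂ (ρ_ f).hom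
  | tensor {X Y X' Y' : B} {f f' : X ⟶ X'} {g g' : Y ⟶ Y'} {η : f ⟶ f'} {θ : g ⟶ g'} : Gen₂ η →
      Gen₂ θ → Gen₂ (D.T.map₂ (a := (X, Y)) (b := (X', Y')) (f := (f, g)) (g := (f', g')) (η, θ))
  | tid {X Y : B} : Gen₀ D S X → Gen₀ D S Y → Gen₂ (tid D.T X Y).hom
  | tcomp {X Y Z X' Y' Z' : B} {f : X ⟶ Y} {g : Y ⟶ Z} {f' : X' ⟶ Y'} {g' : Y' ⟶ Z'} :
      Gen₁ D S f → Gen₁ D S g → Gen₁ D S f' → Gen₁ D S g' →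
      Gen₂ (tcomp D.T (f := f) (f' := g) (g := f') (g' := g')).hom
  | αnat {X Y Z X' Y' Z' : B} {f : X ⟶ X'} {g : Y ⟶ Y'} {h : Z ⟶ Z'} : Gen₁ D S f → Gen₁ D S g →
      Gen₁ D S h → Gen₂ (D.αnat f g h).hom
  | lnat {X Y : B} {f : X ⟶ Y} : Gen₁ D S f → Gen₂ (D.lnat f).hom
  | rnat {X Y : B} {f : X ⟶ Y} : Gen₁ D S f → Gen₂ (D.rnat f).hom
  | pent {X Y Z W : B} : Gen₀ D S X → Gen₀ D S Y → Gen₀ D S Z → Gen₀ D S W →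
      Gen₂ (D.π X Y Z W).hom
  | mid {X Y : B} : Gen₀ D S X → Gen₀ D S Y → Gen₂ (D.μ X Y).hom
  | left {X Y : B} : Gen₀ D S X → Gen₀ D S Y → Gen₂ (D.lam X Y).hom
  | right {X Y : B} : Gen₀ D S X → Gen₀ D S Y → Gen₂ (D.rho X Y).hom

/-- The sub-bicategory generated by a class of cells of a monoidal bicategory. -/
structure Sub where
  /-- the underlying object -/
  val : B
  prop : Gen₀ D S val

namespace Sub

variable {D S}

instance : CategoryStruct (Sub D S) where
  Hom X Y := { f : X.val ⟶ Y.val // Gen₁ D S f }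
  id X := ⟨𝟙 X.val, .id X.prop⟩
  comp f g := ⟨f.1 ≫ g.1, .comp f.2 g.2⟩

instance (X Y : Sub D S) : Category (X ⟶ Y) where
  Hom f g := { η : f.1 ⟶ g.1 // Gen₂ D S η }
  id f := ⟨𝟙 f.1, .id f.2⟩
  comp η θ := ⟨η.1 ≫ θ.1, .comp η.2 θ.2⟩
  id_comp η := Subtype.ext (Category.id_comp η.1)
  comp_id η := Subtype.ext (Category.comp_id η.1)
  assoc η θ κ := Subtype.ext (Category.assoc η.1 θ.1 κ.1)

/-- An isomorphism in the sub-bicategory. -/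
def mkIso {X Y : Sub D S} {f g : X ⟶ Y} (i : f.1 ≅ g.1) (h : Gen₂ D S i.hom) : f ≅ g :=
  ⟨⟨i.hom, h⟩, ⟨i.inv, .inv h⟩, Subtype.ext i.hom_inv_id, Subtype.ext i.inv_hom_id⟩

instance : Bicategory (Sub D S) where
  homCategory X Y := inferInstance
  whiskerLeft f _ _ η := ⟨f.1 ◁ η.1, .whiskerLeft f.2 η.2⟩
  whiskerRight η h := ⟨η.1 ▷ h.1, .whiskerRight η.2 h.2⟩
  associator f g h := mkIso (α_ f.1 g.1 h.1) (.associator f.2 g.2 h.2)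
  leftUnitor f := mkIso (λ_ f.1) (.leftUnitor f.2)
  rightUnitor f := mkIso (ρ_ f.1) (.rightUnitor f.2)
  whiskerLeft_id f g := Subtype.ext (Bicategory.whiskerLeft_id f.1 g.1)
  whiskerLeft_comp f _ _ _ η θ := Subtype.ext (Bicategory.whiskerLeft_comp f.1 η.1 θ.1)
  id_whiskerLeft η := Subtype.ext (Bicategory.id_whiskerLeft η.1)
  comp_whiskerLeft f g _ _ η := Subtype.ext (Bicategory.comp_whiskerLeft f.1 g.1 η.1)
  id_whiskerRight f g := Subtype.ext (Bicategory.id_whiskerRight f.1 g.1)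
  comp_whiskerRight η θ i := Subtype.ext (Bicategory.comp_whiskerRight η.1 θ.1 i.1)
  whiskerRight_id η := Subtype.ext (Bicategory.whiskerRight_id η.1)
  whiskerRight_comp η g h := Subtype.ext (Bicategory.whiskerRight_comp η.1 g.1 h.1)
  whisker_assoc f _ _ η h := Subtype.ext (Bicategory.whisker_assoc f.1 η.1 h.1)
  whisker_exchange η θ := Subtype.ext (Bicategory.whisker_exchange η.1 θ.1)
  pentagon f g h i := Subtype.ext (Bicategory.pentagon f.1 g.1 h.1 i.1)
  triangle f g := Subtype.ext (Bicategory.triangle f.1 g.1)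

/-- The 1-cell of the ambient product that underlies a pair of 1-cells. -/
abbrev p₁ {X Y : Sub D S × Sub D S} (f : X ⟶ Y) : (X.1.val, X.2.val) ⟶ (Y.1.val, Y.2.val) :=
  (f.1.1, f.2.1)

/-- The 2-cell of the ambient product that underlies a pair of 2-cells. -/
abbrev p₂ {X Y : Sub D S × Sub D S} {f g : X ⟶ Y} (η : f ⟶ g) : p₁ f ⟶ p₁ g := (η.1.1, η.2.1)

variable (D S)

/-- The tensor product of the generated sub-bicategory. -/
def tensor : (Sub D S × Sub D S) ⥤ᵖ Sub D S where
  obj X := ⟨D.T.obj (X.1.val, X.2.val), .tensor X.1.prop X.2.prop⟩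
  map f := ⟨D.T.map (p₁ f), .tensor f.1.2 f.2.2⟩
  map₂ η := ⟨D.T.map₂ (p₂ η), .tensor η.1.2 η.2.2⟩
  mapId X := mkIso (D.T.mapId (X.1.val, X.2.val)) (.tid X.1.prop X.2.prop)
  mapComp f g := mkIso (D.T.mapComp (p₁ f) (p₁ g)) (.tcomp f.1.2 g.1.2 f.2.2 g.2.2)
  map₂_id f := Subtype.ext (D.T.map₂_id (p₁ f))
  map₂_comp η θ := Subtype.ext (D.T.map₂_comp (p₂ η) (p₂ θ))
  map₂_whisker_left f _ _ η := Subtype.ext (D.T.map₂_whisker_left (p₁ f) (p₂ η))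
  map₂_whisker_right η h := Subtype.ext (D.T.map₂_whisker_right (p₂ η) (p₁ h))
  map₂_associator f g h := Subtype.ext (D.T.map₂_associator (p₁ f) (p₁ g) (p₁ h))
  map₂_left_unitor f := Subtype.ext (D.T.map₂_left_unitor (p₁ f))
  map₂_right_unitor f := Subtype.ext (D.T.map₂_right_unitor (p₁ f))

/-- The 1-cell of the ambient product that underlies a triple of 1-cells. -/
abbrev t₁ {X Y : (Sub D S × Sub D S) × Sub D S} (f : X ⟶ Y) :
    ((X.1.1.val, X.1.2.val), X.2.val) ⟶ ((Y.1.1.val, Y.1.2.val), Y.2.val) :=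
  (p₁ f.1, f.2.1)

/-- The 2-cell of the ambient product that underlies a triple of 2-cells. -/
abbrev t₂ {X Y : (Sub D S × Sub D S) × Sub D S} {f g : X ⟶ Y} (η : f ⟶ g) :
    t₁ D S f ⟶ t₁ D S g := (p₂ η.1, η.2.1)

/-- The monoidal structure of the generated sub-bicategory. -/
def mon : MonData (Sub D S) where
  T := tensor D S
  I := ⟨D.I, .unit⟩
  as :=
    { app := fun X => ⟨D.α X.1.1.val X.1.2.val X.2.val, .as X.1.1.prop X.1.2.prop X.2.prop⟩
      naturality := fun f => mkIso (D.αnat f.1.1.1 f.1.2.1 f.2.1) (.αnat f.1.1.2 f.1.2.2 f.2.2)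
      naturality_naturality := fun η => Subtype.ext (D.as.naturality_naturality (t₂ D S η))
      naturality_id := fun X =>
        Subtype.ext (D.as.naturality_id ((X.1.1.val, X.1.2.val), X.2.val))
      naturality_comp := fun f g => Subtype.ext (D.as.naturality_comp (t₁ D S f) (t₁ D S g)) }
  lu :=
    { app := fun X => ⟨D.l X.val, .lu X.prop⟩
      naturality := fun f => mkIso (D.lnat f.1) (.lnat f.2)
      naturality_naturality := fun η => Subtype.ext (D.lu.naturality_naturality η.1)
      naturality_id := fun X => Subtype.ext (D.lu.naturality_id X.val)
      naturality_comp := fun f g => Subtype.ext (D.lu.naturality_comp f.1 g.1) }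
  ru :=
    { app := fun X => ⟨D.r X.val, .ru X.prop⟩
      naturality := fun f => mkIso (D.rnat f.1) (.rnat f.2)
      naturality_naturality := fun η => Subtype.ext (D.ru.naturality_naturality η.1)
      naturality_id := fun X => Subtype.ext (D.ru.naturality_id X.val)
      naturality_comp := fun f g => Subtype.ext (D.ru.naturality_comp f.1 g.1) }
  pent X Y Z W := mkIso (D.π X.val Y.val Z.val W.val) (.pent X.prop Y.prop Z.prop W.prop)
  mid X Y := mkIso (D.μ X.val Y.val) (.mid X.prop Y.prop)
  left X Y := mkIso (D.lam X.val Y.val) (.left X.prop Y.prop)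
  right X Y := mkIso (D.rho X.val Y.val) (.right X.prop Y.prop)

end Sub
end MonData

end MonBicat

namespace MonBicat

universe w₁ v₁ u₁ w₂ v₂ u₂ w₃ v₃ u₃ w₄ v₄ u₄ u v

section Trivial

variable {B : Type u₁} [Bicategory.{w₁, v₁} B] {C : Type u₂} [Bicategory.{w₂, v₂} C]

/-- The constant weak 2-functor. -/
def const (B : Type u₁) [Bicategory.{w₁, v₁} B] (c : C) : B ⥤ᵖ C where
  obj _ := c
  map _ := 𝟙 c
  map₂ _ := 𝟙 (𝟙 c)
  mapId _ := Iso.refl _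
  mapComp _ _ := (λ_ (𝟙 c)).symm
  map₂_whisker_left _ _ _ _ := by simp
  map₂_whisker_right _ _ := by simp
  map₂_associator _ _ _ := by simp
  map₂_left_unitor _ := by simp
  map₂_right_unitor _ := by simp

theorem tensorL_one (T : (C × C) ⥤ᵖ C) (x y : C) :
      T.map₂ (a := (x, y)) (b := (x, y)) (f := (𝟙 x, 𝟙 y)) (g := (𝟙 x ≫ 𝟙 x, 𝟙 y ≫ 𝟙 y))
        ((λ_ (𝟙 x)).inv, (λ_ (𝟙 y)).inv) ≫
      (T.mapComp (a := (x, y)) (b := (x, y)) (c := (x, y)) (𝟙 x, 𝟙 y) (𝟙 x, 𝟙 y)).hom =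
    (tensorL T x).map₂ (λ_ (𝟙 y)).inv ≫ ((tensorL T x).mapComp (𝟙 y) (𝟙 y)).hom := by
  refine Eq.trans (congrArg (fun k => k ≫ (T.mapComp (a := (x, y)) (b := (x, y)) (c := (x, y))
    (𝟙 x, 𝟙 y) (𝟙 x, 𝟙 y)).hom) (congrArg (T.map₂ (a := (x, y)) (b := (x, y)) (f := (𝟙 x, 𝟙 y))
      (g := (𝟙 x ≫ 𝟙 x, 𝟙 y ≫ 𝟙 y))) ?_)) (map₂_assoc T (a := (x, y)) (b := (x, y)) (f := (𝟙 x, 𝟙 y)) (g := (𝟙 x, 𝟙 y ≫ 𝟙 y)) (h := (𝟙 x ≫ 𝟙 x, 𝟙 y ≫ 𝟙 y)) (𝟙 _, (λ_ (𝟙 y)).inv) ((ρ_ (𝟙 x)).inv, 𝟙 _) (T.mapComp (a := (x, y)) (b := (x, y)) (c := (x, y))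
    (𝟙 x, 𝟙 y) (𝟙 x, 𝟙 y)).hom).symm
  exact Prod.ext (by simp [unitors_inv_equal]) (by simp)

namespace MonFunData

/-- The trivial weak monoidal 2-functor: it is constant at the unit object, and its structure cells
are built from the unitors. The argument `i` is the identification of the two unitors of the unit
object. -/
def trivial (M : MonData B) (N : MonData C) (i : N.r N.I ≅ N.l N.I) : MonFunData M N where
  F := const B N.I
  χt :=
    { app := fun _ => N.l N.I
      naturality := fun _ => N.lnat (𝟙 N.I)
      naturality_naturality := fun _ => N.lu.naturality_naturality (𝟙 (𝟙 N.I))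
      naturality_id := fun _ => replace (N.lu.naturality_id N.I) (Category.comp_id _)
        (((congrArg (fun k => k ≫ (N.T.mapId (N.I, N.I)).hom)
          (N.T.map₂_id (a := (N.I, N.I)) (b := (N.I, N.I)) (𝟙 N.I, 𝟙 N.I))).trans
            (Category.id_comp _)).trans (tensorL_mapId N.T N.I N.I).symm)
      naturality_comp := fun _ _ => replace
        (nat_comp N.lu (f := 𝟙 N.I) (g := 𝟙 N.I) (λ_ (𝟙 N.I)).inv)
        ((Category.id_comp _).trans (Category.comp_id _).symm) (tensorL_one N.T N.I N.I) }
  ι := 𝟙 N.I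
  ω _ _ _ := whiskerLeftIso _ (N.lnat (N.l N.I)) ≪≫ (α_ _ _ _).symm ≪≫
    whiskerRightIso (N.lam N.I N.I) _ ≪≫ (ρ_ _).symm
  γ _ := whiskerRightIso ((λ_ _).symm ≪≫ whiskerRightIso (tid N.T _ _).symm _) _
  δ _ := whiskerRightIso (i ≪≫ (λ_ _).symm ≪≫ whiskerRightIso (tid N.T _ _).symm _) _

end MonFunData
end Trivial

end MonBicat

namespace MonBicat

universe w₁ v₁ u₁ w₂ v₂ u₂ w₃ v₃ u₃ w₄ v₄ u₄ u v

variable {B : Type u₁} [Bicategory.{w₁, v₁} B] (M : MonData B)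

theorem ruc_id : MonFunData.ruc (MonFunData.id M) = MonFunData.luc (MonFunData.id M) := by
  unfold MonFunData.ruc MonFunData.luc
  congr 1
  · funext a b
    congr 2
    ext
    have h := unitors_equal (a := M.T.obj (a, b))
    change 𝟙 (M.T.obj (a, b)) ◁ 𝟙 (𝟙 (M.T.obj (a, b))) ≫ (ρ_ (𝟙 (M.T.obj (a, b)))).hom =
      (λ_ (𝟙 (M.T.obj (a, b)))).hom
    rw [h]; simp
  · congr 1
    ext
    have h := unitors_equal (a := M.I)
    change 𝟙 M.I ◁ 𝟙 (𝟙 M.I) ≫ (ρ_ (𝟙 M.I)).hom = (λ_ (𝟙 M.I)).hom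
    rw [h]; simp

/-- The cells of the monoidal bicategory of monoidal automorphisms among all cells of the
bicategory of endomorphisms: invertible weak monoidal 2-functors, invertible monoidal
pseudo-natural transformations and invertible monoidal modifications. -/
def autCells : MonData.Cells (MonFunData M M) where
  P₀ X := X.IsMonoidal ∧ IsBiequivalence X.F
  P₁ θ := MonTransData.IsMonoidal θ ∧ MonTransData.IsInvertible θ
  P₂ {_ _ θ κ} Γ := IsIso Γ ∧ MonTransData.IsMonMod (θ := θ) (θ' := κ) Γ

/-- The bicategory of monoidal automorphisms of a monoidal bicategory. The cells in `autCells` are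
closed under all operations of a monoidal bicategory, so the generated sub-bicategory consists of
exactly these cells. -/
abbrev Aut : Type _ := MonData.Sub (endo M) (autCells M)

/-- The monoidal structure on the bicategory of monoidal automorphisms; the tensor product is the
composition. -/
abbrev Aut.mon : MonData (Aut M) := MonData.Sub.mon (endo M) (autCells M)

theorem Aut.unitors : (Aut.mon M).r (Aut.mon M).I = (Aut.mon M).l (Aut.mon M).I :=
  Subtype.ext (ruc_id M)

/-- The trivial monoidal homotopy action of a topological group on a monoidal bicategory. -/
def trivialAction (G : Type u) [TopologicalSpace G] [Group G] [IsTopologicalGroup G] :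
    MonFunData (Pi2.mon G) (Aut.mon M) :=
  MonFunData.trivial (Pi2.mon G) (Aut.mon M) (eqToIso (Aut.unitors M))

/-- The second group cohomology of a group `π` with coefficients in an abelian group `H` with the
trivial action. The lifts only move the two groups to a common universe. -/
abbrev GroupH2 (π : Type u) [Group π] (H : Type v) [CommGroup H] : Type max u v :=
  groupCohomology.H2 (Rep.trivial (ULift.{max u v} ℤ) (ULift.{v} π) (ULift.{u} (Additive H)))

end MonBicat

end

open MonBicat

universe w v u uG uH

/-!
Let `Φ : Aut M → B²H` be the given biequivalence. It maps a 2-cell of `Aut M` to an element of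
`H`, but not compatibly with the structure cells, which may be sent to any values. This is
repaired by attaching a weight in `H` to every 1-cell and measuring a 2-cell by the value of its
image, corrected by the weights of its source and target (`Wtd.n`). With composition, tensor
product, associator and unitors of weighted 1-cells defined from the structure cells of `Φ`, the
axioms of `Φ` say that the corrected value is multiplicative for both compositions and the tensor
product, and is `1` on the structure cells (`Wtd.strictVal`). As it is bijective on the 2-cells
between two 1-cells, equations of 2-cells become equations in the abelian group `H`, read off a
pasting diagram by multiplying the values of its pieces (`StrictVal.Has`).

The left and right 2-unitors need no separate treatment except at the unit object. There the value
of the left one, and of the identification of the two unitors, follows from the coherence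
equations `MonData.lamLeft = MonData.lamRight` and `MonData.unitorLeft = MonData.unitorRight`
(`StrictVal.has_lam`, `StrictVal.has_unitor`). In the bicategory of monoidal endofunctors the
components of these 2-cells at an object are built from unit constraints, so that they are
canonical in the sense of `IsCan` and equal.

Since `π₂` is trivial and `G` is a group, parallel 2-cells of the fundamental 2-groupoid are equal
(`Pi2.thin`). The images of loops at the unit therefore multiply up to a 2-cocycle of `π₁` with
values in `H`, and as it is a coboundary there are weights of all paths for which the structure
cells of the underlying 2-functor of the action, and the images of all 2-cells, have value `1`
(`Wtd.exists_weights`).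

What remains of the action are the values `x` of the naturality squares of its comparison of
tensor products, and the values `om`, `ga`, `de` of its associativity and unit squares. They are
trivialised in `StrictVal.exists_toTrivial`. The function `x` is multiplicative in pairs of paths.
An argument in the style of Eckmann and Hilton shows that it is `1` on pairs of loops at the unit,
so it is the coboundary of a function `q` on pairs of points. After correction by `q`, naturality
makes `om`, `ga` and `de` constant. The associativity axiom has three factors `om` on one side and
two on the other, whence the constant is `1`, and the unit axiom shows that the constants of `ga`
and `de` agree. Thus `q` and this last constant define a monoidal transformation to the trivial
action. Its components are equivalences because parallel 1-cells are isomorphic, and forgetting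
the weights carries it back to `Aut M` (`Wtd.descend_isMonoidal`).
-/

noncomputable section

namespace MonBicat

universe w₁ v₁ u₁ w₂ v₂ u₂

/-! ### Strict valuations of 2-cells -/

/-- A valuation of the 2-cells of a monoidal bicategory in an abelian group: it is bijective on
every set of 2-cells, multiplicative for both compositions and for the tensor product, and all
structure cells have value `1`, except possibly the left and right 2-unitors, about which nothing
is assumed. -/
structure StrictVal {A : Type u₁} [Bicategory.{w₁, v₁} A] (N : MonData A) (H : Type u)
    [CommGroup H] where
  /-- the value of a 2-cell -/
  n {a b : A} {f g : a ⟶ b} (η : f ⟶ g) : H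
  bij {a b : A} (f g : a ⟶ b) : Function.Bijective fun η : f ⟶ g => n η
  comp {a b : A} {f g h : a ⟶ b} (η : f ⟶ g) (θ : g ⟶ h) : n (η ≫ θ) = n η * n θ
  whiskerLeft {a b c : A} (f : a ⟶ b) {g h : b ⟶ c} (η : g ⟶ h) : n (f ◁ η) = n η
  whiskerRight {a b c : A} {f g : a ⟶ b} (η : f ⟶ g) (h : b ⟶ c) : n (η ▷ h) = n η
  associator {a b c d : A} (f : a ⟶ b) (g : b ⟶ c) (h : c ⟶ d) : n (α_ f g h).hom = 1
  leftUnitor {a b : A} (f : a ⟶ b) : n (λ_ f).hom = 1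
  rightUnitor {a b : A} (f : a ⟶ b) : n (ρ_ f).hom = 1
  map₂ {X Y : A × A} {f g : X ⟶ Y} (η : f ⟶ g) : n (N.T.map₂ η) = n η.1 * n η.2
  mapComp {X Y Z : A × A} (f : X ⟶ Y) (g : Y ⟶ Z) : n (N.T.mapComp f g).hom = 1
  mapId (X : A × A) : n (N.T.mapId X).hom = 1
  αnat {a b c a' b' c' : A} (f : a ⟶ a') (g : b ⟶ b') (h : c ⟶ c') :
    n (N.αnat f g h).hom = 1
  lnat {a a' : A} (f : a ⟶ a') : n (N.lnat f).hom = 1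
  rnat {a a' : A} (f : a ⟶ a') : n (N.rnat f).hom = 1
  π (a b c d : A) : n (N.π a b c d).hom = 1
  μ (a b : A) : n (N.μ a b).hom = 1

namespace StrictVal

variable {A : Type u₁} [Bicategory.{w₁, v₁} A] {N : MonData A} {H : Type u} [CommGroup H]
  (V : StrictVal N H)

attribute [simp] StrictVal.comp StrictVal.whiskerLeft StrictVal.whiskerRight
  StrictVal.associator StrictVal.leftUnitor StrictVal.rightUnitor StrictVal.map₂
  StrictVal.mapComp StrictVal.mapId StrictVal.αnat StrictVal.lnat StrictVal.rnat
  StrictVal.π StrictVal.μ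

theorem ext {a b : A} {f g : a ⟶ b} {η θ : f ⟶ g} (h : V.n η = V.n θ) : η = θ :=
  (V.bij f g).1 h

@[simp] theorem id {a b : A} (f : a ⟶ b) : V.n (𝟙 f) = 1 := by
  have := V.comp (𝟙 f) (𝟙 f)
  simpa using this

@[simp] theorem inv {a b : A} {f g : a ⟶ b} (i : f ≅ g) : V.n i.inv = (V.n i.hom)⁻¹ := by
  rw [eq_inv_iff_mul_eq_one, ← V.comp, i.inv_hom_id, V.id]

/-- The isomorphism of two parallel 1-cells with a given value. -/
def cell {a b : A} (f g : a ⟶ b) (h : H) : f ≅ g where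
  hom := ((V.bij f g).2 h).choose
  inv := ((V.bij g f).2 h⁻¹).choose
  hom_inv_id := V.ext (by
    rw [V.comp, V.id]
    exact (congrArg₂ _ ((V.bij f g).2 h).choose_spec ((V.bij g f).2 h⁻¹).choose_spec).trans
      (mul_inv_cancel h))
  inv_hom_id := V.ext (by
    rw [V.comp, V.id]
    exact (congrArg₂ _ ((V.bij g f).2 h⁻¹).choose_spec ((V.bij f g).2 h).choose_spec).trans
      (inv_mul_cancel h))

@[simp] theorem cell_hom {a b : A} (f g : a ⟶ b) (h : H) : V.n (V.cell f g h).hom = h :=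
  ((V.bij f g).2 h).choose_spec

/-- `V.Has η h` says that the 2-cell `η` has value `h`. The lemmas in this namespace compute the
value of a pasting diagram by following its construction. Their conclusions are unified with the
goal up to unfolding, so that no composite structure cell has to be rewritten first. -/
def Has {a b : A} {f g : a ⟶ b} (η : f ⟶ g) (h : H) : Prop := V.n η = h

namespace Has

variable {V} {h k l m : H}

theorem mk {a b : A} {f g : a ⟶ b} (η : f ⟶ g) : V.Has η (V.n η) := rfl

theorem eq {a b : A} {f g : a ⟶ b} {η θ : f ⟶ g} (x : V.Has η h) (y : V.Has θ k)
    (e : η = θ) : h = k := x.symm.trans ((congrArg V.n e).trans y)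

theorem ext {a b : A} {f g : a ⟶ b} {η θ : f ⟶ g} (x : V.Has η h) (y : V.Has θ k)
    (e : h = k) : η = θ := V.ext (x.trans (e.trans y.symm))

theorem of {a b : A} {f g : a ⟶ b} {η : f ⟶ g} (x : V.Has η h) (e : h = k) : V.Has η k :=
  Eq.trans x e

theorem id {a b : A} (f : a ⟶ b) : V.Has (𝟙 f) 1 := V.id f

theorem refl {a b : A} (f : a ⟶ b) : V.Has (Iso.refl f).hom 1 := V.id f

theorem comp {a b : A} {f g h' : a ⟶ b} {η : f ⟶ g} {θ : g ⟶ h'} (x : V.Has η h)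
    (y : V.Has θ k) : V.Has (η ≫ θ) (h * k) := (V.comp η θ).trans (congrArg₂ _ x y)

theorem wl {a b c : A} {f : a ⟶ b} {g g' : b ⟶ c} {η : g ⟶ g'} (x : V.Has η h) :
    V.Has (f ◁ η) h := (V.whiskerLeft f η).trans x

theorem wr {a b c : A} {f f' : a ⟶ b} {η : f ⟶ f'} {g : b ⟶ c} (x : V.Has η h) :
    V.Has (η ▷ g) h := (V.whiskerRight η g).trans x

theorem as {a b c d : A} (f : a ⟶ b) (g : b ⟶ c) (h : c ⟶ d) : V.Has (α_ f g h).hom 1 :=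
  V.associator f g h

theorem lu {a b : A} (f : a ⟶ b) : V.Has (λ_ f).hom 1 := V.leftUnitor f

theorem ru {a b : A} (f : a ⟶ b) : V.Has (ρ_ f).hom 1 := V.rightUnitor f

theorem inv {a b : A} {f g : a ⟶ b} {i : f ≅ g} (x : V.Has i.hom h) : V.Has i.inv h⁻¹ :=
  (V.inv i).trans (congrArg _ x)

theorem symm {a b : A} {f g : a ⟶ b} {i : f ≅ g} (x : V.Has i.hom h) :
    V.Has i.symm.hom h⁻¹ := inv x

theorem trans {a b : A} {f g h' : a ⟶ b} {η : f ≅ g} {θ : g ≅ h'} (x : V.Has η.hom h)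
    (y : V.Has θ.hom k) : V.Has (η ≪≫ θ).hom (h * k) := comp x y

theorem wlIso {a b c : A} {f : a ⟶ b} {g g' : b ⟶ c} {η : g ≅ g'} (x : V.Has η.hom h) :
    V.Has (whiskerLeftIso f η).hom h := wl x

theorem wrIso {a b c : A} {f f' : a ⟶ b} {η : f ≅ f'} {g : b ⟶ c} (x : V.Has η.hom h) :
    V.Has (whiskerRightIso η g).hom h := wr x

theorem vcomp {a b c d e k' : A} {f : a ⟶ b} {g : c ⟶ d} {h' : e ⟶ k'} {u : a ⟶ c}
    {v : b ⟶ d} {u' : c ⟶ e} {v' : d ⟶ k'} {Q : Sq f g u v} {R : Sq g h' u' v'}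
    (x : V.Has Q.hom h) (y : V.Has R.hom k) : V.Has (MonBicat.vcomp Q R).hom (h * k) := by
  refine ((symm (as _ _ _)).trans (x.wrIso.trans ((as _ _ _).trans (y.wlIso.trans
    (symm (as _ _ _)))))).of ?_
  simp

theorem hcomp {a b c d e k' : A} {f : a ⟶ b} {g : c ⟶ d} {u : a ⟶ c} {v : b ⟶ d}
    {f' : b ⟶ e} {g' : d ⟶ k'} {w : e ⟶ k'} {Q : Sq f g u v} {R : Sq f' g' v w}
    (x : V.Has Q.hom h) (y : V.Has R.hom k) : V.Has (MonBicat.hcomp Q R).hom (h * k) := by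
  refine ((as _ _ _).trans (y.wlIso.trans ((symm (as _ _ _)).trans (x.wrIso.trans
    (as _ _ _))))).of ?_
  simp [mul_comm]

theorem idV {a b : A} (f : a ⟶ b) : V.Has (MonBicat.idV f).hom 1 :=
  ((ru _).trans (symm (lu _))).of (by simp)

theorem idH {a b : A} (f : a ⟶ b) : V.Has (MonBicat.idH f).hom 1 :=
  ((lu _).trans (symm (ru _))).of (by simp)

theorem adj {a b c d : A} {f : a ⟶ b} {g : c ⟶ d} {u u' : a ⟶ c} {v v' : b ⟶ d}
    {i : u' ≅ u} {Q : Sq f g u v} {j : v' ≅ v} (x : V.Has i.hom h) (y : V.Has Q.hom k)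
    (z : V.Has j.hom l) : V.Has (MonBicat.adj i Q j).hom (h⁻¹ * k * l) :=
  (z.wlIso.trans (y.trans (wrIso (symm x)))).of (by simp [mul_comm, mul_left_comm])

theorem map₂ {a b a' b' : A} {f f' : a ⟶ a'} {g g' : b ⟶ b'} {η : f ⟶ f'} {θ : g ⟶ g'}
    (x : V.Has η h) (y : V.Has θ k) :
    V.Has (N.T.map₂ (a := (a, b)) (b := (a', b')) (f := (f, g)) (g := (f', g')) (η, θ))
      (h * k) := (V.map₂ _).trans (congrArg₂ _ x y)

theorem tiso {a b a' b' : A} {f f' : a ⟶ a'} {g g' : b ⟶ b'} {η : f ≅ f'} {θ : g ≅ g'}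
    (x : V.Has η.hom h) (y : V.Has θ.hom k) : V.Has (MonBicat.tiso N.T η θ).hom (h * k) :=
  map₂ x y

theorem tmapComp {X Y Z : A × A} (f : X ⟶ Y) (g : Y ⟶ Z) : V.Has (N.T.mapComp f g).hom 1 :=
  V.mapComp f g

theorem tcomp {a b a' b' c d : A} {f : a ⟶ a'} {f' : a' ⟶ c} {g : b ⟶ b'} {g' : b' ⟶ d} :
    V.Has (MonBicat.tcomp N.T (f := f) (f' := f') (g := g) (g' := g')).hom 1 :=
  V.mapComp _ _

theorem tid (a b : A) : V.Has (MonBicat.tid N.T a b).hom 1 := V.mapId _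

theorem tsq {a b c d a' b' c' d' : A} {f : a ⟶ b} {g : c ⟶ d} {u : a ⟶ c} {v : b ⟶ d}
    {f' : a' ⟶ b'} {g' : c' ⟶ d'} {u' : a' ⟶ c'} {v' : b' ⟶ d'} {Q : Sq f g u v}
    {R : Sq f' g' u' v'} (x : V.Has Q.hom h) (y : V.Has R.hom k) :
    V.Has (MonBicat.tsq N.T Q R).hom (h * k) :=
  ((symm tcomp).trans ((tiso x y).trans tcomp)).of (by simp)

theorem lcomp {a b c d : A} (f : b ⟶ c) (g : c ⟶ d) :
    V.Has (MonBicat.lcomp N.T a f g).hom 1 :=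
  (comp (map₂ (symm (ru _)) (id _)) (tmapComp _ _)).of (by simp)

theorem rcomp {a b c d : A} (f : b ⟶ c) (g : c ⟶ d) :
    V.Has (MonBicat.rcomp N.T a f g).hom 1 :=
  (comp (map₂ (id _) (symm (lu _))) (tmapComp _ _)).of (by simp)

theorem αnat {a b c a' b' c' : A} (f : a ⟶ a') (g : b ⟶ b') (h : c ⟶ c') :
    V.Has (N.αnat f g h).hom 1 := V.αnat f g h

theorem lnat {a a' : A} (f : a ⟶ a') : V.Has (N.lnat f).hom 1 := V.lnat f

theorem rnat {a a' : A} (f : a ⟶ a') : V.Has (N.rnat f).hom 1 := V.rnat f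

theorem π (a b c d : A) : V.Has (N.π a b c d).hom 1 := V.π a b c d

theorem μ (a b : A) : V.Has (N.μ a b).hom 1 := V.μ a b

end Has

/-! ### Values of the axioms of a normal monoidal functor -/

section Functors

variable {D : Type u₂} [Bicategory.{w₂, v₂} D]

/-- A pseudofunctor whose structure cells and images of 2-cells all have value `1`. -/
structure Normal (F : D ⥤ᵖ A) : Prop where
  map₂ {a b : D} {f g : a ⟶ b} (η : f ⟶ g) : V.Has (F.map₂ η) 1
  mapId (a : D) : V.Has (F.mapId a).hom 1
  mapComp {a b c : D} (f : a ⟶ b) (g : b ⟶ c) : V.Has (F.mapComp f g).hom 1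

namespace Normal

variable {V} {F : D ⥤ᵖ A} (hF : V.Normal F)

include hF

theorem map₂Iso {a b : D} {f g : a ⟶ b} (η : f ≅ g) : V.Has (F.map₂Iso η).hom 1 :=
  hF.map₂ η.hom

theorem mapSq {a b c d : D} {f : a ⟶ b} {g : c ⟶ d} {u : a ⟶ c} {v : b ⟶ d}
    (Q : Sq f g u v) : V.Has (MonBicat.mapSq F Q).hom 1 :=
  ((hF.mapComp _ _).symm.trans ((hF.map₂Iso _).trans (hF.mapComp _ _))).of (by simp)

theorem map21 {a b c : D} {f : a ⟶ b} {g : b ⟶ c} {h : a ⟶ c} (η : f ≫ g ≅ h) :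
    V.Has (MonBicat.map21 F η).hom 1 :=
  (Has.trans (.symm (hF.mapComp _ _)) (hF.map₂Iso _)).of (by simp)

theorem map32 {a b c d e : D} {f : a ⟶ b} {g : b ⟶ c} {h : c ⟶ d} {k : a ⟶ e}
    {l : e ⟶ d} (η : f ≫ g ≫ h ≅ k ≫ l) : V.Has (MonBicat.map32 F η).hom 1 :=
  (Has.trans (.wlIso (.symm (hF.mapComp _ _))) (.trans (.symm (hF.mapComp _ _))
    (.trans (hF.map₂Iso _) (hF.mapComp _ _)))).of (by simp)

end Normal

variable {V} {M : MonData D} {X : MonFunData M N}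

/-- The value of the naturality square of the comparison of tensor products. -/
def x (V : StrictVal N H) (X : MonFunData M N) {a b a' b' : D} (f : a ⟶ a') (g : b ⟶ b') : H :=
  V.n (X.χnat f g).hom

/-- The value of the associativity square. -/
def om (V : StrictVal N H) (X : MonFunData M N) (a b c : D) : H := V.n (X.om a b c).hom

/-- The value of the left unit square. -/
def ga (V : StrictVal N H) (X : MonFunData M N) (a : D) : H := V.n (X.ga a).hom

/-- The value of the right unit square. -/
def de (V : StrictVal N H) (X : MonFunData M N) (a : D) : H := V.n (X.de a).hom

variable (hX : X.IsMonoidal) (hF : V.Normal X.F)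

include hF

theorem Normal.idsq (a : D) : V.Has (X.idsq a).hom 1 :=
  (Has.wlIso (.symm (hF.mapId _))).of (by simp)

theorem Normal.ιsq : V.Has X.ιsq.hom 1 :=
  (Has.trans (.lu _) (.trans (.symm (.ru _)) (.wlIso (.symm (hF.mapId _))))).of (by simp)

include hX

/-- Naturality of the associativity square of `X`, as an equation of values. -/
theorem nat_om {a b c a' b' c' : D} (f : a ⟶ a') (g : b ⟶ b') (h : c ⟶ c') :
    V.om X a' b' c' * (V.x X f g * V.x X (tmap M.T f g) h) =
    V.x X g h * V.x X f (tmap M.T g h) * V.om X a b c := by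
  have := Has.eq (V := V) (.comp (.wl (.mk _)) (.vcomp (.vcomp (.tsq (.mk _) (.idV _)) (.mk _))
    (hF.mapSq _))) (.comp (.vcomp (.αnat _ _ _) (.vcomp (.tsq (.idV _) (.mk _)) (.mk _)))
    (.wr (.mk _))) (hX.ω_nat f g h)
  simp only [mul_one, one_mul] at this
  exact this

theorem nat_ga {a a' : D} (f : a ⟶ a') : V.ga X a' * V.x X (𝟙 M.I) f = V.ga X a := by
  have := Has.eq (V := V) (.comp (.wl (.mk _)) (.vcomp (.vcomp (.tsq hF.ιsq (.idV _)) (.mk _))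
    (hF.mapSq _))) (.comp (.vcomp (.lnat _) (.idV _)) (.wr (.mk _))) (hX.γ_nat f)
  simp only [mul_one, one_mul] at this
  exact this

theorem nat_de {a a' : D} (f : a ⟶ a') : V.de X a' * V.x X f (𝟙 M.I) = V.de X a := by
  have := Has.eq (V := V) (.comp (.wl (.mk _)) (.vcomp (.vcomp (.tsq (.idV _) hF.ιsq) (.mk _))
    (hF.mapSq _))) (.comp (.vcomp (.rnat _) (.idV _)) (.wr (.mk _))) (hX.δ_nat f)
  simp only [mul_one, one_mul] at this
  exact this

/-- The associativity axiom of `X`, as an equation of values. -/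
theorem pentagon (a b c d : D) :
    V.om X a b c * V.x X (M.α a b c) (𝟙 d) * (V.om X a (tobj M.T b c) d *
      (V.om X b c d * V.x X (𝟙 a) (M.α b c d))) =
    V.om X (tobj M.T a b) c d * V.om X a b (tobj M.T c d) := by
  have := Has.eq (V := V) (.comp (.hcomp
      (.adj (.trans (.symm (.as _ _ _)) (.wrIso (.symm (.rcomp _ _))))
        (.vcomp (.tsq (.mk _) (hF.idsq d)) (.mk _))
        (.trans (.symm (.as _ _ _)) (.wrIso (.symm (.rcomp _ _)))))
      (.hcomp (.vcomp (.symm (.αnat _ _ _)) (.mk _))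
        (.adj (.trans (.symm (.as _ _ _)) (.wrIso (.symm (.lcomp _ _))))
          (.vcomp (.tsq (hF.idsq a) (.mk _)) (.mk _))
          (.trans (.symm (.as _ _ _)) (.wrIso (.symm (.lcomp _ _)))))))
      (.wl (hF.map32 _)))
    (.comp (.wr (.π _ _ _ _)) (.hcomp
      (.adj (.refl _) (.vcomp (.symm (.αnat _ _ _)) (.mk _))
        (.trans (.wrIso (.trans (.tiso (.symm (.ru _)) (.trans (.symm (.lu _))
          (.wrIso (.symm (.tid _ _))))) .tcomp)) (.as _ _ _)))
      (.adj (.trans (.wrIso (.trans (.tiso (.trans (.symm (.lu _))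
          (.wrIso (.symm (.tid _ _)))) (.symm (.ru _))) .tcomp)) (.as _ _ _))
        (.vcomp (.symm (.αnat _ _ _)) (.mk _)) (.refl _)))) (hX.assoc a b c d)
  simp only [mul_one, one_mul, inv_one] at this
  exact this

/-- The unit axiom of `X`, as an equation of values. -/
theorem triangle (a b : D) :
    V.om X a M.I b * (V.ga X b * V.x X (𝟙 a) (M.l b)) = V.de X a * V.x X (M.r a) (𝟙 b) := by
  have := Has.eq (V := V) (.comp (.hcomp (.vcomp (.symm (.αnat _ _ _)) (.mk _))
      (.adj (.trans (.symm (.as _ _ _)) (.wrIso (.symm (.lcomp _ _))))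
        (.vcomp (.tsq (hF.idsq a) (.mk _)) (.mk _))
        (.trans (.symm (.lu _)) (.wrIso (.symm (.tid _ _)))))) (.wl (hF.map21 _)))
    (.comp (.wr (.μ _ _)) (.adj (.trans (.symm (.as _ _ _)) (.wrIso (.symm (.rcomp _ _))))
        (.vcomp (.tsq (.mk _) (hF.idsq b)) (.mk _))
        (.trans (.symm (.lu _)) (.wrIso (.symm (.tid _ _)))))) (hX.unit a b)
  simp only [mul_one, one_mul, inv_one] at this
  exact this

omit hX

/-- The comparison of tensor products is a pseudonatural transformation between normal functors, so
that the values of its naturality squares are multiplicative. -/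
theorem x_comp {a b c a' b' c' : D} (f : a ⟶ b) (g : b ⟶ c) (f' : a' ⟶ b') (g' : b' ⟶ c') :
    V.x X (f ≫ g) (f' ≫ g') = V.x X f f' * V.x X g g' := by
  have := Has.eq (V := V) (.comp (.mk _) (.wl (.comp (hF.map₂ _) (hF.mapComp _ _))))
    (.comp (.wr (.comp (.map₂ (hF.mapComp _ _) (hF.mapComp _ _)) .tcomp)) (.comp (.as _ _ _)
      (.comp (.wl (.mk _)) (.comp (.inv (.as _ _ _)) (.comp (.wr (.mk _)) (.as _ _ _))))))
    (X.χt.naturality_comp (a := (a, a')) (b := (b, b')) (c := (c, c')) (f, f') (g, g'))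
  simp only [mul_one, one_mul, inv_one] at this
  exact this.trans (mul_comm _ _)

theorem x_map₂ {a b a' b' : D} {f g : a ⟶ b} {f' g' : a' ⟶ b'} (η : f ⟶ g) (θ : f' ⟶ g') :
    V.x X f f' = V.x X g g' := by
  have := Has.eq (V := V) (.comp (.wr (.map₂ (hF.map₂ _) (hF.map₂ _))) (.mk _))
    (.comp (.mk _) (.wl (hF.map₂ _)))
    (X.χt.naturality_naturality (a := (a, a')) (b := (b, b'))
    (f := (f, f')) (g := (g, g')) (η, θ))
  simp only [mul_one, one_mul] at this
  exact this.symm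

end Functors

/-! ### Trivialising a normal monoidal functor -/

section Existence

variable {D : Type u₂} [Bicategory.{w₂, v₂} D] {M : MonData D} {X : MonFunData M N}

/-- The transformation from a normal functor to the trivial one with arbitrary components,
naturality squares of value `1`, comparison squares with tensor products of values `p`, and
comparison square with units of value `u`. -/
def toTrivial (hA : ∀ a b : A, Nonempty (a ⟶ b)) (hF : V.Normal X.F) (i : N.r N.I ≅ N.l N.I)
    (p : D → D → H) (u : H) : MonTransData X (MonFunData.trivial M N i) where
  t :=
    { app := fun a => (hA (X.o a) N.I).some
      naturality := fun f => V.cell _ _ 1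
      naturality_naturality := fun η =>
        Has.ext (.comp (.wr (hF.map₂ _)) (V.cell_hom _ _ 1))
          (.comp (V.cell_hom _ _ 1) (.wl (.id _))) rfl
      naturality_id := fun a =>
        Has.ext (V := V) (.comp (V.cell_hom _ _ 1) (.wl (.refl _)))
          (.comp (.wr (hF.mapId _)) (.comp (.lu _) (.inv (.ru _)))) (by simp)
      naturality_comp := fun f g =>
        Has.ext (V := V) (.comp (V.cell_hom _ _ 1) (.wl (.inv (.lu _))))
          (.comp (.wr (hF.mapComp _ _)) (.comp (.as _ _ _) (.comp (.wl (V.cell_hom _ _ 1))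
            (.comp (.inv (.as _ _ _)) (.comp (.wr (V.cell_hom _ _ 1)) (.as _ _ _))))))
          (by simp) }
  P a b := V.cell _ _ (p a b)
  U := V.cell _ _ u

variable {V}

/-- The axioms of a monoidal transformation for `toTrivial` say that `p` and `u` trivialise the
values `x`, `om`, `ga` and `de` of the structure squares. -/
theorem toTrivial_isMonoidal (hA : ∀ a b : A, Nonempty (a ⟶ b)) (hF : V.Normal X.F)
    (i : N.r N.I ≅ N.l N.I) (hi : V.Has i.hom 1) (hl : V.Has (N.lam N.I N.I).hom 1)
    (p : D → D → H) (u : H)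
    (hp : ∀ {a b a' b' : D} (f : a ⟶ a') (g : b ⟶ b'), V.x X f g * p a b = p a' b')
    (ho : ∀ a b c, V.om X a b c * (p a b * p (tobj M.T a b) c) =
      p b c * p a (tobj M.T b c))
    (hg : ∀ a, V.ga X a * (u * p M.I a) = 1) (hd : ∀ a, V.de X a * (u * p a M.I) = 1) :
    (V.toTrivial hA hF i p u).IsMonoidal where
  P_nat {a b a' b'} f g := Has.ext (V := V)
    (.comp (.wl (V.cell_hom _ _ (p a' b'))) (.vcomp (.tsq (V.cell_hom _ _ 1) (V.cell_hom _ _ 1))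
      (.lnat _)))
    (.comp (.vcomp (.mk _) (V.cell_hom _ _ 1)) (.wr (V.cell_hom _ _ (p a b))))
    (by
      have := hp f g
      simp only [mul_one]
      exact this.symm)
  assoc a b c := Has.ext (V := V)
    (.comp (.hcomp (.symm (.αnat _ _ _)) (.hcomp (.tsq (.idH _) (V.cell_hom _ _ (p b c)))
      (V.cell_hom _ _ (p a (tobj M.T b c))))) (.wl (.trans (.wlIso (.lnat _)) (.trans
        (.symm (.as _ _ _)) (.trans (.wrIso hl) (.symm (.ru _)))))))
    (.comp (.wr (.mk _)) (.hcomp (.hcomp (.tsq (V.cell_hom _ _ (p a b)) (.idH _))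
      (V.cell_hom _ _ (p (tobj M.T a b) c))) (V.cell_hom _ _ 1)))
    (by
      have := ho a b c
      simp only [mul_one, one_mul, inv_one]
      exact this.symm)
  unit_left a := Has.ext (V := V)
    (.comp (.hcomp (.symm (.lnat _)) (.idH _)) (.wl (.wrIso (.trans (.symm (.lu _))
      (.wrIso (.symm (.tid _ _)))))))
    (.comp (.wr (.mk _)) (.hcomp (.hcomp (.tsq (V.cell_hom _ _ u) (.idH _))
      (V.cell_hom _ _ (p M.I a))) (V.cell_hom _ _ 1)))
    (by
      have := hg a
      simp only [mul_one, inv_one]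
      exact this.symm)
  unit_right a := Has.ext (V := V)
    (.comp (.hcomp (.symm (.rnat _)) (.idH _)) (.wl (.wrIso (.trans hi (.trans (.symm (.lu _))
      (.wrIso (.symm (.tid _ _))))))))
    (.comp (.wr (.mk _)) (.hcomp (.hcomp (.tsq (.idH _) (V.cell_hom _ _ u))
      (V.cell_hom _ _ (p a M.I))) (V.cell_hom _ _ 1)))
    (by
      have := hd a
      simp only [mul_one, one_mul, inv_one]
      exact this.symm)

/-- A normal monoidal functor from a connected source with invertible 1-cells is equivalent to the
trivial one. -/
theorem exists_toTrivial (hA : ∀ a b : A, Nonempty (a ⟶ b)) (hX : X.IsMonoidal)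
    (hF : V.Normal X.F)
    (i : N.r N.I ≅ N.l N.I) (hi : V.Has i.hom 1) (hl : V.Has (N.lam N.I N.I).hom 1)
    (hD : ∀ a b : D, Nonempty (a ⟶ b))
    (hinv : ∀ {a b : D} (f : a ⟶ b), ∃ g : b ⟶ a, Nonempty (f ≫ g ≅ 𝟙 a)) :
    ∃ θ : MonTransData X (MonFunData.trivial M N i), θ.IsMonoidal := by
  -- Since `x` is multiplicative, its value at two loops at the unit object is the product of its
  -- values at `(f, 𝟙)` and `(𝟙, g)`, which are `1` by naturality of the unit squares.
  have x1 (f g : M.I ⟶ M.I) : V.x X f g = 1 := by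
    rw [← x_map₂ hF (ρ_ f).hom (λ_ g).hom, x_comp hF, mul_eq_one_iff_eq_inv]
    have h1 := nat_ga hX hF g
    have h2 := nat_de hX hF f
    rw [mul_eq_left] at h1 h2
    rw [h1, h2, inv_one]
  -- Hence its value at 1-cells out of the unit object depends on their targets only, and `x` is the
  -- coboundary of the function `q` on pairs of objects.
  have x2 {a b : D} (f f' : M.I ⟶ a) (g g' : M.I ⟶ b) : V.x X f g = V.x X f' g' := by
    obtain ⟨k, ⟨j⟩⟩ := hinv f
    obtain ⟨k', ⟨j'⟩⟩ := hinv g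
    have e1 := x1 (f ≫ k) (g ≫ k')
    have e2 := x1 (f' ≫ k) (g' ≫ k')
    rw [x_comp hF] at e1 e2
    exact mul_right_cancel (e1.trans e2.symm)
  let γ (a : D) : M.I ⟶ a := (hD M.I a).some
  let q (a b : D) : H := V.x X (γ a) (γ b)
  have hq {a b a' b' : D} (f : a ⟶ a') (g : b ⟶ b') : V.x X f g * q a b = q a' b' := by
    rw [mul_comm]
    exact (x_comp hF _ _ _ _).symm.trans (x2 _ _ _ _)
  have hx {a b a' b' : D} (f : a ⟶ a') (g : b ⟶ b') : V.x X f g = q a' b' / q a b :=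
    eq_div_of_mul_eq' (hq f g)
  -- After correction by `q` the value of the associativity square is independent of the objects, by
  -- naturality, and the pentagon shows that this constant is `1`: it has three factors on one side
  -- and two on the other.
  let o (a b c : D) : H := V.om X a b c * (q a b * q (tobj M.T a b) c) /
    (q b c * q a (tobj M.T b c))
  have ho (a b c : D) : o a b c = o M.I M.I M.I := by
    have := nat_om hX hF (γ a) (γ b) (γ c)
    simp only [hx] at this
    have this := congrArg Additive.ofMul this
    apply Additive.ofMul.injective
    simp only [o, ofMul_mul, ofMul_div] at this ⊢
    linear_combination (norm := abel) this
  have ho1 : o M.I M.I M.I = 1 := by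
    have := pentagon hX hF M.I M.I M.I M.I
    simp only [hx] at this
    have this := congrArg Additive.ofMul this
    have h := ho
    simp only [o] at h
    have h1 := congrArg Additive.ofMul (h (tobj M.T M.I M.I) M.I M.I)
    have h2 := congrArg Additive.ofMul (h M.I (tobj M.T M.I M.I) M.I)
    have h3 := congrArg Additive.ofMul (h M.I M.I (tobj M.T M.I M.I))
    apply Additive.ofMul.injective
    simp only [o, ofMul_mul, ofMul_div, ofMul_one] at this h1 h2 h3 ⊢
    linear_combination (norm := abel) this - h2 + h1 + h3
  have hom (a b c : D) : V.om X a b c * (q a b * q (tobj M.T a b) c) =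
      q b c * q a (tobj M.T b c) := div_eq_one.1 ((ho a b c).trans ho1)
  -- The corrected unit squares are constant for the same reason, and the triangle equates them.
  have hga (a : D) : V.ga X a * q M.I a = V.ga X M.I * q M.I M.I := by
    have := nat_ga hX hF (γ a)
    rw [hx] at this
    rw [← this, ← mul_div_assoc, div_mul_cancel]
  have hde (a : D) : V.de X a * q a M.I = V.de X M.I * q M.I M.I := by
    have := nat_de hX hF (γ a)
    rw [hx] at this
    rw [← this, ← mul_div_assoc, div_mul_cancel]
  have hgd : V.ga X M.I * q M.I M.I = V.de X M.I * q M.I M.I := by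
    have := triangle hX hF M.I M.I
    have h2 := hom M.I M.I M.I
    simp only [hx] at this
    have this := congrArg Additive.ofMul this
    have h2 := congrArg Additive.ofMul h2
    apply Additive.ofMul.injective
    simp only [ofMul_mul, ofMul_div] at this h2 ⊢
    linear_combination (norm := abel) this - h2
  -- The comparison squares are `q`, and `u` cancels the common value of the corrected unit squares.
  refine ⟨_, toTrivial_isMonoidal hA hF i hi hl q (V.ga X M.I * q M.I M.I)⁻¹ hq hom
    (fun a => ?_) (fun a => ?_)⟩
  · rw [mul_left_comm]
    exact inv_mul_eq_one.2 (hga a).symm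
  · rw [mul_left_comm]
    exact inv_mul_eq_one.2 (hgd.trans (hde a).symm)

end Existence

end StrictVal

/-! ### Weighted 1-cells -/

/-- The objects of the bicategory of weighted 1-cells of a pseudofunctor `F : A ⥤ᵖ BB H`: those of
`A`. A 1-cell is a 1-cell of `A` with an element of `H`, its weight, and a 2-cell is a 2-cell of
`A`. The weights serve to correct the value in `H` of the image of a 2-cell, see `Wtd.n`. The
composite of weighted 1-cells absorbs the structure cells of `F`, so that the structure cells of
this bicategory have corrected value `1`. -/
structure Wtd {A : Type u₁} [Bicategory.{w₁, v₁} A] {H : Type u} [CommGroup H]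
    (F : A ⥤ᵖ BB H) where
  /-- the underlying object -/
  val : A

namespace Wtd

variable {A : Type u₁} [Bicategory.{w₁, v₁} A] {H : Type u} [CommGroup H] {F : A ⥤ᵖ BB H}

/-- A 1-cell with a weight. -/
structure Hom (a b : Wtd F) where
  /-- the underlying 1-cell -/
  cell : a.val ⟶ b.val
  /-- the weight -/
  wt : H

instance : CategoryStruct (Wtd F) where
  Hom a b := Hom a b
  id a := ⟨𝟙 a.val, BB.val (F.mapId a.val).hom⟩
  comp f g := ⟨f.cell ≫ g.cell, BB.val (F.mapComp f.cell g.cell).hom * (f.wt * g.wt)⟩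

instance {a b : Wtd F} : Category (a ⟶ b) where
  Hom f g := f.cell ⟶ g.cell
  id f := 𝟙 f.cell
  comp η θ := CategoryStruct.comp (X := Hom.cell _) η θ
  id_comp η := Category.id_comp (X := Hom.cell _) η
  comp_id η := Category.comp_id (X := Hom.cell _) η
  assoc η θ κ := Category.assoc (W := Hom.cell _) η θ κ

/-- A 2-isomorphism as one of weighted 1-cells. -/
def ofIso {a b : Wtd F} {f g : a ⟶ b} (i : f.cell ≅ g.cell) : f ≅ g :=
  ⟨i.hom, i.inv, i.hom_inv_id, i.inv_hom_id⟩

/-- A 2-isomorphism of weighted 1-cells as one of underlying 1-cells. -/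
def toIso {a b : Wtd F} {f g : a ⟶ b} (i : f ≅ g) : f.cell ≅ g.cell :=
  ⟨i.hom, i.inv, i.hom_inv_id, i.inv_hom_id⟩

instance : Bicategory (Wtd F) where
  homCategory _ _ := inferInstance
  whiskerLeft f _ _ η := Bicategory.whiskerLeft (Hom.cell f) η
  whiskerRight η h := Bicategory.whiskerRight (f := Hom.cell _) η (Hom.cell h)
  associator f g h := ofIso (α_ f.cell g.cell h.cell)
  leftUnitor f := ofIso (λ_ f.cell)
  rightUnitor f := ofIso (ρ_ f.cell)
  whiskerLeft_id f g := Bicategory.whiskerLeft_id f.cell g.cell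
  whiskerLeft_comp f _ _ _ η θ := Bicategory.whiskerLeft_comp f.cell (g := Hom.cell _) η θ
  id_whiskerLeft η := Bicategory.id_whiskerLeft (f := Hom.cell _) η
  comp_whiskerLeft f g _ _ η := Bicategory.comp_whiskerLeft f.cell g.cell (h := Hom.cell _) η
  id_whiskerRight f g := Bicategory.id_whiskerRight f.cell g.cell
  comp_whiskerRight η θ k := Bicategory.comp_whiskerRight (f := Hom.cell _) η θ k.cell
  whiskerRight_id η := Bicategory.whiskerRight_id (f := Hom.cell _) η
  whiskerRight_comp η g h := Bicategory.whiskerRight_comp (f := Hom.cell _) η g.cell h.cell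
  whisker_assoc f _ _ η h := Bicategory.whisker_assoc f.cell (g := Hom.cell _) η h.cell
  whisker_exchange η θ :=
    Bicategory.whisker_exchange (f := Hom.cell _) (h := Hom.cell _) η θ
  pentagon f g h k := Bicategory.pentagon f.cell g.cell h.cell k.cell
  triangle f g := Bicategory.triangle f.cell g.cell

@[simp] theorem comp_cell {a b c : Wtd F} (f : a ⟶ b) (g : b ⟶ c) :
    (f ≫ g).cell = f.cell ≫ g.cell := rfl

@[simp] theorem id_cell (a : Wtd F) : (𝟙 a : a ⟶ a).cell = 𝟙 a.val := rfl

@[simp] theorem id_wt (a : Wtd F) : (𝟙 a : a ⟶ a).wt = BB.val (F.mapId a.val).hom := rfl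

/-- The value of a 2-cell: that of its image in `BB H`, divided by the weight of its source and
multiplied by the weight of its target. -/
def n {a b : Wtd F} {f g : a ⟶ b} (η : f ⟶ g) : H :=
  f.wt⁻¹ * BB.val (F.map₂ (f := f.cell) (g := g.cell) η) * g.wt

section

variable {a b c d : Wtd F}

theorem val_inv {x y : BB H} {f g : x ⟶ y} (i : f ≅ g) : BB.val i.inv = (BB.val i.hom)⁻¹ :=
  eq_inv_of_mul_eq_one_left (congrArg BB.val i.inv_hom_id)

theorem n_comp {f g h : a ⟶ b} (η : f ⟶ g) (θ : g ⟶ h) : n (η ≫ θ) = n η * n θ := by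
  have := congrArg BB.val (F.map₂_comp (f := Hom.cell f) (g := Hom.cell g) (h := Hom.cell h) η θ)
  refine (congrArg (fun x => f.wt⁻¹ * x * h.wt) this).trans ?_
  rw [BB.val_comp, n, n]
  group

theorem n_whiskerLeft (f : a ⟶ b) {g h : b ⟶ c} (η : g ⟶ h) : n (f ◁ η) = n η := by
  have := congrArg BB.val (F.map₂_whisker_left f.cell (g := g.cell) (h := h.cell) η)
  refine (congrArg (fun x => (_ * _)⁻¹ * x * (_ * _)) this).trans ?_
  simp only [BB.val_comp, BB.val_whiskerLeft, val_inv, n]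
  apply Additive.ofMul.injective
  simp only [ofMul_mul, ofMul_inv]
  abel

theorem n_whiskerRight {f g : a ⟶ b} (η : f ⟶ g) (h : b ⟶ c) : n (η ▷ h) = n η := by
  have := congrArg BB.val (F.map₂_whisker_right (f := f.cell) (g := g.cell) η h.cell)
  refine (congrArg (fun x => (_ * _)⁻¹ * x * (_ * _)) this).trans ?_
  simp only [BB.val_comp, BB.val_whiskerRight, val_inv, n]
  apply Additive.ofMul.injective
  simp only [ofMul_mul, ofMul_inv]
  abel

theorem n_associator (f : a ⟶ b) (g : b ⟶ c) (h : c ⟶ d) : n (α_ f g h).hom = 1 := by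
  have := congrArg BB.val (F.map₂_associator f.cell g.cell h.cell)
  refine (congrArg (fun x => (_ * (_ * _ * _))⁻¹ * x * (_ * (_ * (_ * _)))) this).trans ?_
  simp only [BB.val_comp, BB.val_whiskerRight, BB.val_whiskerLeft, BB.val_associator, val_inv]
  dsimp only [comp_cell, id_cell, id_wt]
  apply Additive.ofMul.injective
  simp only [ofMul_mul, ofMul_inv, ofMul_one]
  abel

theorem n_leftUnitor (f : a ⟶ b) : n (λ_ f).hom = 1 := by
  have := congrArg BB.val (F.map₂_left_unitor f.cell)
  refine (congrArg (fun x => (_ * (_ * _))⁻¹ * x * _) this).trans ?_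
  simp only [BB.val_comp, BB.val_whiskerRight, BB.val_leftUnitor]
  dsimp only [comp_cell, id_cell, id_wt]
  apply Additive.ofMul.injective
  simp only [ofMul_mul, ofMul_inv, ofMul_one]
  abel

theorem n_rightUnitor (f : a ⟶ b) : n (ρ_ f).hom = 1 := by
  have := congrArg BB.val (F.map₂_right_unitor f.cell)
  refine (congrArg (fun x => (_ * (_ * _))⁻¹ * x * _) this).trans ?_
  simp only [BB.val_comp, BB.val_whiskerLeft, BB.val_rightUnitor]
  dsimp only [comp_cell, id_cell, id_wt]
  apply Additive.ofMul.injective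
  simp only [ofMul_mul, ofMul_inv, ofMul_one]
  abel

theorem n_bijective (hF : ∀ {x y : A} (f g : x ⟶ y), Function.Bijective fun η : f ⟶ g => F.map₂ η)
    (f g : a ⟶ b) : Function.Bijective fun η : f ⟶ g => n η := by
  have h1 : Function.Bijective fun z : H => f.wt⁻¹ * z * g.wt :=
    (Group.mulRight_bijective g.wt).comp (Group.mulLeft_bijective f.wt⁻¹)
  exact h1.comp (hF f.cell g.cell)

end

/-! ### The monoidal bicategory of weighted 1-cells -/

section Monoidal

variable (D : MonData A) (Φ : MonFunData D (BB.mon H))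

/-- The pair of underlying 1-cells. -/
abbrev p₁ {F : A ⥤ᵖ BB H} {X Y : Wtd F × Wtd F} (f : X ⟶ Y) :
    (X.1.val, X.2.val) ⟶ (Y.1.val, Y.2.val) := (f.1.cell, f.2.cell)

/-- The pair of underlying 2-cells. -/
abbrev p₂ {F : A ⥤ᵖ BB H} {X Y : Wtd F × Wtd F} {f g : X ⟶ Y} (η : f ⟶ g) : p₁ f ⟶ p₁ g :=
  (η.1, η.2)

/-- The tensor product of weighted 1-cells. The weight of `f ⊗ g` is the product of the weights,
divided by the value of the naturality square at `f` and `g` of the comparison of tensor products of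
`Φ`: this makes the value of 2-cells multiplicative for the tensor product. -/
def tensor : (Wtd Φ.F × Wtd Φ.F) ⥤ᵖ Wtd Φ.F where
  obj X := ⟨D.T.obj (X.1.val, X.2.val)⟩
  map f := ⟨D.T.map (p₁ f), (BB.val (Φ.χnat f.1.cell f.2.cell).hom)⁻¹ * (f.1.wt * f.2.wt)⟩
  map₂ η := D.T.map₂ (p₂ η)
  mapId X := ofIso (D.T.mapId (X.1.val, X.2.val))
  mapComp f g := ofIso (D.T.mapComp (p₁ f) (p₁ g))
  map₂_id f := D.T.map₂_id (p₁ f)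
  map₂_comp η θ := D.T.map₂_comp (p₂ η) (p₂ θ)
  map₂_whisker_left f _ _ η := D.T.map₂_whisker_left (p₁ f) (p₂ η)
  map₂_whisker_right η h := D.T.map₂_whisker_right (p₂ η) (p₁ h)
  map₂_associator f g h := D.T.map₂_associator (p₁ f) (p₁ g) (p₁ h)
  map₂_left_unitor f := D.T.map₂_left_unitor (p₁ f)
  map₂_right_unitor f := D.T.map₂_right_unitor (p₁ f)

/-- The triple of underlying 1-cells. -/
abbrev t₁ {F : A ⥤ᵖ BB H} {X Y : (Wtd F × Wtd F) × Wtd F} (f : X ⟶ Y) :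
    ((X.1.1.val, X.1.2.val), X.2.val) ⟶ ((Y.1.1.val, Y.1.2.val), Y.2.val) := (p₁ f.1, f.2.cell)

/-- The triple of underlying 2-cells. -/
abbrev t₂ {F : A ⥤ᵖ BB H} {X Y : (Wtd F × Wtd F) × Wtd F} {f g : X ⟶ Y} (η : f ⟶ g) :
    t₁ f ⟶ t₁ g := (p₂ η.1, η.2)

/-- The monoidal structure on the bicategory of weighted 1-cells. The associator and the unitors
have as weights the inverses of the values of the corresponding structure squares of `Φ`: by the
axioms for `Φ` the structure 2-cells then have value `1`. -/
def mon : MonData (Wtd Φ.F) where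
  T := tensor D Φ
  I := ⟨D.I⟩
  as :=
    { app := fun X => ⟨D.α X.1.1.val X.1.2.val X.2.val,
        (BB.val (Φ.om X.1.1.val X.1.2.val X.2.val).hom)⁻¹⟩
      naturality := fun f => ofIso (D.αnat f.1.1.cell f.1.2.cell f.2.cell)
      naturality_naturality := fun η => D.as.naturality_naturality (t₂ η)
      naturality_id := fun X => D.as.naturality_id ((X.1.1.val, X.1.2.val), X.2.val)
      naturality_comp := fun f g => D.as.naturality_comp (t₁ f) (t₁ g) }
  lu :=
    { app := fun X => ⟨D.l X.val, (BB.val (Φ.ga X.val).hom)⁻¹⟩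
      naturality := fun f => ofIso (D.lnat f.cell)
      naturality_naturality := fun {_ _ f g} η =>
        D.lu.naturality_naturality (f := f.cell) (g := g.cell) η
      naturality_id := fun X => D.lu.naturality_id X.val
      naturality_comp := fun f g => D.lu.naturality_comp f.cell g.cell }
  ru :=
    { app := fun X => ⟨D.r X.val, (BB.val (Φ.de X.val).hom)⁻¹⟩
      naturality := fun f => ofIso (D.rnat f.cell)
      naturality_naturality := fun {_ _ f g} η =>
        D.ru.naturality_naturality (f := f.cell) (g := g.cell) η
      naturality_id := fun X => D.ru.naturality_id X.val
      naturality_comp := fun f g => D.ru.naturality_comp f.cell g.cell }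
  pent X Y Z W := ofIso (D.π X.val Y.val Z.val W.val)
  mid X Y := ofIso (D.μ X.val Y.val)
  left X Y := ofIso (D.lam X.val Y.val)
  right X Y := ofIso (D.rho X.val Y.val)

/-- The tautological valuation of `B²H`. -/
def _root_.MonBicat.BB.strictVal (H : Type u) [CommGroup H] : StrictVal (BB.mon H) H where
  n η := BB.val η
  bij _ _ := Function.bijective_id
  comp _ _ := rfl
  whiskerLeft _ _ _ _ := rfl
  whiskerRight _ _ := rfl
  associator _ _ _ := rfl
  leftUnitor _ := rfl
  rightUnitor _ := rfl
  map₂ _ := rfl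
  mapComp _ _ := rfl
  mapId _ := rfl
  αnat _ _ _ := rfl
  lnat _ := rfl
  rnat _ := rfl
  π _ _ _ _ := rfl
  μ _ _ := rfl

open StrictVal

variable {D Φ}

theorem has_mapSq {a b c d : A} {f : a ⟶ b} {g : c ⟶ d} {u : a ⟶ c} {v : b ⟶ d}
    (Q : Sq f g u v) : (BB.strictVal H).Has (mapSq F Q).hom
      ((BB.val (F.mapComp f v).hom)⁻¹ * (BB.val (F.map₂ Q.hom) * BB.val (F.mapComp u g).hom)) :=
  Has.trans (.symm (.mk _)) (Has.trans (η := F.map₂Iso Q) (.mk _) (.mk _))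

theorem has_map32 {a b c d e : A} {f : a ⟶ b} {g : b ⟶ c} {h : c ⟶ d} {k : a ⟶ e}
    {l : e ⟶ d} (η : f ≫ g ≫ h ≅ k ≫ l) : (BB.strictVal H).Has (map32 F η).hom
      ((BB.val (F.mapComp g h).hom)⁻¹ * ((BB.val (F.mapComp f (g ≫ h)).hom)⁻¹ *
        (BB.val (F.map₂ η.hom) * BB.val (F.mapComp k l).hom))) :=
  Has.trans (.wlIso (.symm (.mk _))) (.trans (.symm (.mk _))
    (Has.trans (η := F.map₂Iso η) (.mk _) (.mk _)))

theorem has_map21 {a b c : A} {f : a ⟶ b} {g : b ⟶ c} {h : a ⟶ c} (η : f ≫ g ≅ h) :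
    (BB.strictVal H).Has (map21 F η).hom
      ((BB.val (F.mapComp f g).hom)⁻¹ * BB.val (F.map₂ η.hom)) :=
  Has.trans (η := (F.mapComp f g).symm) (θ := F.map₂Iso η) (.symm (.mk _)) (.mk _)

theorem has_idsq (a : A) : (BB.strictVal H).Has (Φ.idsq a).hom
    (BB.val (Φ.F.mapId a).hom)⁻¹ := Has.wlIso (.symm (.mk _))

theorem has_ιsq : (BB.strictVal H).Has Φ.ιsq.hom (BB.val (Φ.F.mapId D.I).hom)⁻¹ :=
  (Has.trans (.lu _) (.trans (.symm (.ru _)) (.wlIso (.symm (.mk _))))).of (by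
    simp only [inv_one, one_mul]; rfl)

theorem n_map₂ {X Y : Wtd Φ.F × Wtd Φ.F} {f g : X ⟶ Y} (η : f ⟶ g) :
    n ((tensor D Φ).map₂ η) = n η.1 * n η.2 := by
  have := Has.eq (V := BB.strictVal H) (.comp (.wr (.map₂ (.mk _) (.mk _))) (.mk _))
    (.comp (.mk _) (.wl (.mk _))) (Φ.χt.naturality_naturality (p₂ η))
  have aux {a b x y p q p' q' v : H} (h : a * b * y = x * v) :
      (x⁻¹ * (p * q))⁻¹ * v * (y⁻¹ * (p' * q')) = (p⁻¹ * a * p') * (q⁻¹ * b * q') := by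
    have h := congrArg Additive.ofMul h
    apply Additive.ofMul.injective
    simp only [ofMul_mul, ofMul_inv] at h ⊢
    linear_combination (norm := abel) -h
  exact aux this

theorem n_mapComp {X Y Z : Wtd Φ.F × Wtd Φ.F} (f : X ⟶ Y) (g : Y ⟶ Z) :
    n ((tensor D Φ).mapComp f g).hom = 1 := by
  have := Has.eq (V := BB.strictVal H) (.comp (.mk _) (.wl (.comp (.mk _) (.mk _))))
    (.comp (.wr (.comp (.map₂ (.mk _) (.mk _)) .tcomp)) (.comp (.as _ _ _)
      (.comp (.wl (.mk _)) (.comp (.inv (.as _ _ _)) (.comp (.wr (.mk _)) (.as _ _ _))))))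
    (Φ.χt.naturality_comp (p₁ f) (p₁ g))
  simp only [mul_one, one_mul, inv_one] at this
  have aux {x v c c1 c2 xf xg p q p' q' : H} (h : x * (v * c) = c1 * c2 * (xg * xf)) :
      (x⁻¹ * ((c1 * (p * q)) * (c2 * (p' * q'))))⁻¹ * v *
        (c * ((xf⁻¹ * (p * p')) * (xg⁻¹ * (q * q')))) = 1 := by
    have h := congrArg Additive.ofMul h
    apply Additive.ofMul.injective
    simp only [ofMul_mul, ofMul_inv, ofMul_one] at h ⊢
    linear_combination (norm := abel) h
  exact aux this

theorem n_mapId (X : Wtd Φ.F × Wtd Φ.F) : n ((tensor D Φ).mapId X).hom = 1 := by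
  have := Has.eq (V := BB.strictVal H) (.comp (.mk _) (.wl (.comp (.mk _) (.mk _))))
    (.comp (.wr (.comp (.map₂ (.mk _) (.mk _)) (.tid _ _)))
      (.comp (.lu _) (.inv (.ru _)))) (Φ.χt.naturality_id (X.1.val, X.2.val))
  simp only [mul_one, inv_one] at this
  have aux {x v d d1 d2 : H} (h : x * (v * d) = d1 * d2) :
      (x⁻¹ * (d1 * d2))⁻¹ * v * d = 1 := by
    rw [← h]; simp [mul_comm]
  exact aux this

variable (hΦ : Φ.IsMonoidal)
include hΦ

theorem n_αnat {a b c a' b' c' : Wtd Φ.F} (f : a ⟶ a') (g : b ⟶ b') (h : c ⟶ c') :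
    n ((mon D Φ).αnat f g h).hom = 1 := by
  have := Has.eq (V := BB.strictVal H) (.comp (.wl (.mk _)) (.vcomp (.vcomp (.tsq (.mk _) (.idV _))
    (.mk _)) (has_mapSq _))) (.comp (.vcomp (.αnat _ _ _) (.vcomp (.tsq (.idV _) (.mk _)) (.mk _)))
    (.wr (.mk _))) (hΦ.ω_nat f.cell g.cell h.cell)
  simp only [mul_one, one_mul] at this
  have aux {o o' x1 x2 x3 x4 c c' v p q r : H}
      (h : o' * (x1 * x2 * (c⁻¹ * (v * c'))) = x3 * x4 * o) :
      (c * ((x2⁻¹ * ((x1⁻¹ * (p * q)) * r)) * o'⁻¹))⁻¹ * v *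
        (c' * (o⁻¹ * (x4⁻¹ * (p * (x3⁻¹ * (q * r)))))) = 1 := by
    have h := congrArg Additive.ofMul h
    apply Additive.ofMul.injective
    simp only [ofMul_mul, ofMul_inv, ofMul_one] at h ⊢
    linear_combination (norm := abel) h
  exact aux this

theorem n_lnat {a a' : Wtd Φ.F} (f : a ⟶ a') : n ((mon D Φ).lnat f).hom = 1 := by
  have := Has.eq (V := BB.strictVal H) (.comp (.wl (.mk _)) (.vcomp (.vcomp (.tsq has_ιsq (.idV _))
    (.mk _)) (has_mapSq _))) (.comp (.vcomp (.lnat _) (.idV _)) (.wr (.mk _))) (hΦ.γ_nat f.cell)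
  simp only [mul_one, one_mul] at this
  have aux {o o' x d c c' v p : H} (h : o' * (d⁻¹ * x * (c⁻¹ * (v * c'))) = o) :
      (c * ((x⁻¹ * (d * p)) * o'⁻¹))⁻¹ * v * (c' * (o⁻¹ * p)) = 1 := by
    have h := congrArg Additive.ofMul h
    apply Additive.ofMul.injective
    simp only [ofMul_mul, ofMul_inv, ofMul_one] at h ⊢
    linear_combination (norm := abel) h
  exact aux this

theorem n_rnat {a a' : Wtd Φ.F} (f : a ⟶ a') : n ((mon D Φ).rnat f).hom = 1 := by
  have := Has.eq (V := BB.strictVal H) (.comp (.wl (.mk _)) (.vcomp (.vcomp (.tsq (.idV _) has_ιsq)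
    (.mk _)) (has_mapSq _))) (.comp (.vcomp (.rnat _) (.idV _)) (.wr (.mk _))) (hΦ.δ_nat f.cell)
  simp only [mul_one, one_mul] at this
  have aux {o o' x d c c' v p : H} (h : o' * (d⁻¹ * x * (c⁻¹ * (v * c'))) = o) :
      (c * ((x⁻¹ * (p * d)) * o'⁻¹))⁻¹ * v * (c' * (o⁻¹ * p)) = 1 := by
    have h := congrArg Additive.ofMul h
    apply Additive.ofMul.injective
    simp only [ofMul_mul, ofMul_inv, ofMul_one] at h ⊢
    linear_combination (norm := abel) h
  exact aux this

theorem n_π (a b c d : Wtd Φ.F) : n ((mon D Φ).π a b c d).hom = 1 := by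
  have := Has.eq (V := BB.strictVal H) (.comp (.hcomp
      (.adj (.trans (.symm (.as _ _ _)) (.wrIso (.symm (.rcomp _ _))))
        (.vcomp (.tsq (.mk _) (has_idsq d.val)) (.mk _))
        (.trans (.symm (.as _ _ _)) (.wrIso (.symm (.rcomp _ _)))))
      (.hcomp (.vcomp (.symm (.αnat _ _ _)) (.mk _))
        (.adj (.trans (.symm (.as _ _ _)) (.wrIso (.symm (.lcomp _ _))))
          (.vcomp (.tsq (has_idsq a.val) (.mk _)) (.mk _))
          (.trans (.symm (.as _ _ _)) (.wrIso (.symm (.lcomp _ _)))))))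
      (.wl (has_map32 _)))
    (.comp (.wr (.π _ _ _ _)) (.hcomp
      (.adj (.refl _) (.vcomp (.symm (.αnat _ _ _)) (.mk _))
        (.trans (.wrIso (.trans (.tiso (.symm (.ru _)) (.trans (.symm (.lu _))
          (.wrIso (.symm (.tid _ _))))) .tcomp)) (.as _ _ _)))
      (.adj (.trans (.wrIso (.trans (.tiso (.trans (.symm (.lu _))
          (.wrIso (.symm (.tid _ _)))) (.symm (.ru _))) .tcomp)) (.as _ _ _))
        (.vcomp (.symm (.αnat _ _ _)) (.mk _)) (.refl _))))
    (hΦ.assoc a.val b.val c.val d.val)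
  simp only [mul_one, one_mul, inv_one] at this
  have aux {c1 c2 c3 x1 x2 o1 o2 o3 o4 o5 d1 d2 v : H}
      (h : o1 * d2⁻¹ * x1 * (o2 * (d1⁻¹ * o3 * x2)) * (c2⁻¹ * (c1⁻¹ * (v * c3))) = o4 * o5) :
      (c1 * ((x1⁻¹ * (o1⁻¹ * d2)) * (c2 * (o2⁻¹ * (x2⁻¹ * (d1 * o3⁻¹))))))⁻¹ * v *
        (c3 * (o4⁻¹ * o5⁻¹)) = 1 := by
    have h := congrArg Additive.ofMul h
    apply Additive.ofMul.injective
    simp only [ofMul_mul, ofMul_inv, ofMul_one] at h ⊢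
    linear_combination (norm := abel) h
  exact aux this

theorem n_μ (a b : Wtd Φ.F) : n ((mon D Φ).μ a b).hom = 1 := by
  have := Has.eq (V := BB.strictVal H) (.comp (.hcomp (.vcomp (.symm (.αnat _ _ _)) (.mk _))
      (.adj (.trans (.symm (.as _ _ _)) (.wrIso (.symm (.lcomp _ _))))
        (.vcomp (.tsq (has_idsq a.val) (.mk _)) (.mk _))
        (.trans (.symm (.lu _)) (.wrIso (.symm (.tid _ _)))))) (.wl (has_map21 _)))
    (.comp (.wr (.μ _ _)) (.adj (.trans (.symm (.as _ _ _)) (.wrIso (.symm (.rcomp _ _))))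
        (.vcomp (.tsq (.mk _) (has_idsq b.val)) (.mk _))
        (.trans (.symm (.lu _)) (.wrIso (.symm (.tid _ _)))))) (hΦ.unit a.val b.val)
  simp only [mul_one, one_mul, inv_one] at this
  have aux {c v x1 x2 o g d d1 d2 : H}
      (h : o * (d1⁻¹ * g * x1) * (c⁻¹ * v) = d * d2⁻¹ * x2) :
      (c * (o⁻¹ * (x1⁻¹ * (d1 * g⁻¹))))⁻¹ * v * (x2⁻¹ * (d⁻¹ * d2)) = 1 := by
    have h := congrArg Additive.ofMul h
    apply Additive.ofMul.injective
    simp only [ofMul_mul, ofMul_inv, ofMul_one] at h ⊢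
    linear_combination (norm := abel) h
  exact aux this

/-- If `Φ` is bijective on 2-cells, the value `Wtd.n` is a valuation of the monoidal bicategory of
weighted 1-cells. -/
def strictVal (hbij : ∀ {x y : A} (f g : x ⟶ y), Function.Bijective fun η : f ⟶ g => Φ.F.map₂ η) :
    StrictVal (mon D Φ) H where
  n := n
  bij := n_bijective hbij
  comp := n_comp
  whiskerLeft := n_whiskerLeft
  whiskerRight := n_whiskerRight
  associator := n_associator
  leftUnitor := n_leftUnitor
  rightUnitor := n_rightUnitor
  map₂ := n_map₂
  mapComp := n_mapComp
  mapId := n_mapId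
  αnat := n_αnat hΦ
  lnat := n_lnat hΦ
  rnat := n_rnat hΦ
  π := n_π hΦ
  μ := n_μ hΦ

end Monoidal

end Wtd

/-! ### Lifting to weighted 1-cells and descending -/

/-- A 1-cell is an equivalence as soon as there is a 1-cell in the other direction, because all
parallel 1-cells are isomorphic. -/
theorem StrictVal.isEquiv₁ {A : Type u₁} [Bicategory.{w₁, v₁} A] {N : MonData A} {H : Type u}
    [CommGroup H] (V : StrictVal N H) (hA : ∀ a b : A, Nonempty (a ⟶ b)) {a b : A} (f : a ⟶ b) :
    IsEquiv₁ f :=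
  ⟨Equivalence.mkOfAdjointifyCounit (V.cell (𝟙 a) (f ≫ (hA b a).some) 1)
    (V.cell ((hA b a).some ≫ f) (𝟙 b) 1), rfl⟩

namespace Wtd

variable {A : Type u₁} [Bicategory.{w₁, v₁} A] {H : Type u} [CommGroup H] {N : MonData A}
  {Φ : MonFunData N (BB.mon H)} {D : Type u₂} [Bicategory.{w₂, v₂} D] {M : MonData D}

section Down

variable {F : A ⥤ᵖ BB H}

/-- `Down η θ` says that the 2-cell `η` between weighted 1-cells is the 2-cell `θ` between the
underlying 1-cells. -/
def Down {a b : Wtd F} {f g : a ⟶ b} (η : f ⟶ g) (θ : f.cell ⟶ g.cell) : Prop := η = θ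

/-- `DownI i j` says that the isomorphism `i` between weighted 1-cells is the isomorphism `j`
between the underlying 1-cells. -/
def DownI {a b : Wtd F} {f g : a ⟶ b} (i : f ≅ g) (j : f.cell ≅ g.cell) : Prop := toIso i = j

theorem Down.eq {a b : Wtd F} {f g : a ⟶ b} {η θ : f ⟶ g} {η' θ' : f.cell ⟶ g.cell}
    (e : η' = θ') (x : Down η η') (y : Down θ θ') : η = θ := x.trans (e.trans y.symm)

theorem Down.eq' {a b : Wtd F} {f g : a ⟶ b} {η θ : f ⟶ g} {η' θ' : f.cell ⟶ g.cell}
    (e : η = θ) (x : Down η η') (y : Down θ θ') : η' = θ' := x.symm.trans (e.trans y)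

theorem Down.comp {a b : Wtd F} {f g h : a ⟶ b} {η : f ⟶ g} {θ : g ⟶ h}
    {η' : f.cell ⟶ g.cell} {θ' : g.cell ⟶ h.cell} (x : Down η η') (y : Down θ θ') :
    Down (η ≫ θ) (η' ≫ θ') := congrArg₂ CategoryStruct.comp x y

theorem Down.wl {a b c : Wtd F} {f : a ⟶ b} {g h : b ⟶ c} {η : g ≅ h} {η' : g.cell ≅ h.cell}
    (x : DownI η η') : Down (f ◁ η.hom) (f.cell ◁ η'.hom) :=
  congrArg (fun i => f.cell ◁ Iso.hom i) x

theorem Down.wr {a b c : Wtd F} {f g : a ⟶ b} {h : b ⟶ c} {η : f ≅ g} {η' : f.cell ≅ g.cell}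
    (x : DownI η η') : Down (η.hom ▷ h) (η'.hom ▷ h.cell) :=
  congrArg (fun i => Iso.hom i ▷ h.cell) x

theorem Down.hom {a b : Wtd F} {f g : a ⟶ b} {i : f ≅ g} {j : f.cell ≅ g.cell}
    (x : DownI i j) : Down i.hom j.hom := congrArg Iso.hom x

namespace DownI

theorem symm {a b : Wtd F} {f g : a ⟶ b} {i : f ≅ g} {j : f.cell ≅ g.cell} (x : DownI i j) :
    DownI i.symm j.symm := congrArg Iso.symm x

theorem trans {a b : Wtd F} {f g h : a ⟶ b} {i : f ≅ g} {i' : g ≅ h} {j : f.cell ≅ g.cell}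
    {j' : g.cell ≅ h.cell} (x : DownI i j) (y : DownI i' j') : DownI (i ≪≫ i') (j ≪≫ j') :=
  congrArg₂ Iso.trans x y

theorem wlIso {a b c : Wtd F} {f : a ⟶ b} {g h : b ⟶ c} {η : g ≅ h} {η' : g.cell ≅ h.cell}
    (x : DownI η η') : DownI (whiskerLeftIso f η) (whiskerLeftIso f.cell η') :=
  congrArg (fun i => whiskerLeftIso f.cell i) x

theorem wrIso {a b c : Wtd F} {f g : a ⟶ b} {h : b ⟶ c} {η : f ≅ g} {η' : f.cell ≅ g.cell}
    (x : DownI η η') : DownI (whiskerRightIso η h) (whiskerRightIso η' h.cell) :=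
  congrArg (fun i => whiskerRightIso i h.cell) x

theorem vcomp {a b c d e k : Wtd F} {f : a ⟶ b} {g : c ⟶ d} {h : e ⟶ k} {u : a ⟶ c} {v : b ⟶ d}
    {u' : c ⟶ e} {v' : d ⟶ k} {Q : Sq f g u v} {R : Sq g h u' v'}
    {Q' : Sq f.cell g.cell u.cell v.cell} {R' : Sq g.cell h.cell u'.cell v'.cell}
    (x : DownI Q Q') (y : DownI R R') : DownI (MonBicat.vcomp Q R) (MonBicat.vcomp Q' R') :=
  congrArg₂ (fun (i : Sq f.cell g.cell u.cell v.cell) (j : Sq g.cell h.cell u'.cell v'.cell) =>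
    MonBicat.vcomp i j) x y

theorem hcomp {a b c d e k : Wtd F} {f : a ⟶ b} {g : c ⟶ d} {u : a ⟶ c} {v : b ⟶ d} {f' : b ⟶ e}
    {g' : d ⟶ k} {w : e ⟶ k} {Q : Sq f g u v} {R : Sq f' g' v w}
    {Q' : Sq f.cell g.cell u.cell v.cell} {R' : Sq f'.cell g'.cell v.cell w.cell}
    (x : DownI Q Q') (y : DownI R R') : DownI (MonBicat.hcomp Q R) (MonBicat.hcomp Q' R') :=
  congrArg₂ (fun (i : Sq f.cell g.cell u.cell v.cell) (j : Sq f'.cell g'.cell v.cell w.cell) =>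
    MonBicat.hcomp i j) x y

theorem adj {a b c d : Wtd F} {f : a ⟶ b} {g : c ⟶ d} {u u' : a ⟶ c} {v v' : b ⟶ d}
    {i : u' ≅ u} {Q : Sq f g u v} {j : v' ≅ v} {i' : u'.cell ≅ u.cell}
    {Q' : Sq f.cell g.cell u.cell v.cell} {j' : v'.cell ≅ v.cell}
    (x : DownI i i') (y : DownI Q Q') (z : DownI j j') :
    DownI (MonBicat.adj i Q j) (MonBicat.adj i' Q' j') := by
  subst x y z; rfl

theorem tiso {a b a' b' : Wtd Φ.F} {f f' : a ⟶ a'} {g g' : b ⟶ b'} {η : f ≅ f'} {θ : g ≅ g'}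
    {η' : f.cell ≅ f'.cell} {θ' : g.cell ≅ g'.cell} (x : DownI η η') (y : DownI θ θ') :
    DownI (MonBicat.tiso (mon N Φ).T η θ) (MonBicat.tiso N.T η' θ') := by
  subst x y; rfl

theorem tsq {a b c d a' b' c' d' : Wtd Φ.F} {f : a ⟶ b} {g : c ⟶ d} {u : a ⟶ c} {v : b ⟶ d}
    {f' : a' ⟶ b'} {g' : c' ⟶ d'} {u' : a' ⟶ c'} {v' : b' ⟶ d'} {Q : Sq f g u v}
    {R : Sq f' g' u' v'} {Q' : Sq f.cell g.cell u.cell v.cell}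
    {R' : Sq f'.cell g'.cell u'.cell v'.cell} (x : DownI Q Q') (y : DownI R R') :
    DownI (MonBicat.tsq (mon N Φ).T Q R) (MonBicat.tsq N.T Q' R') := by
  subst x y; rfl

end DownI

end Down

/-- A functor to `N`, with a weight for the image of each 1-cell, as a functor to the weighted
1-cells. The components of its transformations get weight `1`. -/
def lift (Φ : MonFunData N (BB.mon H)) (X : MonFunData M N) (t : ∀ {a b : D}, (a ⟶ b) → H) :
    MonFunData M (mon N Φ) where
  F :=
    { obj := fun a => ⟨X.F.obj a⟩
      map := fun f => ⟨X.F.map f, t f⟩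
      map₂ := fun η => X.F.map₂ η
      mapId := fun a => ofIso (X.F.mapId a)
      mapComp := fun f g => ofIso (X.F.mapComp f g)
      map₂_id := fun f => X.F.map₂_id f
      map₂_comp := fun η θ => X.F.map₂_comp η θ
      map₂_whisker_left := fun f _ _ η => X.F.map₂_whisker_left f η
      map₂_whisker_right := fun η f => X.F.map₂_whisker_right η f
      map₂_associator := fun f g h => X.F.map₂_associator f g h
      map₂_left_unitor := fun f => X.F.map₂_left_unitor f
      map₂_right_unitor := fun f => X.F.map₂_right_unitor f }
  χt :=
    { app := fun x => ⟨X.χt.app x, 1⟩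
      naturality := fun f => ofIso (X.χt.naturality f)
      naturality_naturality := fun η => X.χt.naturality_naturality η
      naturality_id := fun x => X.χt.naturality_id x
      naturality_comp := fun f g => X.χt.naturality_comp f g }
  ι := ⟨X.ι, 1⟩
  ω a b c := ofIso (X.ω a b c)
  γ a := ofIso (X.γ a)
  δ a := ofIso (X.δ a)

set_option maxHeartbeats 1000000 in
/-- The 2-cells of the weighted bicategory are those of `N`, and so are their pastings; the
derivations follow the two sides of each axiom down to the cells where `rfl` applies. -/
theorem lift_isMonoidal {X : MonFunData M N} (hX : X.IsMonoidal) (t : ∀ {a b : D}, (a ⟶ b) → H)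
    (hΦ : ∀ {a b : Wtd Φ.F} (f : a ⟶ b), IsEquiv₁ f) : (lift Φ X t).IsMonoidal where
  χ_equiv _ _ := hΦ _
  ι_equiv := hΦ _
  ω_nat f g h := Down.eq (hX.ω_nat f g h)
    (.comp (.wl rfl) (.hom (.vcomp (.vcomp (.tsq rfl rfl) rfl) rfl)))
    (.comp (.hom (.vcomp rfl (.vcomp (.tsq rfl rfl) rfl))) (.wr rfl))
  γ_nat f := Down.eq (hX.γ_nat f)
    (.comp (.wl rfl) (.hom (.vcomp (.vcomp (.tsq rfl rfl) rfl) rfl)))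
    (.comp (.hom (.vcomp rfl rfl)) (.wr rfl))
  δ_nat f := Down.eq (hX.δ_nat f)
    (.comp (.wl rfl) (.hom (.vcomp (.vcomp (.tsq rfl rfl) rfl) rfl)))
    (.comp (.hom (.vcomp rfl rfl)) (.wr rfl))
  assoc a b c d := Down.eq (hX.assoc a b c d)
    (.comp (.hom (.hcomp
      (.adj (.trans (.symm rfl) (.wrIso (.symm rfl))) (.vcomp (.tsq rfl (.wlIso (.symm rfl))) rfl)
        (.trans (.symm rfl) (.wrIso (.symm rfl))))
      (.hcomp (.vcomp (.symm rfl) rfl) (.adj (.trans (.symm rfl) (.wrIso (.symm rfl)))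
        (.vcomp (.tsq (.wlIso (.symm rfl)) rfl) rfl) (.trans (.symm rfl) (.wrIso (.symm rfl)))))))
      (.wl (.trans (.wlIso (.symm rfl)) (.trans (.symm rfl) (.trans rfl rfl)))))
    (.comp (.wr rfl) (.hom (.hcomp (.adj rfl (.vcomp (.symm rfl) rfl)
        (.trans (.wrIso (.trans (.tiso (.symm rfl) (.trans (.symm rfl) (.wrIso (.symm rfl)))) rfl))
          rfl))
      (.adj (.trans (.wrIso (.trans (.tiso (.trans (.symm rfl) (.wrIso (.symm rfl)))
        (.symm rfl)) rfl)) rfl) (.vcomp (.symm rfl) rfl) rfl))))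
  unit a b := Down.eq (hX.unit a b)
    (.comp (.hom (.hcomp (.vcomp (.symm rfl) rfl)
      (.adj rfl (.vcomp (.tsq rfl rfl) rfl) rfl))) (.wl rfl))
    (.comp (.wr rfl) (.hom (.adj rfl (.vcomp (.tsq rfl rfl) rfl) rfl)))

/-- A transformation between functors to weighted 1-cells, with the weights of its components
forgotten. -/
def descend {X : MonFunData M N} {t : ∀ {a b : D}, (a ⟶ b) → H} {i : N.r N.I ≅ N.l N.I}
    (θ : MonTransData (lift Φ X t) (MonFunData.trivial M (mon N Φ) (ofIso i))) :
    MonTransData X (MonFunData.trivial M N i) where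
  t :=
    { app := fun a => (θ.app a).cell
      naturality := fun f => toIso (θ.nat f)
      naturality_naturality := fun η => θ.t.naturality_naturality η
      naturality_id := fun x => θ.t.naturality_id x
      naturality_comp := fun f g => θ.t.naturality_comp f g }
  P a b := toIso (θ.P a b)
  U := toIso θ.U

theorem descend_isMonoidal {X : MonFunData M N} {t : ∀ {a b : D}, (a ⟶ b) → H}
    {i : N.r N.I ≅ N.l N.I}
    {θ : MonTransData (lift Φ X t) (MonFunData.trivial M (mon N Φ) (ofIso i))} (h : θ.IsMonoidal) :
    (descend θ).IsMonoidal where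
  P_nat f g := Down.eq' (h.P_nat f g)
    (.comp (.wl rfl) (.hom (.vcomp (.tsq rfl rfl) rfl)))
    (.comp (.hom (.vcomp rfl rfl)) (.wr rfl))
  assoc a b c := Down.eq' (h.assoc a b c)
    (.comp (.hom (.hcomp (.symm rfl) (.hcomp (.tsq rfl rfl) rfl))) (.wl rfl))
    (.comp (.wr rfl) (.hom (.hcomp (.hcomp (.tsq rfl rfl) rfl) rfl)))
  unit_left a := Down.eq' (h.unit_left a)
    (.comp (.hom (.hcomp (.symm rfl) rfl)) (.wl rfl))
    (.comp (.wr rfl) (.hom (.hcomp (.hcomp (.tsq rfl rfl) rfl) rfl)))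
  unit_right a := Down.eq' (h.unit_right a)
    (.comp (.hom (.hcomp (.symm rfl) rfl)) (.wl rfl))
    (.comp (.wr rfl) (.hom (.hcomp (.hcomp (.tsq rfl rfl) rfl) rfl)))

end Wtd

/-! ### Left 2-unitor and unitors of the unit object -/

namespace MonData

variable {A : Type u₁} [Bicategory.{w₁, v₁} A] (N : MonData A)

/-- The pasting of `𝟙 I ⊗ λ`, for the left 2-unitor `λ` at the unit object `I`, with a naturality
square of the associator and a middle 2-unitor tensored with `I`. -/
def lamLeft : (tmap N.T (N.α N.I N.I N.I) (𝟙 N.I) ≫ N.α N.I (tobj N.T N.I N.I) N.I) ≫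
    tmap N.T (𝟙 N.I) (N.α N.I N.I N.I ≫ N.l (tobj N.T N.I N.I)) ⟶
    tmap N.T (tmap N.T (N.r N.I) (𝟙 N.I)) (𝟙 N.I) ≫ N.α N.I N.I N.I :=
  _ ◁ (tiso N.T (Iso.refl (𝟙 N.I)) (N.lam N.I N.I)).hom ≫ (α_ _ _ _).hom ≫
    _ ◁ (N.αnat (𝟙 N.I) (N.l N.I) (𝟙 N.I)).inv ≫ (α_ _ _ _).inv ≫
      (tr21 N.T N.I (N.μ N.I N.I)).hom ▷ _

/-- The other pasting with the boundary of `lamLeft`, made of the pentagonator, a middle 2-unitor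
and a naturality square of the associator, at unit objects. -/
def lamRight : (tmap N.T (N.α N.I N.I N.I) (𝟙 N.I) ≫ N.α N.I (tobj N.T N.I N.I) N.I) ≫
    tmap N.T (𝟙 N.I) (N.α N.I N.I N.I ≫ N.l (tobj N.T N.I N.I)) ⟶
    tmap N.T (tmap N.T (N.r N.I) (𝟙 N.I)) (𝟙 N.I) ≫ N.α N.I N.I N.I :=
  _ ◁ (lcomp N.T N.I (N.α N.I N.I N.I) (N.l (tobj N.T N.I N.I))).hom ≫ (α_ _ _ _).inv ≫
    (α_ _ _ _).hom ▷ _ ≫ (N.π N.I N.I N.I N.I).hom ▷ _ ≫ (α_ _ _ _).hom ≫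
      _ ◁ (N.μ N.I (tobj N.T N.I N.I)).hom ≫ (N.αnat₁ (N.r N.I) N.I N.I).inv

/-- The left 2-unitor at the unit object, whiskered by the left unitor. -/
def unitorLeft : (N.α N.I N.I N.I ≫ N.l (tobj N.T N.I N.I)) ≫ N.l N.I ⟶
    tmap N.T (N.l N.I) (𝟙 N.I) ≫ N.l N.I := (N.lam N.I N.I).hom ▷ _

/-- The pasting with the boundary of `unitorLeft` of a naturality square of the left unitor, a
middle 2-unitor, and an identification `i` of the two unitors of the unit object. -/
def unitorRight (i : N.r N.I ≅ N.l N.I) : (N.α N.I N.I N.I ≫ N.l (tobj N.T N.I N.I)) ≫ N.l N.I ⟶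
    tmap N.T (N.l N.I) (𝟙 N.I) ≫ N.l N.I :=
  (α_ _ _ _).hom ≫ _ ◁ (N.lnat (N.l N.I)).inv ≫ (α_ _ _ _).inv ≫ (N.μ N.I N.I).hom ▷ _ ≫
    (tiso N.T i (Iso.refl (𝟙 N.I))).hom ▷ _

end MonData

namespace StrictVal

variable {A : Type u₁} [Bicategory.{w₁, v₁} A] {N : MonData A} {H : Type u} [CommGroup H]
  {V : StrictVal N H}

/-- In the equation `lamLeft = lamRight` every cell but the left 2-unitor at the unit object has
value `1`. -/
theorem has_lam (h : N.lamLeft = N.lamRight) : V.Has (N.lam N.I N.I).hom 1 := by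
  have := Has.eq (V := V)
    (.comp (.wl (.tiso (.refl _) (.mk _))) (.comp (.as _ _ _) (.comp (.wl (.inv (.αnat _ _ _)))
      (.comp (.inv (.as _ _ _)) (.wr (.trans (.symm (.rcomp _ _)) (.tiso (.μ _ _) (.refl _))))))))
    (.comp (.wl (.lcomp _ _)) (.comp (.inv (.as _ _ _)) (.comp (.wr (.as _ _ _))
      (.comp (.wr (.π _ _ _ _)) (.comp (.as _ _ _) (.comp (.wl (.μ _ _))
        (.inv (.trans (.αnat _ _ _) (.wlIso (.tiso (.refl _) (.tid _ _)))))))))))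
    h
  simp only [mul_one, one_mul, inv_one] at this
  exact this

/-- In the equation `unitorLeft = unitorRight i` every cell but `i` has value `1`. -/
theorem has_unitor (hl : V.Has (N.lam N.I N.I).hom 1) {i : N.r N.I ≅ N.l N.I}
    (h : N.unitorLeft = N.unitorRight i) : V.Has i.hom 1 := by
  have := Has.eq (V := V) (.wr hl) (.comp (.as _ _ _) (.comp (.wl (.inv (.lnat _)))
      (.comp (.inv (.as _ _ _)) (.comp (.wr (.μ _ _)) (.wr (.tiso (.mk _) (.refl _))))))) h
  simp only [mul_one, one_mul, inv_one] at this
  exact this.symm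

end StrictVal

/-! ### Canonical 2-cells between trivialised endomorphisms -/

section Canonical

variable {B : Type u₁} [Bicategory.{w₁, v₁} B] {x : B}

/-- A 2-cell between endomorphisms `u` and `v` of an object is canonical, with respect to given
isomorphisms of `u` and `v` with the identity, if it is compatible with them. There is exactly one
such 2-cell, and pastings of canonical 2-cells are canonical. -/
def IsCan {u v : x ⟶ x} (j : u ≅ 𝟙 x) (k : v ≅ 𝟙 x) (η : u ⟶ v) : Prop := η ≫ k.hom = j.hom

namespace IsCan

variable {u v w u' v' w' : x ⟶ x} {j : u ≅ 𝟙 x} {k : v ≅ 𝟙 x} {l : w ≅ 𝟙 x}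
  {j' : u' ≅ 𝟙 x} {k' : v' ≅ 𝟙 x} {l' : w' ≅ 𝟙 x}

theorem unique {η θ : u ⟶ v} (p : IsCan j k η) (q : IsCan j k θ) : η = θ :=
  (cancel_mono k.hom).1 (p.trans q.symm)

theorem comp {η : u ⟶ v} {θ : v ⟶ w} (p : IsCan j k η) (q : IsCan k l θ) :
    IsCan j l (η ≫ θ) := by
  unfold IsCan at *; rw [Category.assoc, q, p]

theorem id (j : u ≅ 𝟙 x) : IsCan j j (𝟙 u) := Category.id_comp _

theorem inv {η : u ≅ v} (p : IsCan j k η.hom) : IsCan k j η.inv := by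
  unfold IsCan at *; rw [← p, Iso.inv_hom_id_assoc]

theorem wl (j : u ≅ 𝟙 x) {η : v ⟶ v'} (p : IsCan k k' η) :
    IsCan (triv j k) (triv j k') (u ◁ η) := by
  unfold IsCan triv at *
  simp only [Iso.trans_hom, whiskerRightIso_hom]
  rw [← p, whisker_exchange_assoc, id_whiskerLeft_assoc]
  simp

theorem wr {η : u ⟶ u'} (p : IsCan j j' η) (k : v ≅ 𝟙 x) :
    IsCan (triv j k) (triv j' k) (η ▷ v) := by
  unfold IsCan triv at *
  simp only [Iso.trans_hom, whiskerRightIso_hom]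
  rw [← p, comp_whiskerRight_assoc]

theorem as (j : u ≅ 𝟙 x) (k : v ≅ 𝟙 x) (l : w ≅ 𝟙 x) :
    IsCan (triv (triv j k) l) (triv j (triv k l)) (α_ u v w).hom := by
  unfold IsCan triv
  simp

theorem lu (j : u ≅ 𝟙 x) : IsCan (triv (Iso.refl (𝟙 x)) j) j (λ_ u).hom := by
  unfold IsCan triv
  simp

theorem ru (j : u ≅ 𝟙 x) : IsCan (triv j (Iso.refl (𝟙 x))) j (ρ_ u).hom := by
  unfold IsCan triv
  simp [unitors_equal]

theorem isoV {e : u ≅ v} (p : IsCan j k e.hom) :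
    IsCan (triv j (Iso.refl (𝟙 x))) (triv (Iso.refl (𝟙 x)) k) (MonBicat.isoV e).hom :=
  comp (ru j) (comp p (inv (lu k)))

end IsCan

end Canonical

/-! ### The unit object of the bicategory of endofunctors -/

section Endo

variable {B : Type u₁} [Bicategory.{w₁, v₁} B] (M : MonData B)

/-- The identification of the identity 1-cell with itself. -/
abbrev triv₁ (x : B) : 𝟙 x ≅ 𝟙 x := Iso.refl (𝟙 x)

/-- The identification of `𝟙 x ≫ 𝟙 x` with the identity 1-cell. -/
abbrev triv₂ (x : B) : 𝟙 x ≫ 𝟙 x ≅ 𝟙 x := triv (triv₁ x) (triv₁ x)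

theorem IsCan.ofTriv {x : B} {u v : x ⟶ x} {j : u ≅ 𝟙 x} {k k' : v ≅ 𝟙 x} (h : k' = k) :
    IsCan j k (j ≪≫ k'.symm).hom := by
  subst h; simp [IsCan]

theorem trivMap_id (x : B) : trivMap (Pseudofunctor.id B) (Iso.refl (𝟙 x)) = triv₁ x := by
  refine Iso.ext ?_
  change 𝟙 (𝟙 x) ≫ 𝟙 (𝟙 x) = 𝟙 (𝟙 x)
  simp

theorem trivMap_id_comp_id (x : B) :
    trivMap ((Pseudofunctor.id B).comp (Pseudofunctor.id B)) (Iso.refl (𝟙 x)) = triv₁ x := by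
  refine Iso.ext ?_
  change 𝟙 (𝟙 x) ≫ 𝟙 (𝟙 x) ≫ 𝟙 (𝟙 x) = 𝟙 (𝟙 x)
  simp

/-- The structure cells of the monoidal bicategory of endofunctors, at unit objects, have canonical
components; this lemma and those below cover the cells needed, starting with the left 2-unitor. -/
theorem can_left (x : B) : IsCan (triv₂ x) (triv₂ x)
    ((leftG (Pseudofunctor.id B) (Pseudofunctor.id B)).hom.as.app x) := by
  have h := trivMap_id_comp_id x
  exact IsCan.ofTriv (congrArg (fun i => triv i (triv₁ x)) h)

theorem can_mid (x : B) : IsCan (triv (triv₁ x) (triv₂ x)) (triv₂ x)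
    ((midG (Pseudofunctor.id B) (Pseudofunctor.id B)).hom.as.app x) := by
  have h := trivMap_id_comp_id x
  have h' := trivMap_id x
  exact Eq.mp (congrArg (fun i => IsCan (triv (triv₁ x) (triv i (triv₁ x))) (triv₂ x)
    ((midG (Pseudofunctor.id B) (Pseudofunctor.id B)).hom.as.app x)) h')
    (IsCan.ofTriv (congrArg (fun i => triv i (triv₁ x)) h))

variable {M} in
/-- The component at `x` of a 2-cell of the bicategory of monoidal endofunctors. -/
abbrev cellAt {X Y : MonFunData M M} {f g : X ⟶ Y} (m : f ⟶ g) (x : B) : f.t.app x ⟶ g.t.app x :=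
  Pseudofunctor.StrongTrans.Modification.app
    (Pseudofunctor.StrongTrans.Hom.as (η := f.t) (θ := g.t) m) x

variable {M} in
theorem cellAt_hom_inv {X Y : MonFunData M M} {f g : X ⟶ Y} (i : f ≅ g) (x : B) :
    cellAt i.hom x ≫ cellAt i.inv x = 𝟙 (f.t.app x) :=
  congrArg (fun m : f ⟶ f => cellAt m x) i.hom_inv_id

variable {M} in
theorem cellAt_eqToIso {X Y : MonFunData M M} {f g : X ⟶ Y} (h : f = g) (x : B) :
    cellAt (eqToIso h).hom x = eqToHom (congrArg (fun k : X ⟶ Y => MonTransData.app k x) h) := by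
  subst h; rfl

theorem can_unitors (x : B) : IsCan (triv₁ x) (triv₁ x)
    (cellAt (f := MonFunData.ruc (MonFunData.id M)) (g := MonFunData.luc (MonFunData.id M))
      (eqToIso (ruc_id M)).hom x) :=
  (congrArg (fun k => k ≫ 𝟙 (𝟙 x)) (cellAt_eqToIso (ruc_id M) x)).trans (Category.id_comp _)

/-- All components of both sides are canonical. -/
theorem endo_unitorLeft_eq : (endo M).unitorLeft = (endo M).unitorRight (eqToIso (ruc_id M)) := by
  apply Pseudofunctor.StrongTrans.homCategory.ext
  intro x
  refine IsCan.unique (j := triv (triv₂ x) (triv₁ x)) (k := triv (triv₂ x) (triv₁ x)) ?_ ?_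
  · exact .wr (can_left x) (triv₁ x)
  · have p : IsCan (triv₂ x) (triv₂ x)
        ((tiso (endo M).T (eqToIso (ruc_id M)) (Iso.refl (𝟙 (endo M).I))).hom.as.app x) := by
      exact IsCan.comp (.wr (.id (triv₁ x)) (triv₁ x)) (.wl (triv₁ x) (can_unitors M x))
    have q := IsCan.comp (.as (triv₁ x) (triv₁ x) (triv₁ x))
      (.comp (.wl (triv₁ x) (.inv (.isoV (.ru (triv₁ x)))))
      (.comp (.inv (.as (triv₁ x) (triv₂ x) (triv₁ x)))
      (.comp (.wr (can_mid x) (triv₁ x)) (.wr p (triv₁ x)))))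
    exact q

theorem IsCan.idV {x : B} {u : x ⟶ x} (j : u ≅ 𝟙 x) :
    IsCan (triv j (Iso.refl (𝟙 x))) (triv (Iso.refl (𝟙 x)) j) (MonBicat.idV u).hom :=
  .comp (.ru j) (.inv (.lu j))

theorem IsCan.paste {x : B} {f g fg s t g' k : x ⟶ x} {jf : f ≅ 𝟙 x} {jg : g ≅ 𝟙 x}
    {jfg : fg ≅ 𝟙 x} {js : s ≅ 𝟙 x} {jt : t ≅ 𝟙 x} {jg' : g' ≅ 𝟙 x}
    {i : fg ⟶ f ≫ g} {n : g ≫ t ⟶ s ≫ g'} (p : IsCan jfg (triv jf jg) i)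
    (q : IsCan (triv jg jt) (triv js jg') n) (jk : k ≅ 𝟙 x) :
    IsCan (triv jfg (triv jt jk)) (triv (triv jf js) (triv jg' jk)) (MonBicat.paste i n k) :=
  .comp (.wr p _) (.comp (.as _ _ _) (.comp
    (.wl jf (.comp (.inv (.as _ _ _)) (.comp (.wr q jk) (.as _ _ _)))) (.inv (.as _ _ _))))

theorem IsCan.inv' {x : B} {u v : x ⟶ x} {j : u ≅ 𝟙 x} {k : v ≅ 𝟙 x} {η : u ⟶ v} {θ : v ⟶ u}
    (p : IsCan j k η) (h : η ≫ θ = 𝟙 u) : IsCan k j θ := by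
  unfold IsCan at *
  have : IsIso η := by
    have : η = j.hom ≫ k.inv := by rw [← p]; simp
    rw [this]; infer_instance
  rw [← cancel_epi η, p, ← Category.assoc, h, Category.id_comp]

theorem can_asIso (x : B) : IsCan (triv (triv₁ x) (triv₂ x)) (triv (triv₂ x) (triv₁ x))
    (asIso (Pseudofunctor.id B) (𝟙 x) (𝟙 x) (𝟙 x)).hom :=
  .comp (.inv (.as (triv₁ x) (triv₁ x) (triv₁ x))) (.wr (.id (triv₂ x)) (triv₁ x))

theorem can_asIso' (x : B) : IsCan (triv (triv₁ x) (triv₂ x)) (triv (triv₂ x) (triv₁ x))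
    (asIso ((Pseudofunctor.id B).comp (Pseudofunctor.id B)) (𝟙 x) (𝟙 x) (𝟙 x)).hom :=
  .comp (.inv (.as (triv₁ x) (triv₁ x) (triv₁ x)))
    (.wr (.comp (.id (triv₂ x)) (.id (triv₂ x))) (triv₁ x))

theorem can_mid' (x : B) : IsCan (triv (triv₁ x) (triv₂ x)) (triv₂ x)
    ((midG (Pseudofunctor.id B)
      ((Pseudofunctor.id B).comp (Pseudofunctor.id B))).hom.as.app x) := by
  have h := trivMap_id_comp_id x
  have h' := trivMap_id x
  exact Eq.mp (congrArg (fun i => IsCan (triv (triv₁ x) (triv i (triv₁ x))) (triv₂ x)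
    ((midG (Pseudofunctor.id B)
      ((Pseudofunctor.id B).comp (Pseudofunctor.id B))).hom.as.app x)) h')
    (IsCan.ofTriv (congrArg (fun i => triv i (triv₁ x)) h))

theorem can_pent (x : B) : IsCan (triv (triv₂ x) (triv (triv₁ x) (triv₂ x))) (triv₂ x)
    ((pentG (Pseudofunctor.id B) (Pseudofunctor.id B) (Pseudofunctor.id B)
      (Pseudofunctor.id B)).hom.as.app x) := by
  have h : trivMap ((Pseudofunctor.id B).comp ((Pseudofunctor.id B).comp (Pseudofunctor.id B)))
      (Iso.refl (𝟙 x)) = triv₁ x := by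
    refine Iso.ext ?_
    change 𝟙 (𝟙 x) ≫ (𝟙 (𝟙 x) ≫ 𝟙 (𝟙 x) ≫ 𝟙 (𝟙 x)) = 𝟙 (𝟙 x)
    simp
  have h' := trivMap_id x
  have := IsCan.ofTriv (k := triv₂ x) (k' := triv₂ x) rfl
    (j := triv (triv (trivMap ((Pseudofunctor.id B).comp
      ((Pseudofunctor.id B).comp (Pseudofunctor.id B))) (Iso.refl (𝟙 x))) (triv₁ x))
      (triv (triv₁ x) (triv (trivMap (Pseudofunctor.id B) (Iso.refl (𝟙 x))) (triv₁ x))))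
  exact Eq.mp (congrArg₂ (fun i i' =>
    IsCan (triv (triv i (triv₁ x)) (triv (triv₁ x) (triv i' (triv₁ x)))) (triv₂ x)
      ((pentG (Pseudofunctor.id B) (Pseudofunctor.id B) (Pseudofunctor.id B)
        (Pseudofunctor.id B)).hom.as.app x)) h h') this

theorem can_rcomp (x : B) :
    IsCan (triv (triv₁ x) (triv (triv₁ x) (triv₂ x))) (triv (triv₂ x) (triv (triv₁ x) (triv₂ x)))
    (cellAt (rcomp (endo M).T (endo M).I ((endo M).α (endo M).I (endo M).I (endo M).I)
        (tmap (endo M).T (𝟙 (endo M).I) ((endo M).l (endo M).I))).hom x) :=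
  IsCan.comp (.comp (.wr (.inv (.lu (triv₁ x))) (triv (triv₁ x) (triv₂ x)))
    (.wl (triv₂ x) (.id (triv (triv₁ x) (triv₂ x)))))
    (.paste (.comp (.id (triv₂ x)) (.comp (.id (triv₂ x)) (.id (triv₂ x)))) (.idV (triv₁ x))
      (triv₂ x))

theorem can_lcomp (x : B) : IsCan (triv (triv₂ x) (triv₁ x)) (triv (triv₂ x) (triv₂ x))
    (cellAt (lcomp (endo M).T (endo M).I ((endo M).α (endo M).I (endo M).I (endo M).I)
        ((endo M).l (tobj (endo M).T (endo M).I (endo M).I))).hom x) :=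
  IsCan.comp (.comp (.wr (.id (triv₂ x)) (triv₁ x)) (.wl (triv₂ x) (.inv (.ru (triv₁ x)))))
    (.paste (.id (triv₂ x)) (.idV (triv₁ x)) (triv₁ x))

/-- All components of both sides are canonical. -/
theorem endo_lamLeft_eq : (endo M).lamLeft = (endo M).lamRight := by
  apply Pseudofunctor.StrongTrans.homCategory.ext
  intro x
  have r := IsCan.comp (IsCan.inv' (can_rcomp M x) (cellAt_hom_inv _ x))
    (.comp (.wr (.id (triv₁ x)) _) (.wl (triv₁ x) (can_mid x)))
  have p := IsCan.comp (.wl (triv (triv₂ x) (triv₁ x))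
      (.comp (.wr (can_left x) (triv₁ x)) (.wl (triv₂ x) (.id (triv₁ x)))))
    (.comp (.as (triv₂ x) (triv₁ x) (triv (triv₂ x) (triv₁ x)))
    (.comp (.wl (triv₂ x) (.inv (.isoV (can_asIso x))))
    (.comp (.inv (.as (triv₂ x) (triv (triv₁ x) (triv₂ x)) (triv₁ x))) (.wr r (triv₁ x)))))
  have n : IsCan (triv (triv (triv₁ x) (triv₂ x)) (triv₁ x)) (triv (triv₁ x) (triv₂ x))
      (cellAt ((endo M).αnat₁ ((endo M).r (endo M).I) (endo M).I (endo M).I).hom x) :=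
    IsCan.comp (.isoV (can_asIso' x)) (.wl (triv₁ x)
      (.comp (.wr (.comp (.wr (.id (triv₁ x)) (triv₁ x)) (.ru (triv₁ x))) (triv₁ x))
        (.wl (triv₁ x) (.id (triv₁ x)))))
  have q := IsCan.comp (.wl (triv (triv₂ x) (triv₁ x)) (can_lcomp M x))
    (.comp (.inv (.as (triv (triv₂ x) (triv₁ x)) (triv₂ x) (triv₂ x)))
    (.comp (.wr (.as (triv₂ x) (triv₁ x) (triv₂ x)) (triv₂ x))
    (.comp (.wr (can_pent x) (triv₂ x))
    (.comp (.as (triv₁ x) (triv₁ x) (triv₂ x))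
    (.comp (.wl (triv₁ x) (can_mid' x))
      (.inv' n (cellAt_hom_inv
        ((endo M).αnat₁ ((endo M).r (endo M).I) (endo M).I (endo M).I) x)))))))
  exact IsCan.unique p q

theorem unitorRight_val {i : (Aut.mon M).r (Aut.mon M).I ≅ (Aut.mon M).l (Aut.mon M).I}
    {j : (endo M).r (endo M).I ≅ (endo M).l (endo M).I} (h : i.hom.1 = j.hom) :
    ((Aut.mon M).unitorRight i).1 = (endo M).unitorRight j := by
  obtain ⟨f, f', hf, hf'⟩ := j
  subst h
  rfl

theorem sub_eqToIso {A : Type u₁} [Bicategory.{w₁, v₁} A] {D : MonData A} {S : MonData.Cells A}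
    {a b : MonData.Sub D S} {f g : a ⟶ b} (h : f = g) :
    (eqToIso h).hom.1 = (eqToIso (congrArg Subtype.val h)).hom := by
  subst h; rfl

theorem aut_lamLeft_eq : (Aut.mon M).lamLeft = (Aut.mon M).lamRight :=
  Subtype.ext (endo_lamLeft_eq M)

theorem aut_unitorLeft_eq :
    (Aut.mon M).unitorLeft = (Aut.mon M).unitorRight (eqToIso (Aut.unitors M)) :=
  Subtype.ext (by
    exact (endo_unitorLeft_eq M).trans (unitorRight_val M (sub_eqToIso (Aut.unitors M))).symm)

theorem Wtd.lamLeft_eq {H : Type u} [CommGroup H] {N : MonData B} (Φ : MonFunData N (BB.mon H))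
    (h : N.lamLeft = N.lamRight) :
    (Wtd.mon N Φ).lamLeft = (Wtd.mon N Φ).lamRight := h

theorem Wtd.unitorLeft_eq {H : Type u} [CommGroup H] {N : MonData B} (Φ : MonFunData N (BB.mon H))
    {i : N.r N.I ≅ N.l N.I} (h : N.unitorLeft = N.unitorRight i) :
    (Wtd.mon N Φ).unitorLeft = (Wtd.mon N Φ).unitorRight (Wtd.ofIso i) := h

end Endo

/-! ### Normalising weights from the vanishing of second cohomology -/

/-- A 2-cocycle with trivial coefficients is a coboundary if the second cohomology vanishes. -/
theorem exists_coboundary {π : Type u₁} [Group π] {H : Type u₂} [CommGroup H]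
    (hH : Subsingleton (GroupH2 π H)) (z : π → π → H)
    (hz : ∀ g h k, z (g * h) k * z g h = z h k * z g (h * k)) :
    ∃ s : π → H, ∀ g h, z g h * s (g * h) = s g * s h := by
  let R := Rep.trivial (ULift.{max u₁ u₂} ℤ) (ULift.{u₂} π) (ULift.{u₁} (Additive H))
  let Z : groupCohomology.cocycles₂ R := ⟨fun p => ⟨Additive.ofMul (z p.1.down p.2.down)⟩,
    (groupCohomology.mem_cocycles₂_iff _).2 fun g h k =>
      ULift.ext _ _ (congrArg Additive.ofMul (hz g.down h.down k.down))⟩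
  have h0 : groupCohomology.H2π R Z = 0 := @Subsingleton.elim _ hH _ _
  obtain ⟨s, hs⟩ := (groupCohomology.H2π_eq_zero_iff Z).1 h0
  refine ⟨fun g => (s ⟨g⟩).down.toMul, fun g h => ?_⟩
  have := congrArg ULift.down (congrFun hs (⟨g⟩, ⟨h⟩))
  replace this : (s ⟨h⟩).down.toMul / (s ⟨g * h⟩).down.toMul * (s ⟨g⟩).down.toMul = z g h := this
  rw [← this]
  rw [mul_right_comm, div_mul_cancel, mul_comm]

namespace Wtd

section Sections

variable {K : Type u₁} [Bicategory.{w₁, v₁} K] {H : Type u} [CommGroup H] {S : K ⥤ᵖ BB H}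
  {a b c d : Wtd S}

/-- Two weighted 1-cells are related if there is a 2-cell of value one between them. -/
def Rel (P Q : a ⟶ b) : Prop := ∃ η : P ⟶ Q, n η = 1

/-- Multiplying the weight of a 1-cell by an element. -/
def scale (P : a ⟶ b) (h : H) : a ⟶ b := ⟨P.cell, P.wt * h⟩

theorem n_id (P : a ⟶ b) : n (𝟙 P) = 1 := by
  have := n_comp (𝟙 P) (𝟙 P)
  simpa using this

theorem Rel.of_eq {P Q : a ⟶ b} (h : P = Q) : Rel P Q := h ▸ ⟨𝟙 P, n_id P⟩

theorem Rel.trans {P Q R : a ⟶ b} (p : Rel P Q) (q : Rel Q R) : Rel P R :=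
  ⟨p.choose ≫ q.choose, by rw [n_comp, p.choose_spec, q.choose_spec, one_mul]⟩

theorem n_inv {P Q : a ⟶ b} (i : P ≅ Q) : n i.inv = (n i.hom)⁻¹ := by
  rw [eq_inv_iff_mul_eq_one, ← n_comp, i.inv_hom_id, n_id]

theorem Rel.of_iso {P Q : a ⟶ b} (i : P ≅ Q) (h : n i.hom = 1) : Rel P Q := ⟨i.hom, h⟩

theorem Rel.of_iso_symm {P Q : a ⟶ b} (i : P ≅ Q) (h : n i.hom = 1) : Rel Q P :=
  ⟨i.inv, by rw [n_inv, h, inv_one]⟩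

theorem Rel.comp {P P' : a ⟶ b} {Q Q' : b ⟶ c} (p : Rel P P') (q : Rel Q Q') :
    Rel (P ≫ Q) (P' ≫ Q') :=
  ⟨p.choose ▷ Q ≫ P' ◁ q.choose, by
    rw [n_comp, n_whiskerRight, n_whiskerLeft, p.choose_spec, q.choose_spec, one_mul]⟩

theorem Rel.assoc (P : a ⟶ b) (Q : b ⟶ c) (R : c ⟶ d) : Rel ((P ≫ Q) ≫ R) (P ≫ Q ≫ R) :=
  .of_iso _ (n_associator P Q R)

theorem Rel.assoc' (P : a ⟶ b) (Q : b ⟶ c) (R : c ⟶ d) : Rel (P ≫ Q ≫ R) ((P ≫ Q) ≫ R) :=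
  .of_iso_symm _ (n_associator P Q R)

theorem scale_comp (P : a ⟶ b) (Q : b ⟶ c) (h : H) : scale P h ≫ Q = scale (P ≫ Q) h :=
  congrArg (Hom.mk (P.cell ≫ Q.cell)) (by
    change BB.val (S.mapComp P.cell Q.cell).hom * (P.wt * h * Q.wt) =
      BB.val (S.mapComp P.cell Q.cell).hom * (P.wt * Q.wt) * h
    rw [mul_right_comm P.wt]
    exact (mul_assoc _ _ _).symm)

theorem comp_scale (P : a ⟶ b) (Q : b ⟶ c) (h : H) : P ≫ scale Q h = scale (P ≫ Q) h :=
  congrArg (Hom.mk (P.cell ≫ Q.cell)) (by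
    change BB.val (S.mapComp P.cell Q.cell).hom * (P.wt * (Q.wt * h)) =
      BB.val (S.mapComp P.cell Q.cell).hom * (P.wt * Q.wt) * h
    rw [mul_assoc, mul_assoc])

theorem scale_scale (P : a ⟶ b) (h k : H) : scale (scale P h) k = scale P (h * k) :=
  congrArg (Hom.mk P.cell) (mul_assoc _ _ _)

theorem scale_one (P : a ⟶ b) : scale P 1 = P := congrArg (Hom.mk P.cell) (mul_one _)

theorem Rel.scale {P Q : a ⟶ b} (p : Rel P Q) (h : H) : Rel (scale P h) (scale Q h) := by
  obtain ⟨η, p⟩ := p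
  refine ⟨η, ?_⟩
  change (P.wt * h)⁻¹ * BB.val (S.map₂ (f := P.cell) (g := Q.cell) η) * (Q.wt * h) = 1
  change P.wt⁻¹ * BB.val (S.map₂ (f := P.cell) (g := Q.cell) η) * Q.wt = 1 at p
  rw [mul_inv_rev, mul_assoc h⁻¹, mul_assoc h⁻¹, ← mul_assoc _ Q.wt h, p, one_mul, inv_mul_cancel]

/-- A 2-cell of any value becomes one of value `1` when the weight of its target is corrected. -/
theorem exists_scale {P Q : a ⟶ b} (η : P.cell ⟶ Q.cell) : ∃ h, Rel P (Wtd.scale Q h) := by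
  refine ⟨(n (f := P) (g := Q) η)⁻¹, η, ?_⟩
  change P.wt⁻¹ * BB.val (S.map₂ η) * (Q.wt * (P.wt⁻¹ * BB.val (S.map₂ η) * Q.wt)⁻¹) = 1
  rw [← mul_assoc, mul_inv_cancel]

section Thin

variable (thin : ∀ {x y : K} {f g : x ⟶ y} (η θ : f ⟶ g), η = θ)

include thin

/-- If there is at most one 2-cell, the only 2-cell from a 1-cell to itself is the identity, and a
1-cell has at most one weight in a class of related 1-cells. -/
theorem Rel.wt_eq {f : a.val ⟶ b.val} {s t : H} (p : Rel (a := a) (b := b) ⟨f, s⟩ ⟨f, t⟩) :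
    s = t := by
  obtain ⟨η, p⟩ := p
  have h1 : s⁻¹ * 1 * t = 1 := by
    refine Eq.trans ?_ p
    refine congrArg (fun x => s⁻¹ * x * t) ?_
    exact (congrArg BB.val (S.map₂_id f)).symm.trans
      (congrArg (fun x => BB.val (S.map₂ x)) (thin _ _))
  rw [mul_one] at h1
  exact inv_mul_eq_one.1 h1

theorem Rel.scale_eq {P : a ⟶ b} {h k : H} (p : Rel (Wtd.scale P h) (Wtd.scale P k)) : h = k :=
  mul_left_cancel (Rel.wt_eq thin p)

theorem Rel.cancel {P : a ⟶ b} {Q Q' : b ⟶ c} (p : Rel (P ≫ Q) (P ≫ Q')) (η : Q.cell ⟶ Q'.cell) :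
    Rel Q Q' := by
  obtain ⟨θ, p⟩ := p
  refine ⟨η, ?_⟩
  rw [← n_whiskerLeft P (g := Q) (h := Q') η, ← p]
  exact congrArg n (thin _ _)

end Thin

end Sections

section Existence

variable {K : Type u₁} [Bicategory.{w₁, v₁} K] {H : Type u} [CommGroup H] (S : K ⥤ᵖ BB H)

/-- Let `K` be a connected bicategory with invertible 1-cells and at most one 2-cell between two
1-cells, such that the classes of loops at `e` form a group `π` with `H² = 0`. For a pseudofunctor
`S` to `BB H` there are weights of the 1-cells of `K` which make its structure cells and images of
2-cells of value `1`. Related weighted loops multiply up to a 2-cocycle `z` of `π`; a cochain with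
coboundary `z` gives weights of the loops, and 1-cells `γ x` out of `e` transport them to all
1-cells. -/
theorem exists_weights (thin : ∀ {x y : K} {f g : x ⟶ y} (η θ : f ⟶ g), η = θ)
    (hiso : ∀ {x y : K} {f g : x ⟶ y}, (f ⟶ g) → Nonempty (g ⟶ f)) (e : K) (γ : ∀ x, e ⟶ x)
    (hinv : ∀ {x y : K} (f : x ⟶ y), ∃ g : y ⟶ x, Nonempty (f ≫ g ⟶ 𝟙 x) ∧ Nonempty (g ≫ f ⟶ 𝟙 y))
    {π : Type u₂} [Group π] (c : (e ⟶ e) → π) (hc : ∀ {f g}, Nonempty (f ⟶ g) ↔ c f = c g)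
    (hmul : ∀ f g, c (f ≫ g) = c g * c f) (hsurj : Function.Surjective c)
    (hH : Subsingleton (GroupH2 π H)) :
    ∃ t : ∀ {x y : K}, (x ⟶ y) → H,
      (∀ {x y : K} {f g : x ⟶ y} (η : f ⟶ g), (t f)⁻¹ * BB.val (S.map₂ η) * t g = 1) ∧
      (∀ {x y z : K} (f : x ⟶ y) (g : y ⟶ z),
        t (f ≫ g) = BB.val (S.mapComp f g).hom * (t f * t g)) ∧
      ∀ x : K, t (𝟙 x) = BB.val (S.mapId x).hom := by
  choose l hl using hsurj
  let o (x : K) : Wtd S := ⟨x⟩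
  let L₀ (g : π) : o e ⟶ o e := ⟨l g, 1⟩
  -- The loops `l g` with weight `1` multiply up to a 2-cocycle `z`.
  have hz (g h : π) : ∃ z, Rel (L₀ h ≫ L₀ g) (scale (L₀ (g * h)) z) :=
    exists_scale (hc.2 (by rw [comp_cell, hmul, hl, hl, hl])).some
  choose z hz using hz
  have rsymm {a b : Wtd S} {P Q : a ⟶ b} (p : Rel P Q) : Rel Q P := by
    obtain ⟨η, p⟩ := p
    obtain ⟨θ⟩ := hiso (f := P.cell) (g := Q.cell) η
    exact ⟨θ, by
      have : n (f := P) (g := Q) η * n (f := Q) (g := P) θ = 1 := by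
        rw [← n_comp, ← n_id P]; exact congrArg n (thin _ _)
      rwa [p, one_mul] at this⟩
  have hcoc (g h k : π) : z (g * h) k * z g h = z h k * z g (h * k) := by
    have h1 : Rel ((L₀ k ≫ L₀ h) ≫ L₀ g) (scale (L₀ (g * (h * k))) (z g (h * k) * z h k)) :=
      ((hz h k).comp (.of_eq rfl)).trans (.trans (.of_eq (scale_comp _ _ _))
        (((hz g (h * k)).scale _).trans (.of_eq (scale_scale _ _ _))))
    have h2 : Rel (L₀ k ≫ L₀ h ≫ L₀ g) (scale (L₀ (g * h * k)) (z (g * h) k * z g h)) :=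
      (Rel.comp (.of_eq rfl) (hz g h)).trans (.trans (.of_eq (comp_scale _ _ _))
        (((hz (g * h) k).scale _).trans (.of_eq (scale_scale _ _ _))))
    rw [mul_assoc] at h2
    rw [mul_comm (z h k)]
    exact Rel.scale_eq thin ((rsymm h2).trans ((Rel.assoc' _ _ _).trans h1))
  obtain ⟨s, hs⟩ := exists_coboundary hH z hcoc
  -- Rescaled by the inverse of a cochain with coboundary `z` they multiply strictly.
  let L (g : π) : o e ⟶ o e := scale (L₀ g) (s g)⁻¹
  have hL (g h : π) : Rel (L h ≫ L g) (L (g * h)) := by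
    refine .trans (.of_eq ((scale_comp _ _ _).trans (congrArg (scale · _) (comp_scale _ _ _)))) ?_
    refine .trans (((hz g h).scale _).scale _) (.of_eq ?_)
    rw [scale_scale, scale_scale]
    refine congrArg (scale _) ?_
    have := hs g h
    rw [← mul_inv, ← div_eq_mul_inv, ← this, div_mul_cancel_left]
  let Γ (x : K) : o e ⟶ o x := ⟨γ x, 1⟩
  -- The weight `t f` of `f : x ⟶ y` is the one for which `γ x ≫ f`, where `γ x` and `γ y` have
  -- weight `1`, is related to `L g ≫ γ y` for some `g`. Both `g` and the weight are determined by
  -- `f`: this is what `hr` and `ht'` below say.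
  have ht {x y : K} (f : x ⟶ y) : ∃ t g, Rel (Γ x ≫ (⟨f, t⟩ : o x ⟶ o y)) (L g ≫ Γ y) := by
    obtain ⟨δ, -, ⟨i⟩⟩ := hinv (γ y)
    obtain ⟨i'⟩ := hiso i
    obtain ⟨j⟩ := hc.2 (hl (c ((γ x ≫ f) ≫ δ))).symm
    obtain ⟨h, r⟩ := exists_scale (P := Γ x ≫ (⟨f, 1⟩ : o x ⟶ o y))
      (Q := L (c ((γ x ≫ f) ≫ δ)) ≫ Γ y)
      ((ρ_ (γ x ≫ f)).inv ≫ (γ x ≫ f) ◁ i' ≫ (α_ _ _ _).inv ≫ j ▷ γ y)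
    refine ⟨1 * h⁻¹, c ((γ x ≫ f) ≫ δ), ?_⟩
    refine .trans (.of_eq (comp_scale (Γ x) (⟨f, 1⟩ : o x ⟶ o y) h⁻¹)) ?_
    refine (r.scale h⁻¹).trans (.of_eq ?_)
    rw [scale_scale, mul_inv_cancel, scale_one]
  choose t c' ht using @ht
  have hu {y : K} {g g' : π} (j : l g ≫ γ y ⟶ l g' ≫ γ y) : g = g' := by
    obtain ⟨δ, ⟨i⟩, -⟩ := hinv (γ y)
    obtain ⟨i'⟩ := hiso i
    rw [← hl g, ← hl g']
    exact hc.1 ⟨(ρ_ _).inv ≫ l g ◁ i' ≫ (α_ _ _ _).inv ≫ j ▷ δ ≫ (α_ _ _ _).hom ≫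
      l g' ◁ i ≫ (ρ_ _).hom⟩
  have hr {x y : K} {f f' : x ⟶ y} {t t' : H} {g g' : π} (η : f ⟶ f')
      (p : Rel (Γ x ≫ (⟨f, t⟩ : o x ⟶ o y)) (L g ≫ Γ y))
      (p' : Rel (Γ x ≫ (⟨f', t'⟩ : o x ⟶ o y)) (L g' ≫ Γ y)) :
      Rel (⟨f, t⟩ : o x ⟶ o y) ⟨f', t'⟩ := by
    have e : g = g' := by
      obtain ⟨j, -⟩ := rsymm p
      obtain ⟨j', -⟩ := p'
      have j : l g ≫ γ y ⟶ γ x ≫ f := j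
      have j' : γ x ≫ f' ⟶ l g' ≫ γ y := j'
      exact hu (j ≫ γ x ◁ η ≫ j')
    subst e
    exact (p.trans (rsymm p')).cancel thin η
  have ht' {x y : K} {f : x ⟶ y} {t' : H} {g : π}
      (p : Rel (Γ x ≫ (⟨f, t'⟩ : o x ⟶ o y)) (L g ≫ Γ y)) : t f = t' :=
    (hr (𝟙 f) (ht f) p).wt_eq thin
  refine ⟨t, fun {x y f f'} η => ?_, fun {x y w} f f' => ?_, fun x => ?_⟩
  · obtain ⟨θ, h⟩ := hr η (ht f) (ht f')
    rw [thin η θ]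
    exact h
  · refine ht' (g := c' f' * c' f) ?_
    refine (Rel.assoc' (Γ x) (⟨f, t f⟩ : o x ⟶ o y) (⟨f', t f'⟩ : o y ⟶ o w)).trans ?_
    refine ((ht f).comp (.of_eq rfl)).trans ((Rel.assoc _ _ _).trans ?_)
    refine (Rel.comp (.of_eq rfl) (ht f')).trans ((Rel.assoc' _ _ _).trans ?_)
    exact (hL _ _).comp (.of_eq rfl)
  · refine ht' (g := 1) ?_
    have h1 : c (𝟙 e) = 1 := by
      have := hmul (𝟙 e) (𝟙 e)
      rw [hc.1 ⟨(λ_ (𝟙 e)).hom⟩] at this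
      simpa using this
    have h2 : Rel (L 1) (𝟙 (o e)) := by
      refine Rel.cancel thin (P := L 1) ?_ (hc.2 ((hl 1).trans h1.symm)).some
      have := hL 1 1
      rw [mul_one] at this
      exact this.trans (.of_iso_symm (ρ_ (L 1)) (n_rightUnitor _))
    refine (Rel.of_iso (ρ_ (Γ x)) (n_rightUnitor _)).trans ?_
    refine (Rel.of_iso_symm (λ_ (Γ x)) (n_leftUnitor _)).trans ?_
    exact (rsymm h2).comp (.of_eq rfl)

end Existence

end Wtd

/-! ### The fundamental 2-groupoid -/

namespace Pi2

open unitInterval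

section

variable {X : Type u} [TopologicalSpace X]

theorem nonempty_hom₂_iff {x y : Pi2 X} {f g : x ⟶ y} :
    Nonempty (f ⟶ g) ↔ f.as.Homotopic g.as := by
  constructor
  · rintro ⟨η⟩
    induction η using ind with | h U
    exact ⟨{ toFun := fun p => U p.1 p.2
             continuous_toFun := by fun_prop
             map_zero_left := by simp
             map_one_left := by simp
             prop' := by rintro t s (rfl | rfl) <;> simp }⟩
  · rintro ⟨F⟩
    exact ⟨pc { toFun := F.eval
                continuous_toFun := by
                  rw [← Path.continuous_uncurry_iff]
                  exact F.continuous
                source' := F.eval_zero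
                target' := F.eval_one }⟩

theorem nonempty_hom [PathConnectedSpace X] (x y : Pi2 X) : Nonempty (x ⟶ y) :=
  ⟨⟨(PathConnectedSpace.joined x.pt y.pt).somePath⟩⟩

theorem exists_inverse {x y : Pi2 X} (f : x ⟶ y) :
    ∃ g : y ⟶ x, Nonempty (f ≫ g ⟶ 𝟙 x) ∧ Nonempty (g ≫ f ⟶ 𝟙 y) :=
  ⟨⟨f.as.symm⟩, nonempty_hom₂_iff.2 ⟨(Path.Homotopy.reflTransSymm f.as).symm⟩,
    nonempty_hom₂_iff.2 ⟨(Path.Homotopy.reflSymmTrans f.as).symm⟩⟩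

theorem pc_eq_iff {x y : X} {f g : Path x y} : pc f = pc g ↔ f.Homotopic g :=
  Path.Homotopic.Quotient.eq

end

section

variable {G : Type uG} [Group G] [TopologicalSpace G] [IsTopologicalGroup G]

/-- In a topological group, translating a homotopy from `f` to `f` by the inverse of `f` gives a
map of the square that is constant on the boundary. It is null homotopic since `π₂` is trivial at
the unit. -/
theorem homotopic_refl (hG : Subsingleton (HomotopyGroup.Pi 2 G 1)) {x y : G} {f : Path x y}
    (U : Path f f) : U.Homotopic (Path.refl f) := by
  -- `U` is constant at `x` and `y` on two sides of the square and equal to `f` on the other two.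
  let q : GenLoop (Fin 2) G 1 := ⟨⟨fun t => U (t 0) (t 1) * (f (t 1))⁻¹, by fun_prop⟩, by
    rintro t ⟨i, hi⟩
    fin_cases i <;> rcases hi with hi | hi <;> simp_all⟩
  obtain ⟨F⟩ : GenLoop.Homotopic q GenLoop.const :=
    Quotient.exact (Subsingleton.elim (α := HomotopyGroup.Pi 2 G 1) ⟦q⟧ ⟦GenLoop.const⟧)
  have hF (r s t : I) (h : s = 0 ∨ s = 1 ∨ t = 0 ∨ t = 1) : F (r, ![s, t]) = U s t * (f t)⁻¹ := by
    exact F.eq_fst r (by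
      rcases h with h | h | h | h
      exacts [⟨0, .inl h⟩, ⟨0, .inr h⟩, ⟨1, .inl h⟩, ⟨1, .inr h⟩])
  have hc : Continuous fun b : (I × I) × I => F (b.1.1, ![b.1.2, b.2]) * f b.2 := by
    refine (F.continuous.comp (.prodMk (by fun_prop) (continuous_pi fun i => ?_))).mul (by fun_prop)
    fin_cases i <;> simp <;> fun_prop
  refine ⟨{ toFun := fun a =>
              { toFun := fun t => F (a.1, ![a.2, t]) * f t
                continuous_toFun := hc.comp (.prodMk (continuous_const (y := a)) continuous_id)
                source' := by simp [hF]
                target' := by simp [hF] }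
            continuous_toFun := ?_
            map_zero_left := ?_
            map_one_left := ?_
            prop' := ?_ }⟩
  · rw [← Path.continuous_uncurry_iff]
    exact hc
  · intro s
    ext t
    exact (congrArg (· * f t) (F.apply_zero _)).trans (inv_mul_cancel_right _ _)
  · intro s
    ext t
    exact (congrArg (· * f t) (F.apply_one _)).trans (one_mul _)
  · rintro r s (rfl | rfl)
    · ext t; simp [hF]
    · ext t; simp [hF]

/-- If `π₂` is trivial, parallel 2-cells of the fundamental 2-groupoid are equal. -/
theorem thin (hG : Subsingleton (HomotopyGroup.Pi 2 G 1)) {x y : Pi2 G} {f g : x ⟶ y}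
    (η θ : f ⟶ g) : η = θ := by
  have h : η ≫ Groupoid.inv θ = 𝟙 f := by
    generalize η ≫ Groupoid.inv θ = ζ
    induction ζ using ind with | h U
    exact pc_eq_iff.2 (homotopic_refl hG U)
  rw [← Category.comp_id η, ← Groupoid.inv_comp θ, ← Category.assoc, h, Category.id_comp]

/-- The 1-cells of the fundamental 2-groupoid have weights which normalise a given pseudofunctor to
`BB H`. -/
theorem exists_weights [PathConnectedSpace G] {H : Type uH} [CommGroup H]
    (hG : Subsingleton (HomotopyGroup.Pi 2 G 1))
    (hH : Subsingleton (GroupH2 (FundamentalGroup G 1) H)) (S : Pi2 G ⥤ᵖ BB H) :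
    ∃ t : ∀ {x y : Pi2 G}, (x ⟶ y) → H,
      (∀ {x y : Pi2 G} {f g : x ⟶ y} (η : f ⟶ g), (t f)⁻¹ * BB.val (S.map₂ η) * t g = 1) ∧
      (∀ {x y z : Pi2 G} (f : x ⟶ y) (g : y ⟶ z),
        t (f ≫ g) = BB.val (S.mapComp f g).hom * (t f * t g)) ∧
      ∀ x : Pi2 G, t (𝟙 x) = BB.val (S.mapId x).hom :=
  Wtd.exists_weights (π := FundamentalGroup G 1) S (thin hG) (fun η => ⟨Groupoid.inv η⟩) ⟨1⟩
    (fun x => (nonempty_hom _ x).some) exists_inverse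
    (c := fun f : (⟨1⟩ : Pi2 G) ⟶ ⟨1⟩ => (pc f.as : FundamentalGroup G 1))
    (nonempty_hom₂_iff.trans pc_eq_iff.symm) (fun _ _ => rfl)
    (fun g => by
      obtain ⟨f, hf⟩ := Quotient.exists_rep g
      exact ⟨⟨f⟩, hf⟩) hH

end

end Pi2

/-! ### Trivialising a monoidal functor over `B²H` -/

namespace Wtd

variable {A : Type u₁} [Bicategory.{w₁, v₁} A] {N : MonData A} {H : Type u} [CommGroup H]
  {D : Type u₂} [Bicategory.{w₂, v₂} D] {M : MonData D}

/-- A monoidal functor `X` to a monoidal bicategory which is biequivalent to `B²H` by `Φ` is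
equivalent to the trivial one if the composite of `X` with `Φ` has normalising weights. -/
theorem exists_toTrivial {Φ : MonFunData N (BB.mon H)} (hΦ : Φ.IsMonoidal)
    (hb : IsBiequivalence Φ.F) {i : N.r N.I ≅ N.l N.I} (hl : N.lamLeft = N.lamRight)
    (hi : N.unitorLeft = N.unitorRight i) {X : MonFunData M N} (hX : X.IsMonoidal)
    (t : ∀ {x y : D}, (x ⟶ y) → H)
    (ht₂ : ∀ {x y : D} {f g : x ⟶ y} (η : f ⟶ g),
      (t f)⁻¹ * BB.val (Φ.F.map₂ (X.F.map₂ η)) * t g = 1)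
    (htc : ∀ {x y z : D} (f : x ⟶ y) (g : y ⟶ z), t (f ≫ g) =
      BB.val (Φ.F.map₂ (X.F.mapComp f g).hom) *
        BB.val (Φ.F.mapComp (X.F.map f) (X.F.map g)).hom * (t f * t g))
    (hti : ∀ x : D, t (𝟙 x) =
      BB.val (Φ.F.map₂ (X.F.mapId x).hom) * BB.val (Φ.F.mapId (X.F.obj x)).hom)
    (hD : ∀ a b : D, Nonempty (a ⟶ b))
    (hinv : ∀ {a b : D} (f : a ⟶ b), ∃ g : b ⟶ a, Nonempty (f ≫ g ≅ 𝟙 a)) :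
    ∃ θ : MonTransData X (MonFunData.trivial M N i), θ.IsMonoidal ∧ θ.IsInvertible := by
  have hA (a b : Wtd Φ.F) : Nonempty (a ⟶ b) :=
    ⟨⟨(hb.full (𝟙 (BB.mon H).I : Φ.F.obj a.val ⟶ Φ.F.obj b.val)).choose, 1⟩⟩
  let V : StrictVal (mon N Φ) H := strictVal hΦ hb.bij
  have hF : V.Normal (lift Φ X t).F :=
    { map₂ := fun η => ht₂ η
      mapId := fun a => by
        change (t (𝟙 a))⁻¹ * BB.val (Φ.F.map₂ (X.F.mapId a).hom) *
          BB.val (Φ.F.mapId (X.F.obj a)).hom = 1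
        rw [mul_assoc, ← hti, inv_mul_cancel]
      mapComp := fun f g => by
        change (t (f ≫ g))⁻¹ * BB.val (Φ.F.map₂ (X.F.mapComp f g).hom) *
          (BB.val (Φ.F.mapComp (X.F.map f) (X.F.map g)).hom * (t f * t g)) = 1
        rw [mul_assoc, ← mul_assoc (BB.val _), ← htc, inv_mul_cancel] }
  have hl := StrictVal.has_lam (V := V) (lamLeft_eq Φ hl)
  obtain ⟨θ, hθ⟩ := StrictVal.exists_toTrivial (V := V) (X := lift Φ X t) hA
    (lift_isMonoidal hX t (V.isEquiv₁ hA)) hF (ofIso i)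
    (StrictVal.has_unitor hl (unitorLeft_eq Φ hi)) hl hD hinv
  refine ⟨descend θ, descend_isMonoidal hθ, fun a => ?_⟩
  obtain ⟨e, he⟩ := V.isEquiv₁ hA (θ.app a)
  exact ⟨Equivalence.mkOfAdjointifyCounit (toIso e.unit) (toIso e.counit), congrArg Hom.cell he⟩

end Wtd

end MonBicat

end

theorem mainTheorem6 {C : Type u} [Bicategory.{w, v} C] (M : MonData C)
    (hM : M.IsMonoidal) (G : Type uG) [Group G] [TopologicalSpace G] [IsTopologicalGroup G]
    [PathConnectedSpace G] (hG : ∀ x : G, Subsingleton (HomotopyGroup.Pi 2 G x))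
    (H : Type uH) [CommGroup H]
    (hC : ∃ Φ : MonFunData (Aut.mon M) (BB.mon H), Φ.IsMonoidal ∧ IsBiequivalence Φ.F)
    (hH : Subsingleton (GroupH2 (FundamentalGroup G 1) H))
    (ρ : MonFunData (Pi2.mon G) (Aut.mon M)) (hρ : ρ.IsMonoidal) :
    ∃ θ : MonTransData ρ (trivialAction M G), θ.IsMonoidal ∧ θ.IsInvertible := by
  obtain ⟨Φ, hΦ, hb⟩ := hC
  obtain ⟨t, ht₂, htc, hti⟩ := Pi2.exists_weights (hG 1) hH (ρ.F.comp Φ.F)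
  exact Wtd.exists_toTrivial hΦ hb (aut_lamLeft_eq M) (aut_unitorLeft_eq M) hρ t ht₂ htc hti
    Pi2.nonempty_hom fun f => by
      obtain ⟨g, ⟨η⟩, -⟩ := Pi2.exists_inverse f
      exact ⟨g, ⟨Pi2.ic η⟩⟩
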